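/- All logarithms are to base 2 and rates are in bits per channel use. The Gaussian interference channel with a cognitive relay has complex inputs $X_1,X_2,X_0$ and outputs $$Y_1=|h_{11}|X_1+|h_{10}|X_0+h_{12}X_2+Z_1,\qquad Y_2=h_{21}X_1+|h_{20}|X_0+|h_{22}|X_2+Z_2,$$ with fixed gains $h_{ij}\in\mathbb C$, memoryless noises $Z_1,Z_2$ that are independent proper complex Gaussians of mean $0$ and variance $1$, and power constraints $\mathbb E|X_i|^2\le 1$, $i\in\{0,1,2\}$ (averaged over the time indices and over the messages). Source $i\in\{1,2\}$ encodes its message $W_i$, the messages being independent and uniformly distributed; the relay encodes $(W_1,W_2)$ into $X_0^n$; receiver $i$ decodes $W_i$ from $Y_i^n$. The capacity region is the closed convex hull of the set of non-negative rate pairs $(R_1,R_2)$ for which there are codes whose two error probabilities tend to $0$ as $n\to\infty$. Put $V_1=h_{21}X_1+Z_2$, $V_2=h_{12}X_2+Z_1$, $\widetilde V_1=h_{21}X_1+\widetilde Z_2$, $\widetilde V_2=h_{12}X_2+\widetilde Z_1$, where $\widetilde Z_1,\widetilde Z_2$ are copies of $Z_1,Z_2$ and $\widetilde Z_1,\widetilde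 Z_2,Z_1,Z_2,(Q,X_1,X_2,X_0)$ are independent. Let $h(\cdot\,|\,\cdot)$ be conditional differential entropy and $$\mathsf{MLP}_2=\log(1+\min\{|h_{12}|^2,|h_{10}|^2\})+\log(1+\min\{|h_{21}|^2,|h_{20}|^2\})+2\log 2 .$$ Let $\mathcal O$ be the set of non-negative pairs $(R_1,R_2)$ for which there is a law of $(Q,X_1,X_2,X_0)$, with $Q$ in some standard Borel space, that factors as $P_QP_{X_1|Q}P_{X_2|Q}P_{X_0|X_1,X_2,Q}$, satisfies $\mathbb E|X_i|^2\le1$ for $i\in\{0,1,2\}$, and is such that $$\begin{aligned} R_1&\le I(Y_1;X_1,X_0|Q,X_2),\qquad R_2\le I(Y_2;X_2,X_0|Q,X_1),\\ R_1+R_2&\le I(Y_2;X_1,X_2,X_0|Q)+I(Y_1;X_1,X_0|Q,\bar Y_2,X_2),\\ R_1+R_2&\le I(Y_1;X_1,X_2,X_0|Q)+I(Y_2;X_2,X_0|Q,\bar Y_1,X_1),\\ R_1+R_2&\le h(Y_1|\widetilde V_1,Q)-h(\widetilde V_2|X_2)+h(Y_2|\widetilde V_2,Q)-h(\widetilde V_1|X_1)+\mathsf{MLP}_2,\\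 2R_1+R_2&\le -h(\widetilde V_1|X_1)-2h(V_2|X_2)+h(Y_1|Q)+h(Y_1|\widetilde V_1,X_2,Q)+h(Y_2|\widetilde V_2,Q)+\mathsf{MLP}_2,\\ R_1+2R_2&\le -h(\widetilde V_2|X_2)-2h(V_1|X_1)+h(Y_2|Q)+h(Y_2|\widetilde V_2,X_1,Q)+h(Y_1|\widetilde V_1,Q)+\mathsf{MLP}_2. \end{aligned}$$ Here the third and fourth bounds are required for all joint conditional laws, given $(X_1,X_2,X_0)$ and not depending on $Q$, of $(Y_1,\bar Y_2)$, respectively $(\bar Y_1,Y_2)$, in which $Y_i$ and $\bar Y_i$ have the conditional law of the $i$-th channel output given $(X_1,X_2,X_0)$. Then the capacity region is contained in $\mathcal O$. Moreover $\mathcal O$ is exhausted by jointly Gaussian inputs: every pair in $\mathcal O$ satisfies all these bounds for some admissible law with $Q$ constant and $(X_1,X_2,X_0)$ zero-mean, proper complex, jointly Gaussian. -/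

import Mathlib

open MeasureTheory ProbabilityTheory Filter Topology
open scoped ENNReal

noncomputable section

namespace ICCR

/-! ### Information measures (in bits) -/

/-- Differential entropy, in bits, of a law on `ℂ ≃ ℝ²`: minus the expectation of the base-2
logarithm of the Lebesgue density. -/
def diffEntropy (ν : Measure ℂ) : ℝ :=
  -∫ a, Real.logb 2 (ν.rnDeriv volume a).toReal ∂ν

/-- Conditional differential entropy `h(A | C)` in bits: the average over the law of `C` of the
differential entropy of the conditional law of `A` given `C = c`. -/
def condEntropy {Ω γ : Type*} [MeasurableSpace Ω] [MeasurableSpace γ]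
    (P : Measure Ω) [IsFiniteMeasure P] (A : Ω → ℂ) (C : Ω → γ) : ℝ :=
  ∫ c, diffEntropy (condDistrib A C P c) ∂(P.map C)

/-- Conditional mutual information `I(A ; B | C)` in bits (possibly infinite): the relative entropy
of the law of `(C, A, B)` with respect to the law that has the same marginals on `(C, A)` and on
`(C, B)` and makes `A` and `B` conditionally independent given `C`. -/
def condMutualInfo {Ω α β γ : Type*} [MeasurableSpace Ω] [MeasurableSpace α]
    [StandardBorelSpace α] [Nonempty α] [MeasurableSpace β] [StandardBorelSpace β] [Nonempty β]
    [MeasurableSpace γ] (P : Measure Ω) [IsFiniteMeasure P]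
    (A : Ω → α) (B : Ω → β) (C : Ω → γ) : ℝ≥0∞ :=
  InformationTheory.klDiv (P.map (fun ω => (C ω, A ω, B ω)))
    ((P.map C) ⊗ₘ (condDistrib A C P ×ₖ condDistrib B C P)) / ENNReal.ofReal (Real.log 2)

/-! ### Complex Gaussian laws -/

/-- The proper (circularly symmetric) complex Gaussian law with mean `0` and variance `1`: real and
imaginary parts are independent real Gaussians of variance `1/2`. -/
def stdComplexGaussian : Measure ℂ :=
  ((gaussianReal 0 (1 / 2)).prod (gaussianReal 0 (1 / 2))).map
    (fun p : ℝ × ℝ => (p.1 : ℂ) + (p.2 : ℂ) * Complex.I)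

instance : IsProbabilityMeasure stdComplexGaussian :=
  Measure.isProbabilityMeasure_map (by fun_prop)

/-- A zero-mean proper complex jointly Gaussian law on `ℂ³`: the law of `M W`, where the three
entries of `W` are independent standard complex Gaussians and `M` is a complex matrix (its
covariance matrix is `M Mᴴ`). -/
def IsProperGaussian (ν : Measure (ℂ × ℂ × ℂ)) : Prop :=
  ∃ M : Matrix (Fin 3) (Fin 3) ℂ,
    ν = (Measure.pi fun _ : Fin 3 => stdComplexGaussian).map
      (fun w => ((M.mulVec w) 0, (M.mulVec w) 1, (M.mulVec w) 2))

/-! ### The Gaussian interference channel with a cognitive relay -/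

/-- The channel gains. -/
structure Gains where
  h11 : ℂ
  h10 : ℂ
  h12 : ℂ
  h21 : ℂ
  h20 : ℂ
  h22 : ℂ

/-- Noiseless part of the first output for the channel inputs `x = (x₁, x₂, x₀)`. -/
def Gains.signal1 (g : Gains) (x : ℂ × ℂ × ℂ) : ℂ :=
  (‖g.h11‖ : ℂ) * x.1 + (‖g.h10‖ : ℂ) * x.2.2 + g.h12 * x.2.1

/-- Noiseless part of the second output for the channel inputs `x = (x₁, x₂, x₀)`. -/
def Gains.signal2 (g : Gains) (x : ℂ × ℂ × ℂ) : ℂ :=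
  g.h21 * x.1 + (‖g.h20‖ : ℂ) * x.2.2 + (‖g.h22‖ : ℂ) * x.2.1

/-- Law of the pair of outputs `(Y₁, Y₂)` in one channel use with inputs `x = (x₁, x₂, x₀)`. -/
def Gains.channelLaw (g : Gains) (x : ℂ × ℂ × ℂ) : Measure (ℂ × ℂ) :=
  (stdComplexGaussian.prod stdComplexGaussian).map
    (fun z => (g.signal1 x + z.1, g.signal2 x + z.2))

/-! ### Codes and capacity region -/

/-- A code of length `n` with `2 ^ k₁` and `2 ^ k₂` messages: the sources know their own message,
the relay knows both messages, and each receiver observes its own output. -/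
structure Code (n k₁ k₂ : ℕ) where
  enc1 : Fin (2 ^ k₁) → Fin n → ℂ
  enc2 : Fin (2 ^ k₂) → Fin n → ℂ
  enc0 : Fin (2 ^ k₁) → Fin (2 ^ k₂) → Fin n → ℂ
  dec1 : (Fin n → ℂ) → Fin (2 ^ k₁)
  dec2 : (Fin n → ℂ) → Fin (2 ^ k₂)
  measurable_dec1 : Measurable dec1
  measurable_dec2 : Measurable dec2

namespace Code

variable {n k₁ k₂ : ℕ}

/-- The inputs `(x₁, x₂, x₀)` at time `t` for the messages `(w₁, w₂)`. -/
def input (c : Code n k₁ k₂) (w₁ : Fin (2 ^ k₁)) (w₂ : Fin (2 ^ k₂)) (t : Fin n) : ℂ × ℂ × ℂ :=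
  (c.enc1 w₁ t, c.enc2 w₂ t, c.enc0 w₁ w₂ t)

/-- Expectation over independent, uniformly distributed messages. -/
def messageAverage (k₁ k₂ : ℕ) (f : Fin (2 ^ k₁) → Fin (2 ^ k₂) → ℝ) : ℝ :=
  (∑ w₁, ∑ w₂, f w₁ w₂) / ((2 : ℝ) ^ k₁ * (2 : ℝ) ^ k₂)

/-- Average (over time and over the messages) power at most one for each of the three inputs. -/
def PowerConstraint (c : Code n k₁ k₂) : Prop :=
  messageAverage k₁ k₂ (fun w₁ _ => ∑ t, ‖c.enc1 w₁ t‖ ^ 2) ≤ n ∧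
  messageAverage k₁ k₂ (fun _ w₂ => ∑ t, ‖c.enc2 w₂ t‖ ^ 2) ≤ n ∧
  messageAverage k₁ k₂ (fun w₁ w₂ => ∑ t, ‖c.enc0 w₁ w₂ t‖ ^ 2) ≤ n

/-- Law of the output sequence of the memoryless channel, given the messages. -/
def outputLaw (c : Code n k₁ k₂) (g : Gains) (w₁ : Fin (2 ^ k₁)) (w₂ : Fin (2 ^ k₂)) :
    Measure (Fin n → ℂ × ℂ) :=
  Measure.pi (fun t => g.channelLaw (c.input w₁ w₂ t))

/-- Probability that receiver 1 does not recover its message. -/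
def error1 (c : Code n k₁ k₂) (g : Gains) : ℝ :=
  messageAverage k₁ k₂ (fun w₁ w₂ =>
    (c.outputLaw g w₁ w₂).real {y | c.dec1 (fun t => (y t).1) ≠ w₁})

/-- Probability that receiver 2 does not recover its message. -/
def error2 (c : Code n k₁ k₂) (g : Gains) : ℝ :=
  messageAverage k₁ k₂ (fun w₁ w₂ =>
    (c.outputLaw g w₁ w₂).real {y | c.dec2 (fun t => (y t).2) ≠ w₂})

end Code

/-- Achievability of a pair of non-negative rates in bits per channel use; the message sets of a
code of length `n` have `2 ^ ⌈n R₁⌉` and `2 ^ ⌈n R₂⌉` elements. -/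
def Achievable (g : Gains) (R : ℝ × ℝ) : Prop :=
  0 ≤ R.1 ∧ 0 ≤ R.2 ∧
    ∃ c : ∀ n : ℕ, Code n ⌈(n : ℝ) * R.1⌉₊ ⌈(n : ℝ) * R.2⌉₊,
      (∀ n, (c n).PowerConstraint) ∧
      Tendsto (fun n => max ((c n).error1 g) ((c n).error2 g)) atTop (𝓝 0)

/-- The capacity region: the closed convex hull of the set of achievable rate pairs. -/
def capacityRegion (g : Gains) : Set (ℝ × ℝ) :=
  closure (convexHull ℝ {R | Achievable g R})

/-! ### Single-letter input distributions -/

/-- `μ`, a law of `(Q, X₁, X₂, X₀)`, factors as `P_Q P_{X₁|Q} P_{X₂|Q} P_{X₀|Q,X₁,X₂}` and satisfies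
the power constraints `E|Xᵢ|² ≤ 1`. -/
def IsInputLaw {𝒬 : Type} [MeasurableSpace 𝒬] (μ : Measure (𝒬 × ℂ × ℂ × ℂ)) : Prop :=
  (∃ (PQ : Measure 𝒬) (K₁ K₂ : Kernel 𝒬 ℂ) (K₀ : Kernel (𝒬 × ℂ × ℂ) ℂ),
    IsProbabilityMeasure PQ ∧ IsMarkovKernel K₁ ∧ IsMarkovKernel K₂ ∧ IsMarkovKernel K₀ ∧
    μ = ((PQ ⊗ₘ (K₁ ×ₖ K₂)) ⊗ₘ K₀).map
      (fun p => (p.1.1, p.1.2.1, p.1.2.2, p.2))) ∧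
  (∫⁻ p, ‖p.2.1‖ₑ ^ 2 ∂μ ≤ 1) ∧
  (∫⁻ p, ‖p.2.2.1‖ₑ ^ 2 ∂μ ≤ 1) ∧
  (∫⁻ p, ‖p.2.2.2‖ₑ ^ 2 ∂μ ≤ 1)

/-! ### The random variables of the single-letter bounds

The sample space carries `(Q, X₁, X₂, X₀)` and four noises `(Z₁, Z₂, Z̃₁, Z̃₂)`. -/

section Sample

variable {𝒬 : Type}

/-- Values of `((Q, X₁, X₂, X₀), (Z₁, Z₂, Z̃₁, Z̃₂))`. -/
abbrev Sample (𝒬 : Type) : Type := (𝒬 × ℂ × ℂ × ℂ) × (ℂ × ℂ × ℂ × ℂ)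

/-- The inputs have law `μ`; the noises are independent standard complex Gaussians, independent of
the inputs. -/
abbrev sampleLaw [MeasurableSpace 𝒬] (μ : Measure (𝒬 × ℂ × ℂ × ℂ)) : Measure (Sample 𝒬) :=
  μ.prod (stdComplexGaussian.prod
    (stdComplexGaussian.prod (stdComplexGaussian.prod stdComplexGaussian)))

def rvQ (ω : Sample 𝒬) : 𝒬 := ω.1.1
def rvX1 (ω : Sample 𝒬) : ℂ := ω.1.2.1
def rvX2 (ω : Sample 𝒬) : ℂ := ω.1.2.2.1
def rvX0 (ω : Sample 𝒬) : ℂ := ω.1.2.2.2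

/-- `Y₁ = |h₁₁| X₁ + |h₁₀| X₀ + h₁₂ X₂ + Z₁`. -/
def rvY1 (g : Gains) (ω : Sample 𝒬) : ℂ := g.signal1 ω.1.2 + ω.2.1

/-- `Y₂ = h₂₁ X₁ + |h₂₀| X₀ + |h₂₂| X₂ + Z₂`. -/
def rvY2 (g : Gains) (ω : Sample 𝒬) : ℂ := g.signal2 ω.1.2 + ω.2.2.1

/-- `V₁ = h₂₁ X₁ + Z₂`. -/
def rvV1 (g : Gains) (ω : Sample 𝒬) : ℂ := g.h21 * rvX1 ω + ω.2.2.1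

/-- `V₂ = h₁₂ X₂ + Z₁`. -/
def rvV2 (g : Gains) (ω : Sample 𝒬) : ℂ := g.h12 * rvX2 ω + ω.2.1

/-- `Ṽ₁ = h₂₁ X₁ + Z̃₂`. -/
def rvVt1 (g : Gains) (ω : Sample 𝒬) : ℂ := g.h21 * rvX1 ω + ω.2.2.2.2

/-- `Ṽ₂ = h₁₂ X₂ + Z̃₁`. -/
def rvVt2 (g : Gains) (ω : Sample 𝒬) : ℂ := g.h12 * rvX2 ω + ω.2.2.2.1

/-- A memoryless channel from `(x₁, x₂, x₀)` to a pair of outputs whose two conditional marginals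
are those of the Gaussian channel; the joint conditional law is otherwise arbitrary. -/
structure IsCoupling (g : Gains) (κ : Kernel (ℂ × ℂ × ℂ) (ℂ × ℂ)) : Prop where
  fst_eq : ∀ x, (κ x).map Prod.fst = (g.channelLaw x).map Prod.fst
  snd_eq : ∀ x, (κ x).map Prod.snd = (g.channelLaw x).map Prod.snd

/-- Joint law of `(Q, X₁, X₂, X₀)` and of the outputs of the channel `κ`. -/
abbrev couplingLaw [MeasurableSpace 𝒬] (μ : Measure (𝒬 × ℂ × ℂ × ℂ))
    (κ : Kernel (ℂ × ℂ × ℂ) (ℂ × ℂ)) : Measure ((𝒬 × ℂ × ℂ × ℂ) × (ℂ × ℂ)) :=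
  μ ⊗ₘ (κ.comap Prod.snd measurable_snd)

end Sample

/-! ### The outer bound -/

/-- The term that replaces the multi-letter portion. -/
def mlp2 (g : Gains) : ℝ :=
  Real.logb 2 (1 + min (‖g.h12‖ ^ 2) (‖g.h10‖ ^ 2)) +
    Real.logb 2 (1 + min (‖g.h21‖ ^ 2) (‖g.h20‖ ^ 2)) + 2 * Real.logb 2 2

section Bounds

variable {𝒬 : Type} [MeasurableSpace 𝒬]

/-- The four bounds for general memoryless channels. In the third one `p.2 = (Y₁, Ȳ₂)` and in the
fourth one `p.2 = (Ȳ₁, Y₂)`; they hold for every joint law of these pairs, given the inputs, that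
has the prescribed marginals. -/
def GeneralBounds (g : Gains) (μ : Measure (𝒬 × ℂ × ℂ × ℂ)) [IsProbabilityMeasure μ]
    (R₁ R₂ : ℝ) : Prop :=
  ENNReal.ofReal R₁ ≤
    condMutualInfo (sampleLaw μ) (rvY1 g) (fun ω => (rvX1 ω, rvX0 ω)) (fun ω => (rvQ ω, rvX2 ω)) ∧
  ENNReal.ofReal R₂ ≤
    condMutualInfo (sampleLaw μ) (rvY2 g) (fun ω => (rvX2 ω, rvX0 ω)) (fun ω => (rvQ ω, rvX1 ω)) ∧
  (∀ (κ : Kernel (ℂ × ℂ × ℂ) (ℂ × ℂ)) [IsMarkovKernel κ], IsCoupling g κ →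
    ENNReal.ofReal (R₁ + R₂) ≤
      condMutualInfo (sampleLaw μ) (rvY2 g) (fun ω => (rvX1 ω, rvX2 ω, rvX0 ω)) rvQ +
      condMutualInfo (couplingLaw μ κ) (fun p => p.2.1) (fun p => (p.1.2.1, p.1.2.2.2))
        (fun p => (p.1.1, p.2.2, p.1.2.2.1))) ∧
  (∀ (κ : Kernel (ℂ × ℂ × ℂ) (ℂ × ℂ)) [IsMarkovKernel κ], IsCoupling g κ →
    ENNReal.ofReal (R₁ + R₂) ≤
      condMutualInfo (sampleLaw μ) (rvY1 g) (fun ω => (rvX1 ω, rvX2 ω, rvX0 ω)) rvQ +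
      condMutualInfo (couplingLaw μ κ) (fun p => p.2.2) (fun p => (p.1.2.2.1, p.1.2.2.2))
        (fun p => (p.1.1, p.2.1, p.1.2.1)))

/-- The three bounds for injective semi-deterministic channels, with the multi-letter portion
replaced by `mlp2`. -/
def InjectiveBounds (g : Gains) (μ : Measure (𝒬 × ℂ × ℂ × ℂ)) [IsProbabilityMeasure μ]
    (R₁ R₂ : ℝ) : Prop :=
  R₁ + R₂ ≤
    condEntropy (sampleLaw μ) (rvY1 g) (fun ω => (rvVt1 g ω, rvQ ω)) -
      condEntropy (sampleLaw μ) (rvVt2 g) rvX2 +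
    condEntropy (sampleLaw μ) (rvY2 g) (fun ω => (rvVt2 g ω, rvQ ω)) -
      condEntropy (sampleLaw μ) (rvVt1 g) rvX1 + mlp2 g ∧
  2 * R₁ + R₂ ≤
    -condEntropy (sampleLaw μ) (rvVt1 g) rvX1 - 2 * condEntropy (sampleLaw μ) (rvV2 g) rvX2 +
      condEntropy (sampleLaw μ) (rvY1 g) rvQ +
      condEntropy (sampleLaw μ) (rvY1 g) (fun ω => (rvVt1 g ω, rvX2 ω, rvQ ω)) +
      condEntropy (sampleLaw μ) (rvY2 g) (fun ω => (rvVt2 g ω, rvQ ω)) + mlp2 g ∧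
  R₁ + 2 * R₂ ≤
    -condEntropy (sampleLaw μ) (rvVt2 g) rvX2 - 2 * condEntropy (sampleLaw μ) (rvV1 g) rvX1 +
      condEntropy (sampleLaw μ) (rvY2 g) rvQ +
      condEntropy (sampleLaw μ) (rvY2 g) (fun ω => (rvVt2 g ω, rvX1 ω, rvQ ω)) +
      condEntropy (sampleLaw μ) (rvY1 g) (fun ω => (rvVt1 g ω, rvQ ω)) + mlp2 g

/-- The non-negative rate pairs that satisfy all seven bounds for the input law `μ`. -/
def ratesOf (g : Gains) (μ : Measure (𝒬 × ℂ × ℂ × ℂ)) [IsProbabilityMeasure μ] : Set (ℝ × ℝ) :=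
  {R | 0 ≤ R.1 ∧ 0 ≤ R.2 ∧ GeneralBounds g μ R.1 R.2 ∧ InjectiveBounds g μ R.1 R.2}

end Bounds

/-- The outer bound: the union over all time-sharing variables and all admissible inputs. -/
def outerRegion (g : Gains) : Set (ℝ × ℝ) :=
  {R | ∃ (𝒬 : Type) (_ : MeasurableSpace 𝒬) (_ : StandardBorelSpace 𝒬)
    (μ : Measure (𝒬 × ℂ × ℂ × ℂ)) (_ : IsProbabilityMeasure μ),
    IsInputLaw μ ∧ R ∈ ratesOf g μ}

/-- The part of the outer bound that is obtained from admissible jointly Gaussian inputs, without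
time sharing (`Q` is constant). -/
def gaussianOuterRegion (g : Gains) : Set (ℝ × ℝ) :=
  {R | ∃ (μ : Measure (Unit × ℂ × ℂ × ℂ)) (_ : IsProbabilityMeasure μ),
    IsInputLaw μ ∧ IsProperGaussian (μ.map Prod.snd) ∧ R ∈ ratesOf g μ}

end ICCR

end

open MeasureTheory ProbabilityTheory Filter Topology
open scoped ENNReal

noncomputable section

namespace ICCR

/-! Everything is compared with one explicit region, `closedFormRegion`, through the cycle of
inclusions: capacity region ⊆ closed form ⊆ Gaussian outer region ⊆ outer region ⊆ closed form.

Unit-power Gaussian inputs with `X₁`, `X₂` independent are described by the correlations `p` of `X₀`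
with `X₁` and `X₂`, a point of the compact convex set `corrBall`, and the variance `formVar p v` of
a linear form is affine in `p`. A conditional variance of Gaussians is a minimum over linear
estimators; the closed form demands each bound for every choice of estimator coefficients, and for
every noise correlation `s` with `‖s‖ < 1` in the genie bounds. For fixed coefficients a bound says
that a linear function of the rates is at most a constant plus logarithms of positive affine
functions of `p`. Concavity of the logarithm gives convexity (`convex_closedFormRegion`) and
compactness gives closedness (`isClosed_closedFormRegion`), so the closed convex hull in the
definition of capacity costs nothing.

Outer region into closed form: `IsInputLaw.exists_formVar_bound` finds `p` after centring `X₁` at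
its conditional mean given `Q`. Gaussians maximise entropy under second-moment constraints, so
`condMutualInfo_le` and `condEntropy_le` bound each term by the logarithm of an estimator's error
variance. Of all couplings only those with Gaussian noises of correlation `s` are needed.

Closed form into Gaussian region: for Gaussian inputs the residual of the best linear estimator is
independent of the conditioning variables, which evaluates the entropies and bounds the mutual
informations from below. The genie bounds must hold for every coupling of the two outputs, though.
Here `le_condMutualInfo`, a Donsker–Varadhan bound that sees only second moments of the output,
reduces an arbitrary coupling to its noise correlation `ρ`; `le_add_condMutualInfo_genie` uses the
closed form at `s = ρ`, or at `s` close to `ρ` if `‖ρ‖ = 1`.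

Codes into closed form: `fano` is stated for likelihood ratios, so no multi-letter mutual
information is needed. Choosing Gaussian test densities yields `rate_le_of_conditional` and
`rate_le_of_mixture`. In the last three bounds the differences of `h(V₁ⁿ)` and `h(Y₂ⁿ|W₂)`, and of
`h(V₂ⁿ)` and `h(Y₁ⁿ|W₁)`, are left over; `multiLetter_le` bounds each in two ways, which produces
the minima and the `log 2` in `mlp2`. The correlations come from averaging over time and messages
(`exists_average_form_le`), and letting the block length grow ends the proof. -/

/-! ### Scalar complex Gaussian densities -/

/-- Density of the proper complex Gaussian law with mean `0` and variance `v`. -/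
def gden (v : ℝ) (z : ℂ) : ℝ := (Real.pi * v)⁻¹ * Real.exp (-‖z‖ ^ 2 / v)

lemma gden_pos {v : ℝ} (hv : 0 < v) (z : ℂ) : 0 < gden v z := by
  unfold gden; positivity

@[fun_prop]
lemma continuous_gden (v : ℝ) : Continuous (gden v) := by
  unfold gden; fun_prop

@[fun_prop]
lemma measurable_gden (v : ℝ) : Measurable (gden v) := (continuous_gden v).measurable

lemma gden_neg (v : ℝ) (z : ℂ) : gden v (-z) = gden v z := by simp [gden]

lemma log_gden {v : ℝ} (hv : 0 < v) (z : ℂ) :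
    Real.log (gden v z) = -Real.log (Real.pi * v) - ‖z‖ ^ 2 / v := by
  unfold gden
  rw [Real.log_mul (by positivity) (by positivity), Real.log_inv, Real.log_exp]
  ring

lemma gden_le {v : ℝ} (hv : 0 < v) (z : ℂ) : gden v z ≤ (Real.pi * v)⁻¹ := by
  unfold gden
  have : Real.exp (-‖z‖ ^ 2 / v) ≤ 1 := by
    rw [Real.exp_le_one_iff, neg_div]
    have : 0 ≤ ‖z‖ ^ 2 / v := by positivity
    linarith
  have h2 : 0 < (Real.pi * v)⁻¹ := by positivity
  nlinarith

/-- The variance `1/2` of each real coordinate turns the product density into `π⁻¹ exp (-(x² +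
y²))`. -/
lemma stdComplexGaussian_eq_withDensity :
    stdComplexGaussian = volume.withDensity (fun z => ENNReal.ofReal (gden 1 z)) := by
  have hv : ((1 / 2 : NNReal)) ≠ 0 := by norm_num
  unfold stdComplexGaussian
  rw [gaussianReal_of_var_ne_zero _ hv, prod_withDensity (by fun_prop) (by fun_prop)]
  have hfun : (fun p : ℝ × ℝ => (p.1 : ℂ) + (p.2 : ℂ) * Complex.I)
      = Complex.measurableEquivRealProd.symm := by
    ext p
    simp [Complex.measurableEquivRealProd_symm_apply, Complex.mk_eq_add_mul_I]
  rw [hfun]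
  ext s hs
  rw [Measure.map_apply (MeasurableEquiv.measurable _) hs, withDensity_apply _ hs,
    withDensity_apply _ (MeasurableEquiv.measurable _ hs),
    ← (Complex.volume_preserving_equiv_real_prod.symm).setLIntegral_comp_preimage hs (by fun_prop)]
  change ∫⁻ a in _, _ ∂volume = _
  refine lintegral_congr fun p => ?_
  simp only [gaussianPDF]
  rw [← ENNReal.ofReal_mul (gaussianPDFReal_nonneg _ _ _)]
  congr 1
  simp only [gaussianPDFReal, gden, Complex.measurableEquivRealProd_symm_apply]
  have h1 : ‖(⟨p.1, p.2⟩ : ℂ)‖ ^ 2 = p.1 ^ 2 + p.2 ^ 2 := by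
    rw [← Complex.normSq_eq_norm_sq, Complex.normSq_mk]; ring
  rw [h1]
  have h2 : (Real.sqrt (2 * Real.pi * ((1 / 2 : NNReal) : ℝ))) ^ 2 = Real.pi := by
    rw [Real.sq_sqrt (by positivity)]; push_cast; ring
  have h3 : Real.sqrt (2 * Real.pi * ((1 / 2 : NNReal) : ℝ)) ≠ 0 := by positivity
  calc _ = (Real.sqrt (2 * Real.pi * ((1 / 2 : NNReal) : ℝ)) ^ 2)⁻¹ *
        (Real.exp (-(p.1 - 0) ^ 2 / (2 * ((1 / 2 : NNReal) : ℝ))) *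
          Real.exp (-(p.2 - 0) ^ 2 / (2 * ((1 / 2 : NNReal) : ℝ)))) := by
        field_simp
    _ = _ := by
        rw [h2, ← Real.exp_add]
        congr 2
        · ring
        · push_cast; ring

lemma lintegral_gden_one : ∫⁻ z, ENNReal.ofReal (gden 1 z) = 1 := by
  have h := measure_univ (μ := stdComplexGaussian)
  rwa [stdComplexGaussian_eq_withDensity, withDensity_apply _ MeasurableSet.univ,
    setLIntegral_univ] at h

lemma integral_gden_one : ∫ z, gden 1 z = 1 := by
  rw [integral_eq_lintegral_of_nonneg_ae (Eventually.of_forall fun z => (gden_pos one_pos z).le)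
    (by fun_prop), lintegral_gden_one]
  simp

lemma gden_eq_scale {v : ℝ} (hv : 0 < v) (z : ℂ) :
    gden v z = v⁻¹ * gden 1 ((Real.sqrt v)⁻¹ • z) := by
  have h : ‖(Real.sqrt v)⁻¹ • z‖ ^ 2 = ‖z‖ ^ 2 / v := by
    rw [norm_smul, mul_pow, norm_inv, inv_pow, Real.norm_of_nonneg (Real.sqrt_nonneg _),
      Real.sq_sqrt hv.le]
    field_simp
  unfold gden
  rw [h]
  field_simp

/-- Change of variables that reduces Gaussian integrals to unit variance. -/
lemma integral_gden_mul {E : Type*} [NormedAddCommGroup E] [NormedSpace ℝ E]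
    {v : ℝ} (hv : 0 < v) (f : ℂ → E) :
    ∫ z, gden v z • f z = ∫ z, gden 1 z • f (Real.sqrt v • z) := by
  have h := Measure.integral_comp_smul (volume : Measure ℂ)
    (fun z => gden 1 z • f (Real.sqrt v • z)) (Real.sqrt v)⁻¹
  have hs : Real.sqrt v ≠ 0 := by positivity
  simp only [smul_smul, mul_inv_cancel₀ hs, one_smul, Complex.finrank_real_complex, inv_pow,
    Real.sq_sqrt hv.le, inv_inv, abs_of_pos hv] at h
  simp_rw [gden_eq_scale hv, mul_smul, integral_smul]
  rw [h, smul_smul, inv_mul_cancel₀ hv.ne', one_smul]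

lemma integral_gden {v : ℝ} (hv : 0 < v) : ∫ z, gden v z = 1 := by
  have := integral_gden_mul hv (fun _ => (1 : ℝ))
  simpa [integral_gden_one] using this

lemma integrable_gden {v : ℝ} (hv : 0 < v) : Integrable (gden v) := by
  -- The Bochner integral of a non-integrable function is `0`, but the value found is `1`. The same
  -- device recurs below.
  by_contra h
  have := integral_gden hv
  rw [integral_undef h] at this
  exact zero_ne_one this

lemma lintegral_gden {v : ℝ} (hv : 0 < v) : ∫⁻ z, ENNReal.ofReal (gden v z) = 1 := by
  rw [← ofReal_integral_eq_lintegral_ofReal (integrable_gden hv)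
    (Eventually.of_forall fun z => (gden_pos hv z).le), integral_gden hv, ENNReal.ofReal_one]

lemma lintegral_gden_sub {v : ℝ} (hv : 0 < v) (m : ℂ) :
    ∫⁻ z, ENNReal.ofReal (gden v (z - m)) = 1 := by
  rw [lintegral_sub_right_eq_self (fun z => ENNReal.ofReal (gden v z)) m, lintegral_gden hv]

/-- Completing the square in a product of two complex Gaussian densities. -/
lemma gden_mul_gden {v : ℝ} (hv : 0 < v) (d u w : ℂ) :
    gden v (u - d * w) * gden 1 w =
      gden (v + ‖d‖ ^ 2) u * gden (v / (v + ‖d‖ ^ 2)) (w - (starRingEnd ℂ d) * u / (v + ‖d‖ ^ 2 : ℝ)) := by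
  have hs : 0 < v + ‖d‖ ^ 2 := by positivity
  unfold gden
  have hexp : Real.exp (-‖u - d * w‖ ^ 2 / v) * Real.exp (-‖w‖ ^ 2 / 1) =
      Real.exp (-‖u‖ ^ 2 / (v + ‖d‖ ^ 2)) * Real.exp (-‖w - (starRingEnd ℂ d) * u /
        (v + ‖d‖ ^ 2 : ℝ)‖ ^ 2 / (v / (v + ‖d‖ ^ 2))) := by
    rw [← Real.exp_add, ← Real.exp_add]
    congr 1
    have e : w - (starRingEnd ℂ d) * u / (v + ‖d‖ ^ 2 : ℝ)
        = (((v + ‖d‖ ^ 2)⁻¹ : ℝ) : ℂ) * (((v + ‖d‖ ^ 2 : ℝ) : ℂ) * w - (starRingEnd ℂ d) * u) := by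
      have : ((v + ‖d‖ ^ 2 : ℝ) : ℂ) ≠ 0 := by exact_mod_cast hs.ne'
      rw [Complex.ofReal_inv]; field_simp
    rw [e, norm_mul, mul_pow, Complex.norm_real, norm_inv, Real.norm_of_nonneg hs.le]
    have key : ‖((v + ‖d‖ ^ 2 : ℝ) : ℂ) * w - (starRingEnd ℂ d) * u‖ ^ 2 =
        (v + ‖d‖ ^ 2) * ‖u - d * w‖ ^ 2 + v * (v + ‖d‖ ^ 2) * ‖w‖ ^ 2 - v * ‖u‖ ^ 2 := by
      simp only [← Complex.normSq_eq_norm_sq, Complex.normSq_apply]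
      simp
      ring
    rw [key]
    field_simp
    ring
  calc _ = (Real.pi * v)⁻¹ * (Real.pi * 1)⁻¹ *
        (Real.exp (-‖u - d * w‖ ^ 2 / v) * Real.exp (-‖w‖ ^ 2 / 1)) := by ring
    _ = _ := by rw [hexp]; field_simp

/-- Convolution of two Gaussians: after completing the square, the factor that contains `w` is a
shifted density and integrates to one. -/
lemma lintegral_gden_sub_mul {v : ℝ} (hv : 0 < v) (d u : ℂ) :
    ∫⁻ w, ENNReal.ofReal (gden v (u - d * w)) ∂stdComplexGaussian =
      ENNReal.ofReal (gden (v + ‖d‖ ^ 2) u) := by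
  have hs : 0 < v + ‖d‖ ^ 2 := by positivity
  rw [stdComplexGaussian_eq_withDensity, lintegral_withDensity_eq_lintegral_mul _ (by fun_prop)
    (by fun_prop)]
  simp only [Pi.mul_apply]
  simp_rw [← ENNReal.ofReal_mul (gden_pos one_pos _).le, mul_comm (gden 1 _),
    gden_mul_gden hv, ENNReal.ofReal_mul (gden_pos hs _).le]
  rw [lintegral_const_mul _ (by fun_prop), lintegral_gden_sub (by positivity), mul_one]

/-! ### Moments of the standard complex Gaussian law -/

lemma integral_std_eq {f : ℂ → ℂ} : ∫ z, f z ∂stdComplexGaussian = ∫ z, gden 1 z • f z := by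
  rw [stdComplexGaussian_eq_withDensity, integral_withDensity_eq_integral_toReal_smul (by fun_prop)
    (by simp)]
  simp [(gden_pos one_pos _).le]

lemma lintegral_enorm_sq_std : ∫⁻ z, ‖z‖ₑ ^ 2 ∂stdComplexGaussian = 1 := by
  have key : ∀ p : ℝ × ℝ, ‖(p.1 : ℂ) + (p.2 : ℂ) * Complex.I‖ₑ ^ 2 =
      ENNReal.ofReal (p.1 ^ 2) + ENNReal.ofReal (p.2 ^ 2) := by
    intro p
    rw [← ENNReal.ofReal_add (by positivity) (by positivity), ← ofReal_norm,
      ← ENNReal.ofReal_pow (by positivity), ← Complex.normSq_eq_norm_sq,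
      Complex.normSq_add_mul_I]
  have hg : ∫⁻ x, ENNReal.ofReal (x ^ 2) ∂(gaussianReal 0 (1 / 2)) = ENNReal.ofReal (1 / 2) := by
    have hi : Integrable (fun x : ℝ => x ^ 2) (gaussianReal 0 (1 / 2)) :=
      (memLp_id_gaussianReal (μ := 0) (v := 1 / 2) 2).integrable_sq
    rw [← ofReal_integral_eq_lintegral_ofReal hi (Eventually.of_forall fun x => sq_nonneg x)]
    congr 1
    have := variance_fun_id_gaussianReal (μ := 0) (v := 1 / 2)
    rw [variance_of_integral_eq_zero (by fun_prop) (by simp)] at this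
    rw [this]
    simp
  unfold stdComplexGaussian
  rw [lintegral_map (by fun_prop) (by fun_prop)]
  simp_rw [key]
  rw [lintegral_add_left (by fun_prop),
    lintegral_prod _ (by fun_prop), lintegral_prod _ (by fun_prop)]
  simp only [lintegral_const, measure_univ, mul_one, hg]
  rw [← ENNReal.ofReal_add (by norm_num) (by norm_num)]
  norm_num

lemma memLp_two_of_lintegral {Ω : Type*} [MeasurableSpace Ω] {P : Measure Ω} {f : Ω → ℂ}
    (hf : AEStronglyMeasurable f P) (h : ∫⁻ x, ‖f x‖ₑ ^ 2 ∂P ≠ ∞) : MemLp f 2 P := by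
  refine ⟨hf, ?_⟩
  rw [eLpNorm_lt_top_iff_lintegral_rpow_enorm_lt_top (by norm_num) (by norm_num)]
  simpa using h.lt_top

lemma memLp_id_std : MemLp (fun z : ℂ => z) 2 stdComplexGaussian :=
  memLp_two_of_lintegral (by fun_prop) (by rw [lintegral_enorm_sq_std]; simp)

lemma integral_id_std : ∫ z, z ∂stdComplexGaussian = 0 := by
  have h : ∫ z, z ∂stdComplexGaussian = -∫ z, z ∂stdComplexGaussian := by
    rw [integral_std_eq, ← integral_neg]
    nth_rw 1 [← integral_neg_eq_self]
    simp [gden_neg]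
  exact self_eq_neg.mp h

lemma integral_norm_sq_eq {Ω : Type*} [MeasurableSpace Ω] {P : Measure Ω} {f : Ω → ℂ}
    (hf : AEStronglyMeasurable f P) :
    ∫ x, ‖f x‖ ^ 2 ∂P = (∫⁻ x, ‖f x‖ₑ ^ 2 ∂P).toReal := by
  rw [integral_eq_lintegral_of_nonneg_ae (Eventually.of_forall fun x => by positivity)
    (by fun_prop)]
  congr 1
  refine lintegral_congr fun x => ?_
  rw [ENNReal.ofReal_pow (by positivity), ofReal_norm]

lemma integral_norm_sq_std : ∫ z, ‖z‖ ^ 2 ∂stdComplexGaussian = 1 := by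
  rw [integral_norm_sq_eq (f := fun z => z) (by fun_prop), lintegral_enorm_sq_std]; simp

/-- The standard complex Gaussian law scaled by `√v`. -/
lemma map_sqrt_std {v : ℝ} (hv : 0 < v) :
    stdComplexGaussian.map (fun z => ((Real.sqrt v : ℝ) : ℂ) * z) =
      volume.withDensity (fun z => ENNReal.ofReal (gden v z)) := by
  ext s hs
  rw [Measure.map_apply (by fun_prop) hs, stdComplexGaussian_eq_withDensity,
    withDensity_apply _ ((by fun_prop : Measurable fun z : ℂ => ((Real.sqrt v : ℝ) : ℂ) * z) hs),
    withDensity_apply _ hs]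
  have h := integral_gden_mul hv (s.indicator (fun _ => (1 : ℝ)))
  have aux : ∀ {u : ℝ} (hu : 0 < u) (t : Set ℂ) (_ : MeasurableSet t),
      ∫⁻ z in t, ENNReal.ofReal (gden u z) =
        ENNReal.ofReal (∫ z, gden u z • t.indicator (fun _ => (1 : ℝ)) z) := by
    intro u hu t ht
    have e : ∀ z, gden u z • t.indicator (fun _ => (1 : ℝ)) z = t.indicator (gden u) z := by
      intro z; by_cases hz : z ∈ t <;> simp [hz]
    simp_rw [e]
    rw [integral_indicator ht, ofReal_integral_eq_lintegral_ofReal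
      (integrable_gden hu).integrableOn (Eventually.of_forall fun z => (gden_pos hu z).le)]
  rw [aux one_pos _ ((by fun_prop : Measurable fun z : ℂ => ((Real.sqrt v : ℝ) : ℂ) * z) hs),
    aux hv _ hs, h]
  rfl

/-! ### Linear forms of independent standard complex Gaussians -/

/-- The characteristic function of a proper law depends on `c` only through `‖c‖`. The quarter is
half of the variance `1/2` of a real coordinate. -/
lemma integral_cexp_std (c : ℂ) :
    ∫ z, Complex.exp (Complex.I * ((c * z).re : ℂ)) ∂stdComplexGaussian =
      Complex.exp (-(‖c‖ ^ 2 : ℝ) / 4) := by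
  unfold stdComplexGaussian
  rw [integral_map (by fun_prop) (by fun_prop)]
  have e : ∀ p : ℝ × ℝ, Complex.exp (Complex.I * ((c * ((p.1 : ℂ) + (p.2 : ℂ) * Complex.I)).re : ℂ)) =
      Complex.exp (c.re * p.1 * Complex.I) * Complex.exp ((-c.im : ℝ) * p.2 * Complex.I) := by
    intro p
    rw [← Complex.exp_add]
    congr 1
    simp
    ring
  simp_rw [e]
  rw [integral_prod_mul (f := fun x : ℝ => Complex.exp (c.re * x * Complex.I))
    (g := fun x : ℝ => Complex.exp ((-c.im : ℝ) * x * Complex.I)),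
    ← charFun_apply_real, ← charFun_apply_real, charFun_gaussianReal, charFun_gaussianReal,
    ← Complex.exp_add]
  congr 1
  rw [← Complex.normSq_eq_norm_sq, Complex.normSq_apply]
  push_cast
  ring

variable {ι : Type*} [Fintype ι]

/-- The law of a family of independent standard complex Gaussians. -/
abbrev stdFamily (ι : Type*) [Fintype ι] : Measure (ι → ℂ) :=
  Measure.pi fun _ => stdComplexGaussian

/-- The linear form with coefficients `c`. -/
def linForm (c w : ι → ℂ) : ℂ := ∑ i, c i * w i

@[fun_prop]
lemma measurable_linForm (c : ι → ℂ) : Measurable (linForm c) := by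
  unfold linForm; fun_prop

lemma integral_cexp_linForm (c : ι → ℂ) :
    ∫ w, Complex.exp (Complex.I * ((linForm c w).re : ℂ)) ∂stdFamily ι =
      Complex.exp (-(∑ i, ‖c i‖ ^ 2 : ℝ) / 4) := by
  have e : ∀ w : ι → ℂ, Complex.exp (Complex.I * ((linForm c w).re : ℂ)) =
      ∏ i, Complex.exp (Complex.I * ((c i * w i).re : ℂ)) := by
    intro w
    rw [← Complex.exp_sum, linForm, Complex.re_sum, Complex.ofReal_sum, Finset.mul_sum]
  simp_rw [e]
  rw [integral_fintype_prod_eq_prod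
    (f := fun i z => Complex.exp (Complex.I * ((c i * z).re : ℂ)))]
  simp_rw [integral_cexp_std]
  rw [← Complex.exp_sum]
  congr 1
  push_cast
  rw [← Finset.sum_div, Finset.sum_neg_distrib]

/-- Real functionals on `ℂ` thereby become real parts of complex multiples, to which the
characteristic functions above apply. -/
lemma exists_re_mul_eq (L : StrongDual ℝ ℂ) : ∃ a : ℂ, ∀ z, L z = (a * z).re := by
  refine ⟨L 1 - Complex.I * L Complex.I, fun z => ?_⟩
  have hz : z = z.re • (1 : ℂ) + z.im • Complex.I := by
    simp [Complex.re_add_im]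
  conv_lhs => rw [hz]
  simp only [map_add, map_smul, smul_eq_mul]
  simp
  ring

lemma linForm_mul (a : ℂ) (c w : ι → ℂ) : a * linForm c w = linForm (fun i => a * c i) w := by
  simp [linForm, Finset.mul_sum, mul_assoc]

lemma linForm_add (c d w : ι → ℂ) : linForm c w + linForm d w = linForm (fun i => c i + d i) w := by
  simp [linForm, Finset.sum_add_distrib, add_mul]

/-- Characteristic functions agree: the one of a linear form involves its coefficients only through
the sum of their squared norms. -/
lemma map_linForm (c : ι → ℂ) {s : ℝ} (hs : s ^ 2 = ∑ i, ‖c i‖ ^ 2) :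
    (stdFamily ι).map (linForm c) = stdComplexGaussian.map (fun z => (s : ℂ) * z) := by
  have h1 : IsProbabilityMeasure ((stdFamily ι).map (linForm c)) :=
    Measure.isProbabilityMeasure_map (by fun_prop)
  have h2 : IsProbabilityMeasure (stdComplexGaussian.map (fun z => (s : ℂ) * z)) :=
    Measure.isProbabilityMeasure_map (by fun_prop)
  refine Measure.ext_of_charFunDual ?_
  ext L
  obtain ⟨a, ha⟩ := exists_re_mul_eq L
  simp only [charFunDual_apply, ha]
  rw [integral_map (by fun_prop) (by fun_prop), integral_map (by fun_prop) (by fun_prop)]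
  simp_rw [linForm_mul, ← mul_assoc, mul_comm _ Complex.I]
  rw [integral_cexp_linForm, integral_cexp_std]
  simp_rw [norm_mul, mul_pow, ← Finset.mul_sum, ← hs]
  simp

/-- A linear form is independent of a pair of linear forms to which it is orthogonal. -/
lemma indepFun_linForm {t c₁ c₂ : ι → ℂ} (h₁ : ∑ i, t i * (starRingEnd ℂ) (c₁ i) = 0)
    (h₂ : ∑ i, t i * (starRingEnd ℂ) (c₂ i) = 0) :
    IndepFun (linForm t) (fun w => (linForm c₁ w, linForm c₂ w)) (stdFamily ι) := by
  rw [indepFun_iff_charFunDual_prod (by fun_prop) (by fun_prop)]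
  intro L
  obtain ⟨a, ha⟩ := exists_re_mul_eq (L.comp (.inl ℝ ℂ (ℂ × ℂ)))
  obtain ⟨b, hb⟩ := exists_re_mul_eq ((L.comp (.inr ℝ ℂ (ℂ × ℂ))).comp (.inl ℝ ℂ ℂ))
  obtain ⟨d, hd⟩ := exists_re_mul_eq ((L.comp (.inr ℝ ℂ (ℂ × ℂ))).comp (.inr ℝ ℂ ℂ))
  have hL2 : ∀ y : ℂ × ℂ, L.comp (.inr ℝ ℂ (ℂ × ℂ)) y = (b * y.1 + d * y.2).re := by
    intro y
    rw [Complex.add_re, ← hb, ← hd]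
    rw [ContinuousLinearMap.comp_apply _ (.inl ℝ ℂ ℂ), ContinuousLinearMap.comp_apply _ (.inr ℝ ℂ ℂ),
      ← map_add]
    simp
  have hL : ∀ y : ℂ × ℂ × ℂ, L y = (a * y.1 + (b * y.2.1 + d * y.2.2)).re := by
    intro y
    rw [Complex.add_re, ← ha, ← hL2, ContinuousLinearMap.comp_apply, ContinuousLinearMap.comp_apply,
      ← map_add]
    simp
  simp only [charFunDual_apply, hL, hL2, ha]
  rw [integral_map (by fun_prop) (by fun_prop), integral_map (by fun_prop) (by fun_prop),
    integral_map (by fun_prop) (by fun_prop)]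
  simp only [linForm_mul, linForm_add, mul_comm _ Complex.I, integral_cexp_linForm]
  rw [← Complex.exp_add]
  congr 1
  -- Orthogonality removes the cross terms, so the joint characteristic function factors. Hermitian
  -- orthogonality suffices because the exponent contains only squared norms, that is, the law is
  -- proper.
  have hsum : ∑ i, ‖a * t i + (b * c₁ i + d * c₂ i)‖ ^ 2 =
      ∑ i, ‖a * t i‖ ^ 2 + ∑ i, ‖b * c₁ i + d * c₂ i‖ ^ 2 := by
    have hx : ∀ i, ‖a * t i + (b * c₁ i + d * c₂ i)‖ ^ 2 =
        ‖a * t i‖ ^ 2 + ‖b * c₁ i + d * c₂ i‖ ^ 2 +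
          2 * (a * (starRingEnd ℂ) b * (t i * (starRingEnd ℂ) (c₁ i)) +
            a * (starRingEnd ℂ) d * (t i * (starRingEnd ℂ) (c₂ i))).re := by
      intro i
      have e : a * (starRingEnd ℂ) b * (t i * (starRingEnd ℂ) (c₁ i)) +
            a * (starRingEnd ℂ) d * (t i * (starRingEnd ℂ) (c₂ i)) =
            (a * t i) * (starRingEnd ℂ) (b * c₁ i + d * c₂ i) := by
        simp only [map_add, map_mul]; ring
      rw [e]
      simp only [← Complex.normSq_eq_norm_sq, Complex.normSq_add]
    simp_rw [hx, Finset.sum_add_distrib, ← Finset.mul_sum, ← Complex.re_sum,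
      Finset.sum_add_distrib, ← Finset.mul_sum, h₁, h₂]
    simp
  rw [hsum]
  push_cast
  ring

/-- Linear regression of one linear form on two others. -/
lemma exists_orthogonal_residual (y c₁ c₂ : ι → ℂ) : ∃ α β : ℂ,
    ∑ i, (y i - α * c₁ i - β * c₂ i) * (starRingEnd ℂ) (c₁ i) = 0 ∧
    ∑ i, (y i - α * c₁ i - β * c₂ i) * (starRingEnd ℂ) (c₂ i) = 0 := by
  classical
  let Y : EuclideanSpace ℂ ι := WithLp.toLp 2 y
  let C₁ : EuclideanSpace ℂ ι := WithLp.toLp 2 c₁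
  let C₂ : EuclideanSpace ℂ ι := WithLp.toLp 2 c₂
  -- Projecting onto the span covers dependent or zero `c₁`, `c₂` too; the coefficients are then not
  -- unique.
  let U : Submodule ℂ (EuclideanSpace ℂ ι) := Submodule.span ℂ {C₁, C₂}
  have hp : (U.starProjection Y) ∈ U := Submodule.starProjection_apply_mem U Y
  obtain ⟨α, β, h⟩ := Submodule.mem_span_pair.mp hp
  have ho : ∀ C ∈ U, inner ℂ C (Y - U.starProjection Y) = 0 := fun C hC =>
    (Submodule.mem_orthogonal _ _).mp (Submodule.sub_starProjection_mem_orthogonal Y) C hC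
  refine ⟨α, β, ?_, ?_⟩
  · have := ho C₁ (Submodule.subset_span (by simp))
    rw [← h, PiLp.inner_apply] at this
    simpa [Y, C₁, C₂, sub_sub] using this
  · have := ho C₂ (Submodule.subset_span (by simp))
    rw [← h, PiLp.inner_apply] at this
    simpa [Y, C₁, C₂, sub_sub] using this

/-! ### Variational bounds for relative entropy and conditional mutual information -/

/-- Gibbs' inequality. -/
lemma integral_log_le_integral_llr {α : Type*} [MeasurableSpace α] {μ ν : Measure α}
    [IsProbabilityMeasure μ] [SigmaFinite ν] {f : α → ℝ} (hf : Measurable f)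
    (hpos : ∀ x, 0 < f x) (hint : ∫⁻ x, ENNReal.ofReal (f x) ∂ν ≤ 1)
    (hlog : Integrable (fun x => Real.log (f x)) μ) (hac : μ ≪ ν) (hI : Integrable (llr μ ν) μ) :
    ∫ x, Real.log (f x) ∂μ ≤ ∫ x, llr μ ν x ∂μ := by
  set r : α → ℝ≥0∞ := μ.rnDeriv ν with hr
  have hrm : Measurable r := Measure.measurable_rnDeriv μ ν
  have hrpos : ∀ᵐ x ∂μ, 0 < r x := Measure.rnDeriv_pos hac
  have hrtop : ∀ᵐ x ∂μ, r x < ∞ := hac.ae_le (Measure.rnDeriv_lt_top μ ν)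
  have hlin : ∫⁻ x, ENNReal.ofReal (f x / (r x).toReal) ∂μ ≤ 1 := by
    calc ∫⁻ x, ENNReal.ofReal (f x / (r x).toReal) ∂μ
        = ∫⁻ x, ENNReal.ofReal (f x) * (r x)⁻¹ ∂μ := by
          refine lintegral_congr_ae ?_
          filter_upwards [hrpos, hrtop] with x h1 h2
          rw [ENNReal.ofReal_div_of_pos (ENNReal.toReal_pos h1.ne' h2.ne),
            ENNReal.ofReal_toReal h2.ne, div_eq_mul_inv]
      _ = ∫⁻ x, r x * (ENNReal.ofReal (f x) * (r x)⁻¹) ∂ν :=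
          (lintegral_rnDeriv_mul hac (by fun_prop)).symm
      -- Only `r * r⁻¹ ≤ 1` is available, since `r` may vanish on a set of positive `ν`-measure.
      _ ≤ ∫⁻ x, ENNReal.ofReal (f x) ∂ν := by
          refine lintegral_mono fun x => ?_
          rw [mul_comm, mul_assoc]
          calc _ ≤ ENNReal.ofReal (f x) * 1 := by gcongr; exact ENNReal.inv_mul_le_one _
            _ = _ := mul_one _
      _ ≤ 1 := hint
  have hq : Integrable (fun x => f x / (r x).toReal) μ := by
    refine ⟨Measurable.aestronglyMeasurable (by fun_prop), ?_⟩
    rw [hasFiniteIntegral_iff_ofReal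
      (Eventually.of_forall fun x => div_nonneg (hpos x).le ENNReal.toReal_nonneg)]
    exact lt_of_le_of_lt hlin (by simp)
  have hq1 : ∫ x, f x / (r x).toReal ∂μ ≤ 1 := by
    rw [integral_eq_lintegral_of_nonneg_ae
      (Eventually.of_forall fun x => div_nonneg (hpos x).le ENNReal.toReal_nonneg)
      (Measurable.aestronglyMeasurable (by fun_prop))]
    exact ENNReal.toReal_le_of_le_ofReal zero_le_one (by simpa using hlin)
  -- The inequality `log x ≤ x - 1` at `x = f / r`, where `r` is the density of `μ` with respect to
  -- `ν`.
  have hle : ∫ x, (Real.log (f x) - llr μ ν x) ∂μ ≤ ∫ x, (f x / (r x).toReal - 1) ∂μ := by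
    refine integral_mono_ae (hlog.sub hI) (hq.sub (integrable_const _)) ?_
    filter_upwards [hrpos, hrtop] with x h1 h2
    have h3 := ENNReal.toReal_pos h1.ne' h2.ne
    simp only [llr_def]
    rw [← Real.log_div (hpos x).ne' h3.ne']
    exact Real.log_le_sub_one_of_pos (div_pos (hpos x) h3)
  rw [integral_sub hlog hI, integral_sub hq (integrable_const _)] at hle
  simp at hle
  linarith

/-- The lower half of the Donsker–Varadhan formula. If `μ` is not absolutely continuous, or the
log-likelihood ratio is not integrable, the divergence is infinite; otherwise this is Gibbs'
inequality. -/
lemma le_klDiv_of_lintegral_le_one {α : Type*} [MeasurableSpace α] {μ ν : Measure α}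
    [IsProbabilityMeasure μ] [IsProbabilityMeasure ν] {f : α → ℝ} (hf : Measurable f)
    (hpos : ∀ x, 0 < f x) (hint : ∫⁻ x, ENNReal.ofReal (f x) ∂ν ≤ 1)
    (hlog : Integrable (fun x => Real.log (f x)) μ) :
    ENNReal.ofReal (∫ x, Real.log (f x) ∂μ) ≤ InformationTheory.klDiv μ ν := by
  by_cases hac : μ ≪ ν
  swap; · simp [InformationTheory.klDiv_of_not_ac hac]
  by_cases hI : Integrable (llr μ ν) μ
  swap; · simp [InformationTheory.klDiv_of_not_integrable hI]
  rw [InformationTheory.klDiv_of_ac_of_integrable hac hI]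
  refine ENNReal.ofReal_le_ofReal ?_
  simp only [probReal_univ, add_sub_cancel_right]
  exact integral_log_le_integral_llr hf hpos hint hlog hac hI

lemma klDiv_withDensity_le {α : Type*} [MeasurableSpace α] {ν : Measure α}
    [IsProbabilityMeasure ν] {r : α → ℝ} (hr : Measurable r) (hpos : ∀ x, 0 < r x)
    [IsProbabilityMeasure (ν.withDensity fun x => ENNReal.ofReal (r x))]
    (hlog : Integrable (fun x => Real.log (r x)) (ν.withDensity fun x => ENNReal.ofReal (r x))) :
    InformationTheory.klDiv (ν.withDensity fun x => ENNReal.ofReal (r x)) ν =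
      ENNReal.ofReal (∫ x, Real.log (r x) ∂(ν.withDensity fun x => ENNReal.ofReal (r x))) := by
  have hac : (ν.withDensity fun x => ENNReal.ofReal (r x)) ≪ ν := withDensity_absolutelyContinuous _ _
  have hl : llr (ν.withDensity fun x => ENNReal.ofReal (r x)) ν
      =ᵐ[ν.withDensity fun x => ENNReal.ofReal (r x)] fun x => Real.log (r x) := by
    filter_upwards [hac.ae_le (Measure.rnDeriv_withDensity ν hr.ennreal_ofReal)] with x hx
    simp only [llr_def, hx, ENNReal.toReal_ofReal (hpos x).le]
  rw [InformationTheory.klDiv_of_ac_of_integrable hac ((integrable_congr hl).mpr hlog),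
    integral_congr_ae hl]
  simp

section CondMutualInfo

lemma integral_const_add_div_sub_div {Ω : Type*} [MeasurableSpace Ω] {P : Measure Ω}
    [IsProbabilityMeasure P] {f g : Ω → ℝ} (hf : Integrable f P) (hg : Integrable g P) {k v w : ℝ} :
    ∫ ω, (k + f ω / w - g ω / v) ∂P = k + (∫ ω, f ω ∂P) / w - (∫ ω, g ω ∂P) / v := by
  have h1 : Integrable (fun ω => k + f ω / w) P := (integrable_const k).add (hf.div_const w)
  rw [integral_sub h1 (hg.div_const v), integral_add (integrable_const k) (hf.div_const w),
    integral_div, integral_div]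
  simp

variable {Ω β γ : Type*} [MeasurableSpace Ω] [MeasurableSpace β] [StandardBorelSpace β] [Nonempty β]
  [MeasurableSpace γ] {P : Measure Ω} [IsProbabilityMeasure P]
  {A : Ω → ℂ} {B : Ω → β} {C : Ω → γ}

omit [StandardBorelSpace β] [Nonempty β] in
lemma compProd_map_snd {κ : Kernel γ β} [IsMarkovKernel κ] {μ : Measure γ} [IsProbabilityMeasure μ]
    {h : γ × β → ℂ} (hh : Measurable h) :
    (μ ⊗ₘ κ).map (fun p => (p.1, h p)) = μ ⊗ₘ ((Kernel.id ×ₖ κ).map h) := by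
  ext s hs
  have hm : Measurable fun p : γ × β => (p.1, h p) := by fun_prop
  rw [Measure.map_apply hm hs, Measure.compProd_apply (hm hs), Measure.compProd_apply hs]
  refine lintegral_congr fun c => ?_
  rw [Kernel.map_apply' _ hh _ (by exact measurable_prodMk_left hs), Kernel.id_prod_apply' _ _ (hh (measurable_prodMk_left hs))]
  rfl

/-- Conditional law of a function of `(C, B)` that is independent of `C`. -/
lemma ae_map_condDistrib_eq (hB : Measurable B) (hC : Measurable C) {h : γ × β → ℂ}
    (hh : Measurable h) (hind : IndepFun (fun ω => h (C ω, B ω)) C P) :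
    ∀ᵐ c ∂(P.map C), (condDistrib B C P c).map (fun b => h (c, b)) =
      P.map (fun ω => h (C ω, B ω)) := by
  have hCp : IsProbabilityMeasure (P.map C) := Measure.isProbabilityMeasure_map hC.aemeasurable
  have hTp : IsProbabilityMeasure (P.map fun ω => h (C ω, B ω)) :=
    Measure.isProbabilityMeasure_map (by fun_prop)
  have e1 : (P.map C) ⊗ₘ ((Kernel.id ×ₖ condDistrib B C P).map h) =
      (P.map C) ⊗ₘ Kernel.const γ (P.map fun ω => h (C ω, B ω)) := by
    rw [← compProd_map_snd hh, compProd_map_condDistrib hB.aemeasurable,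
      Measure.map_map (by fun_prop) (by fun_prop), Measure.compProd_const]
    exact (indepFun_iff_map_prod_eq_prod_map_map (by fun_prop) (by fun_prop)).mp hind.symm
  have hK : IsMarkovKernel ((Kernel.id ×ₖ condDistrib B C P).map h) := Kernel.IsMarkovKernel.map _ hh
  filter_upwards [Kernel.ae_eq_of_compProd_eq e1] with c hc
  rw [Kernel.const_apply] at hc
  rw [← hc]
  ext s hs
  rw [Kernel.map_apply' _ hh _ hs, Kernel.id_prod_apply' _ _ (hh hs),
    Measure.map_apply (by fun_prop) hs]
  rfl

/-- A lower bound for the conditional mutual information in terms of second moments, when the part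
of `S C B` that is not explained by `C` is Gaussian. -/
lemma le_condMutualInfo (hA : Measurable A) (hB : Measurable B) (hC : Measurable C)
    {S : γ × β → ℂ} (hS : Measurable S) {m : γ → ℂ} (hm : Measurable m) {v d w : ℝ} (hv : 0 < v)
    (hw : w = v + d ^ 2)
    (hind : IndepFun (fun ω => S (C ω, B ω) - m (C ω)) C P)
    (hlaw : P.map (fun ω => S (C ω, B ω) - m (C ω)) = stdComplexGaussian.map (fun z => (d : ℂ) * z))
    (h1 : Integrable (fun ω => ‖A ω - S (C ω, B ω)‖ ^ 2) P)
    (h2 : Integrable (fun ω => ‖A ω - m (C ω)‖ ^ 2) P) :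
    ENNReal.ofReal ((Real.log (w / v) + (∫ ω, ‖A ω - m (C ω)‖ ^ 2 ∂P) / w -
      (∫ ω, ‖A ω - S (C ω, B ω)‖ ^ 2 ∂P) / v) / Real.log 2) ≤ condMutualInfo P A B C := by
  have hw0 : 0 < w := by rw [hw]; positivity
  have hl2 : 0 < Real.log 2 := Real.log_pos (by norm_num)
  have hCp : IsProbabilityMeasure (P.map C) := Measure.isProbabilityMeasure_map hC.aemeasurable
  have hLp : IsProbabilityMeasure (P.map fun ω => (C ω, A ω, B ω)) :=
    Measure.isProbabilityMeasure_map (by fun_prop)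
  -- The test function is the likelihood ratio of a Gaussian channel with mean `S` and variance `v`
  -- to a Gaussian output with mean `m` and variance `w`. The true law of `A` need not be Gaussian:
  -- it enters only through two second moments.
  let f : γ × ℂ × β → ℝ := fun p => gden v (p.2.1 - S (p.1, p.2.2)) / gden w (p.2.1 - m p.1)
  have hf : Measurable f := by fun_prop
  have hpos : ∀ p, 0 < f p := fun p => div_pos (gden_pos hv _) (gden_pos hw0 _)
  have hlogf : ∀ p, Real.log (f p) = Real.log (w / v) + ‖p.2.1 - m p.1‖ ^ 2 / w -
      ‖p.2.1 - S (p.1, p.2.2)‖ ^ 2 / v := by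
    intro p
    simp only [f]
    rw [Real.log_div (gden_pos hv _).ne' (gden_pos hw0 _).ne', log_gden hv, log_gden hw0,
      Real.log_mul Real.pi_ne_zero hv.ne', Real.log_mul Real.pi_ne_zero hw0.ne',
      Real.log_div hw0.ne' hv.ne']
    ring
  unfold condMutualInfo
  rw [ENNReal.ofReal_div_of_pos hl2]
  gcongr
  have hmeas : Measurable fun ω => (C ω, A ω, B ω) := by fun_prop
  have hint : Integrable (fun ω => Real.log (f (C ω, A ω, B ω))) P := by
    simp only [hlogf]
    exact ((integrable_const _).add (h2.div_const _)).sub (h1.div_const _)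
  have key := le_klDiv_of_lintegral_le_one (μ := P.map fun ω => (C ω, A ω, B ω))
    (ν := (P.map C) ⊗ₘ (condDistrib A C P ×ₖ condDistrib B C P)) hf hpos ?_ ?_
  · refine le_trans (le_of_eq ?_) key
    rw [integral_map (by fun_prop) (Measurable.aestronglyMeasurable (by fun_prop))]
    simp only [hlogf]
    rw [integral_const_add_div_sub_div h2 h1]
  · rw [Measure.lintegral_compProd (by fun_prop)]
    -- Given `C = c`, the residual `S - m` is Gaussian with variance `d ^ 2`. Averaging `gden v`
    -- over `B` thus gives exactly `gden w` with `w = v + d ^ 2`, and the ratio averages to one for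
    -- every value of `A`.
    have : ∀ᵐ c ∂(P.map C), ∫⁻ b, ENNReal.ofReal (f (c, b)) ∂(condDistrib A C P ×ₖ condDistrib B C P) c
        ≤ 1 := by
      filter_upwards [ae_map_condDistrib_eq hB hC (h := fun p => S p - m p.1) (by fun_prop) hind]
        with c hc
      rw [Kernel.lintegral_prod _ _ _ (by fun_prop)]
      have : ∀ a : ℂ, ∫⁻ b, ENNReal.ofReal (f (c, a, b)) ∂(condDistrib B C P c) = 1 := by
        intro a
        simp only [f]
        simp_rw [ENNReal.ofReal_div_of_pos (gden_pos hw0 _), div_eq_mul_inv]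
        rw [lintegral_mul_const _ (by fun_prop)]
        have e : ∫⁻ b, ENNReal.ofReal (gden v (a - S (c, b))) ∂(condDistrib B C P c) =
            ENNReal.ofReal (gden w (a - m c)) := by
          have h3 : ∫⁻ t, ENNReal.ofReal (gden v ((a - m c) - t))
              ∂((condDistrib B C P c).map fun b => S (c, b) - m c) =
              ENNReal.ofReal (gden w (a - m c)) := by
            rw [hc, hlaw, lintegral_map (by fun_prop) (by fun_prop), lintegral_gden_sub_mul hv, hw]
            simp
          rw [lintegral_map (by fun_prop) (by fun_prop)] at h3
          rw [← h3]
          refine lintegral_congr fun b => ?_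
          congr 2
          ring
        rw [e, ENNReal.mul_inv_cancel (by simpa using gden_pos hw0 _) (by simp)]
      simp_rw [this]
      simp
    calc _ ≤ ∫⁻ _, 1 ∂(P.map C) := lintegral_mono_ae this
      _ = 1 := by simp
  · rw [integrable_map_measure (Measurable.aestronglyMeasurable (by fun_prop)) (by fun_prop)]
    exact hint

/-! ### Upper bounds -/

/-- The law `CN(m(c), w)` as a function of `c`. -/
def gaussKernel (m : γ → ℂ) (w : ℝ) : Kernel γ ℂ :=
  (Kernel.id ×ₖ Kernel.const γ (volume.withDensity fun z => ENNReal.ofReal (gden w z))).map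
    (fun p => m p.1 + p.2)

lemma isProbabilityMeasure_gden {w : ℝ} (hw : 0 < w) :
    IsProbabilityMeasure (volume.withDensity fun z => ENNReal.ofReal (gden w z)) :=
  ⟨by rw [withDensity_apply _ MeasurableSet.univ, setLIntegral_univ, lintegral_gden hw]⟩

lemma isMarkovKernel_gaussKernel {m : γ → ℂ} (hm : Measurable m) {w : ℝ} (hw : 0 < w) :
    IsMarkovKernel (gaussKernel m w) := by
  have := isProbabilityMeasure_gden hw
  exact Kernel.IsMarkovKernel.map _ (by fun_prop)

lemma gaussKernel_apply {m : γ → ℂ} (hm : Measurable m) {w : ℝ} (hw : 0 < w) (c : γ) :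
    gaussKernel m w c = (volume.withDensity fun z => ENNReal.ofReal (gden w z)).map
      (fun z => m c + z) := by
  have := isProbabilityMeasure_gden hw
  unfold gaussKernel
  ext s hs
  rw [Kernel.map_apply' _ (by fun_prop) _ hs, Kernel.id_prod_apply' _ _
    ((by fun_prop : Measurable fun p : γ × ℂ => m p.1 + p.2) hs), Kernel.const_apply,
    Measure.map_apply (by fun_prop) hs]
  rfl

lemma lintegral_gaussKernel {m : γ → ℂ} (hm : Measurable m) {w : ℝ} (hw : 0 < w) (c : γ)
    {F : ℂ → ℝ≥0∞} (hF : Measurable F) :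
    ∫⁻ a, F a ∂(gaussKernel m w c) = ∫⁻ a, ENNReal.ofReal (gden w (a - m c)) * F a := by
  rw [gaussKernel_apply hm hw, lintegral_map hF (by fun_prop),
    lintegral_withDensity_eq_lintegral_mul _ (by fun_prop) (by fun_prop),
    ← lintegral_sub_right_eq_self _ (m c)]
  simp

omit [StandardBorelSpace β] [Nonempty β] in
lemma compProd_prod_assoc {μ : Measure γ} [IsProbabilityMeasure μ] (κ : Kernel γ ℂ) (η : Kernel γ β)
    [IsMarkovKernel κ] [IsMarkovKernel η] :
    (μ ⊗ₘ (κ ×ₖ η)).map (fun p : γ × ℂ × β => ((p.1, p.2.1), p.2.2)) =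
      (μ ⊗ₘ κ) ⊗ₘ (η.comap Prod.fst measurable_fst) := by
  refine Measure.ext_of_lintegral _ fun F hF => ?_
  rw [lintegral_map hF (by fun_prop), Measure.lintegral_compProd (by fun_prop),
    Measure.lintegral_compProd hF, Measure.lintegral_compProd (by fun_prop)]
  refine lintegral_congr fun c => ?_
  rw [Kernel.lintegral_prod _ _ _ (by fun_prop)]
  simp [Kernel.comap_apply]

/-- Replacing the conditional law of `A` given `C` by another kernel increases the relative entropy
that defines the conditional mutual information. -/
lemma condMutualInfo_le_klDiv (hA : Measurable A) (hB : Measurable B) (hC : Measurable C)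
    (q : Kernel γ ℂ) [IsMarkovKernel q] :
    condMutualInfo P A B C ≤ InformationTheory.klDiv (P.map (fun ω => (C ω, A ω, B ω)))
      ((P.map C) ⊗ₘ (q ×ₖ condDistrib B C P)) / ENNReal.ofReal (Real.log 2) := by
  unfold condMutualInfo
  gcongr
  have hCp : IsProbabilityMeasure (P.map C) := Measure.isProbabilityMeasure_map hC.aemeasurable
  have hCAp : IsProbabilityMeasure (P.map fun ω => (C ω, A ω)) :=
    Measure.isProbabilityMeasure_map (by fun_prop)
  have hLp : IsProbabilityMeasure (P.map fun ω => (C ω, A ω, B ω)) :=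
    Measure.isProbabilityMeasure_map (by fun_prop)
  set L := P.map fun ω => (C ω, A ω, B ω) with hL
  set M := (P.map C) ⊗ₘ (condDistrib A C P ×ₖ condDistrib B C P) with hM
  let e : γ × ℂ × β → (γ × ℂ) × β := fun p => ((p.1, p.2.1), p.2.2)
  let e' : (γ × ℂ) × β → γ × ℂ × β := fun p => (p.1.1, p.1.2, p.2)
  have he : Measurable e := by fun_prop
  have he' : Measurable e' := by fun_prop
  have hee : e' ∘ e = id := rfl
  have hback : ∀ ν : Measure (γ × ℂ × β), (ν.map e).map e' = ν := by
    intro ν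
    rw [Measure.map_map he' he, hee, Measure.map_id]
  have hLe : L.map e = (P.map fun ω => (C ω, A ω)) ⊗ₘ condDistrib B (fun ω => (C ω, A ω)) P := by
    rw [compProd_map_condDistrib hB.aemeasurable, hL, Measure.map_map he (by fun_prop)]
    rfl
  have hMe : M.map e = (P.map fun ω => (C ω, A ω)) ⊗ₘ
      ((condDistrib B C P).comap Prod.fst measurable_fst) := by
    rw [hM, compProd_prod_assoc, compProd_map_condDistrib hA.aemeasurable]
  have hM'e : ((P.map C) ⊗ₘ (q ×ₖ condDistrib B C P)).map e = ((P.map C) ⊗ₘ q) ⊗ₘ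
      ((condDistrib B C P).comap Prod.fst measurable_fst) := compProd_prod_assoc _ _
  calc InformationTheory.klDiv L M
      = InformationTheory.klDiv ((L.map e).map e') ((M.map e).map e') := by rw [hback, hback]
    _ ≤ InformationTheory.klDiv (L.map e) (M.map e) :=
        InformationTheory.klDiv_map_le _ _ he'
    -- Both reference laws have the same conditional law of `B` given `(C, A)`. By the chain rule
    -- the new divergence is the old one plus that of the law of `(C, A)` from `P_C ⊗ q`.
    _ ≤ InformationTheory.klDiv (L.map e) (((P.map C) ⊗ₘ (q ×ₖ condDistrib B C P)).map e) := by
        rw [hLe, hMe, hM'e, InformationTheory.klDiv_compProd_eq_add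
          (P.map fun ω => (C ω, A ω)) ((P.map C) ⊗ₘ q)]
        exact le_add_self
    _ ≤ _ := InformationTheory.klDiv_map_le _ _ he

/-- Expectations of functions of an observation with independent Gaussian noise. -/
lemma lintegral_eq_of_noise {δ : Type*} [MeasurableSpace δ] (hA : Measurable A) {D : Ω → δ} (hD : Measurable D)
    {S : δ → ℂ} (hS : Measurable S) {v : ℝ}
    (hind : IndepFun (fun ω => A ω - S (D ω)) D P)
    (hlaw : P.map (fun ω => A ω - S (D ω)) = volume.withDensity fun z => ENNReal.ofReal (gden v z))
    {F : ℂ × δ → ℝ≥0∞} (hF : Measurable F) :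
    ∫⁻ ω, F (A ω, D ω) ∂P =
      ∫⁻ x, (∫⁻ a, ENNReal.ofReal (gden v (a - S x)) * F (a, x)) ∂(P.map D) := by
  have hDp : IsProbabilityMeasure (P.map D) := Measure.isProbabilityMeasure_map hD.aemeasurable
  have hTp : IsProbabilityMeasure (P.map fun ω => A ω - S (D ω)) :=
    Measure.isProbabilityMeasure_map (by fun_prop)
  have h := (indepFun_iff_map_prod_eq_prod_map_map (by fun_prop) (by fun_prop)).mp hind.symm
  have e : ∫⁻ ω, F (A ω, D ω) ∂P =
      ∫⁻ p, F (S p.1 + p.2, p.1) ∂(P.map fun ω => (D ω, A ω - S (D ω))) := by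
    rw [lintegral_map (by fun_prop) (by fun_prop)]
    simp
  rw [e, h, lintegral_prod _ (by fun_prop)]
  refine lintegral_congr fun x => ?_
  rw [hlaw, lintegral_withDensity_eq_lintegral_mul _ (by fun_prop) (by fun_prop),
    ← lintegral_sub_right_eq_self _ (S x)]
  simp

/-- The Gaussian upper bound for the conditional mutual information of an observation with additive
Gaussian noise. -/
lemma condMutualInfo_le (hA : Measurable A) (hB : Measurable B) (hC : Measurable C)
    {S : γ × β → ℂ} (hS : Measurable S) {m : γ → ℂ} (hm : Measurable m) {v w : ℝ} (hv : 0 < v)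
    (hw : 0 < w)
    (hind : IndepFun (fun ω => A ω - S (C ω, B ω)) (fun ω => (C ω, B ω)) P)
    (hlaw : P.map (fun ω => A ω - S (C ω, B ω)) = volume.withDensity fun z => ENNReal.ofReal (gden v z))
    (h1 : ∫ ω, ‖A ω - S (C ω, B ω)‖ ^ 2 ∂P = v)
    (h2 : Integrable (fun ω => ‖A ω - m (C ω)‖ ^ 2) P)
    (h3 : ∫ ω, ‖A ω - m (C ω)‖ ^ 2 ∂P ≤ w) :
    condMutualInfo P A B C ≤ ENNReal.ofReal (Real.log (w / v) / Real.log 2) := by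
  have hl2 : 0 < Real.log 2 := Real.log_pos (by norm_num)
  have hq := isMarkovKernel_gaussKernel hm hw
  refine (condMutualInfo_le_klDiv hA hB hC (gaussKernel m w)).trans ?_
  rw [ENNReal.ofReal_div_of_pos hl2]
  gcongr
  have hCp : IsProbabilityMeasure (P.map C) := Measure.isProbabilityMeasure_map hC.aemeasurable
  have hLp : IsProbabilityMeasure (P.map fun ω => (C ω, A ω, B ω)) :=
    Measure.isProbabilityMeasure_map (by fun_prop)
  set M' := (P.map C) ⊗ₘ (gaussKernel m w ×ₖ condDistrib B C P) with hM'
  let r : γ × ℂ × β → ℝ := fun p => gden v (p.2.1 - S (p.1, p.2.2)) / gden w (p.2.1 - m p.1)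
  have hr : Measurable r := by fun_prop
  have hpos : ∀ p, 0 < r p := fun p => div_pos (gden_pos hv _) (gden_pos hw _)
  have hlogr : ∀ p, Real.log (r p) = Real.log (w / v) + ‖p.2.1 - m p.1‖ ^ 2 / w -
      ‖p.2.1 - S (p.1, p.2.2)‖ ^ 2 / v := by
    intro p
    simp only [r]
    rw [Real.log_div (gden_pos hv _).ne' (gden_pos hw _).ne', log_gden hv, log_gden hw,
      Real.log_mul Real.pi_ne_zero hv.ne', Real.log_mul Real.pi_ne_zero hw.ne',
      Real.log_div hw.ne' hv.ne']
    ring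
  have hi1 : Integrable (fun ω => ‖A ω - S (C ω, B ω)‖ ^ 2) P := by
    by_contra h
    rw [integral_undef h] at h1
    exact hv.ne h1
  -- Given `(C, B)` the observation has density `gden v (a - S)`, so `r` is exactly the density with
  -- respect to the law built from the Gaussian kernel. The divergence is then the expectation of
  -- `log r`.
  have hLM : P.map (fun ω => (C ω, A ω, B ω)) = M'.withDensity fun p => ENNReal.ofReal (r p) := by
    refine Measure.ext_of_lintegral _ fun F hF => ?_
    rw [lintegral_map hF (by fun_prop), lintegral_withDensity_eq_lintegral_mul _ (by fun_prop) hF,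
      hM', Measure.lintegral_compProd (by fun_prop),
      lintegral_eq_of_noise (D := fun ω => (C ω, B ω)) hA (by fun_prop) hS hind hlaw
        (F := fun p => F (p.2.1, p.1, p.2.2)) (by fun_prop),
      ← compProd_map_condDistrib hB.aemeasurable, Measure.lintegral_compProd (by fun_prop)]
    refine lintegral_congr fun c => ?_
    rw [Kernel.lintegral_prod_symm _ _ _ (by fun_prop)]
    refine lintegral_congr fun b => ?_
    rw [lintegral_gaussKernel hm hw _ (by fun_prop)]
    refine lintegral_congr fun a => ?_
    simp only [Pi.mul_apply, r]
    rw [← mul_assoc, ← ENNReal.ofReal_mul (gden_pos hw _).le,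
      mul_div_cancel₀ _ (gden_pos hw _).ne']
  have hI : Integrable (fun ω => Real.log (r (C ω, A ω, B ω))) P := by
    simp only [hlogr]
    exact ((integrable_const _).add (h2.div_const _)).sub (hi1.div_const _)
  have hW : IsProbabilityMeasure (M'.withDensity fun p => ENNReal.ofReal (r p)) := hLM ▸ hLp
  have hI' : Integrable (fun p => Real.log (r p)) (M'.withDensity fun p => ENNReal.ofReal (r p)) := by
    rw [← hLM, integrable_map_measure (Measurable.aestronglyMeasurable (by fun_prop)) (by fun_prop)]
    exact hI
  rw [hLM, klDiv_withDensity_le hr hpos hI', ← hLM, integral_map (by fun_prop) (Measurable.aestronglyMeasurable (by fun_prop))]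
  refine ENNReal.ofReal_le_ofReal ?_
  simp only [hlogr]
  rw [integral_const_add_div_sub_div h2 hi1, h1, div_self hv.ne']
  have : (∫ ω, ‖A ω - m (C ω)‖ ^ 2 ∂P) / w ≤ 1 := by rw [div_le_one hw]; exact h3
  linarith

end CondMutualInfo

/-! ### Conditional differential entropy -/

lemma std_absolutelyContinuous : stdComplexGaussian ≪ volume := by
  rw [stdComplexGaussian_eq_withDensity]
  exact withDensity_absolutelyContinuous _ _

lemma absolutelyContinuous_std : (volume : Measure ℂ) ≪ stdComplexGaussian := by
  rw [stdComplexGaussian_eq_withDensity]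
  exact withDensity_absolutelyContinuous' (by fun_prop)
    (Eventually.of_forall fun z => by simpa using gden_pos one_pos z)

lemma one_le_pi : 1 ≤ Real.pi := by linarith [Real.pi_gt_three]

lemma lintegral_enorm_sq_gden {w : ℝ} (hw : 0 < w) :
    ∫ z, ‖z‖ ^ 2 ∂(volume.withDensity fun z => ENNReal.ofReal (gden w z)) = w := by
  rw [← map_sqrt_std hw, integral_map (by fun_prop) (by fun_prop)]
  simp_rw [norm_mul, mul_pow, Complex.norm_real, Real.norm_of_nonneg (Real.sqrt_nonneg w),
    Real.sq_sqrt hw.le]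
  rw [integral_const_mul, integral_norm_sq_std, mul_one]

lemma integrable_norm_sq_gden {w : ℝ} (hw : 0 < w) :
    Integrable (fun z : ℂ => ‖z‖ ^ 2) (volume.withDensity fun z => ENNReal.ofReal (gden w z)) := by
  by_contra h
  have := lintegral_enorm_sq_gden hw
  rw [integral_undef h] at this
  exact hw.ne this

lemma diffEntropy_eq_llr (ν : Measure ℂ) :
    diffEntropy ν = -(∫ a, llr ν volume a ∂ν) / Real.log 2 := by
  unfold diffEntropy
  simp only [Real.logb, llr_def]
  rw [integral_div, neg_div]

/-- Gibbs' inequality against the Gaussian density of mean `m` and variance `w`. The condition `1 ≤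
w` handles a non-integrable log-density: `diffEntropy` is then `0` by the convention for integrals,
and the right side is nonnegative because `π * w ≥ 1`. -/
lemma diffEntropy_le {ν : Measure ℂ} [IsProbabilityMeasure ν] (hac : ν ≪ volume) (m : ℂ) {w : ℝ}
    (hw : 1 ≤ w) (hint : Integrable (fun a => ‖a - m‖ ^ 2) ν) :
    diffEntropy ν ≤ (Real.log (Real.pi * w) + (∫ a, ‖a - m‖ ^ 2 ∂ν) / w) / Real.log 2 := by
  have hl2 : 0 < Real.log 2 := Real.log_pos (by norm_num)
  have hw0 : 0 < w := by linarith
  rw [diffEntropy_eq_llr]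
  gcongr
  have hlog : ∀ a, Real.log (gden w (a - m)) = -Real.log (Real.pi * w) - ‖a - m‖ ^ 2 / w :=
    fun a => log_gden hw0 _
  by_cases hI : Integrable (llr ν volume) ν
  · have hi : Integrable (fun a => Real.log (gden w (a - m))) ν := by
      simp only [hlog]; exact (integrable_const _).sub (hint.div_const _)
    have := integral_log_le_integral_llr (f := fun a => gden w (a - m)) (by fun_prop)
      (fun a => gden_pos hw0 _) (lintegral_gden_sub hw0 m).le hi hac hI
    simp only [hlog] at this
    rw [integral_sub (integrable_const _) (hint.div_const _), integral_div] at this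
    simp at this
    linarith
  · rw [integral_undef hI]
    have h1 : 0 ≤ Real.log (Real.pi * w) := Real.log_nonneg (by nlinarith [one_le_pi])
    have h2 : 0 ≤ (∫ a, ‖a - m‖ ^ 2 ∂ν) / w := by positivity
    linarith

section CondEntropy

variable {Ω γ : Type*} [MeasurableSpace Ω] [MeasurableSpace γ] {P : Measure Ω}
  [IsProbabilityMeasure P] {A : Ω → ℂ} {C : Ω → γ}

/-- The Gaussian upper bound for the conditional differential entropy. -/
lemma condEntropy_le (hA : Measurable A) (hC : Measurable C)
    (hac : P.map (fun ω => (C ω, A ω)) ≪ (P.map C).prod stdComplexGaussian) {m : γ → ℂ} (hm : Measurable m)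
    {w : ℝ} (hw : 1 ≤ w) (h2 : Integrable (fun ω => ‖A ω - m (C ω)‖ ^ 2) P)
    (h3 : ∫ ω, ‖A ω - m (C ω)‖ ^ 2 ∂P ≤ w) :
    condEntropy P A C ≤ (Real.log (Real.pi * w) + 1) / Real.log 2 := by
  have hl2 : 0 < Real.log 2 := Real.log_pos (by norm_num)
  have hw0 : 0 < w := by linarith
  have hCp : IsProbabilityMeasure (P.map C) := Measure.isProbabilityMeasure_map hC.aemeasurable
  have h1 : 0 ≤ Real.log (Real.pi * w) := Real.log_nonneg (by nlinarith [one_le_pi])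
  unfold condEntropy
  -- Without integrability the conditional entropy has the default value `0`, below the bound since
  -- `π * w ≥ 1`.
  by_cases hI : Integrable (fun c => diffEntropy (condDistrib A C P c)) (P.map C)
  swap; · rw [integral_undef hI]; positivity
  -- Joint absolute continuity disintegrates: almost every conditional law is absolutely continuous.
  -- The Gaussian law replaces Lebesgue measure as a finite reference measure.
  rw [← compProd_map_condDistrib hA.aemeasurable, ← Measure.compProd_const] at hac
  have hac' := Measure.absolutelyContinuous_compProd_right_iff.mp hac
  have h2' : Integrable (fun p : γ × ℂ => ‖p.2 - m p.1‖ ^ 2) ((P.map C) ⊗ₘ condDistrib A C P) := by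
    rw [compProd_map_condDistrib hA.aemeasurable,
      integrable_map_measure (by fun_prop) (by fun_prop)]
    exact h2
  have h4 := (Measure.integrable_compProd_iff h2'.1).mp h2'
  have h5 : Integrable (fun c => ∫ a, ‖a - m c‖ ^ 2 ∂(condDistrib A C P c)) (P.map C) := by
    simpa using h4.2
  calc ∫ c, diffEntropy (condDistrib A C P c) ∂(P.map C)
      ≤ ∫ c, (Real.log (Real.pi * w) + (∫ a, ‖a - m c‖ ^ 2 ∂(condDistrib A C P c)) / w) /
          Real.log 2 ∂(P.map C) := by
        refine integral_mono_ae hI (((integrable_const _).add (h5.div_const _)).div_const _) ?_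
        filter_upwards [hac', h4.1] with c hc1 hc2
        exact diffEntropy_le (hc1.trans std_absolutelyContinuous) (m c) hw hc2
    _ = (Real.log (Real.pi * w) + (∫ ω, ‖A ω - m (C ω)‖ ^ 2 ∂P) / w) / Real.log 2 := by
        rw [integral_div, integral_add (integrable_const _) (h5.div_const _), integral_div,
          ← Measure.integral_compProd h2', compProd_map_condDistrib hA.aemeasurable,
          integral_map (φ := fun ω => (C ω, A ω)) (by fun_prop) (by fun_prop)]
        simp
    _ ≤ _ := by
        gcongr
        rwa [div_le_one hw0]

/-- Given `D`, the observation has a Gaussian density and misses null sections; this survives the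
passage from `D` to `φ (D)`. It supplies the absolute continuity required by `condEntropy_le`. -/
lemma map_prodMk_absolutelyContinuous_of_noise {δ : Type*} [MeasurableSpace δ] (hA : Measurable A)
    {D : Ω → δ} (hD : Measurable D) {S : δ → ℂ} (hS : Measurable S) {v : ℝ}
    (hind : IndepFun (fun ω => A ω - S (D ω)) D P)
    (hlaw : P.map (fun ω => A ω - S (D ω)) = volume.withDensity fun z => ENNReal.ofReal (gden v z))
    {φ : δ → γ} (hφ : Measurable φ) :
    P.map (fun ω => (φ (D ω), A ω)) ≪ (P.map fun ω => φ (D ω)).prod stdComplexGaussian := by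
  refine Measure.AbsolutelyContinuous.mk fun s hs h0 => ?_
  have h0' := Measure.ae_ae_of_ae_prod (measure_eq_zero_iff_ae_notMem.mp h0)
  change ∀ᵐ x ∂(P.map (φ ∘ D)), _ at h0'
  rw [← Measure.map_map hφ hD] at h0'
  have h1 := ae_of_ae_map hφ.aemeasurable h0'
  rw [Measure.map_apply (by fun_prop) hs, ← lintegral_indicator_one
    ((by fun_prop : Measurable fun ω => (φ (D ω), A ω)) hs)]
  have e := lintegral_eq_of_noise hA hD hS hind hlaw
    (F := fun p => s.indicator 1 (φ p.2, p.1)) ((measurable_one.indicator hs).comp (by fun_prop))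
  refine (Eq.trans ?_ e).trans ?_
  · rfl
  · rw [lintegral_eq_zero_iff' (by
      refine Measurable.aemeasurable (Measurable.lintegral_prod_right ?_)
      exact Measurable.mul (by fun_prop) ((measurable_one.indicator hs).comp (by fun_prop)))]
    filter_upwards [h1] with x hx
    refine (lintegral_congr_ae ?_).trans lintegral_zero
    filter_upwards [absolutelyContinuous_std.ae_le hx] with a ha
    simp [ha]

lemma diffEntropy_gaussian {w : ℝ} (hw : 0 < w) (m : ℂ) :
    diffEntropy ((volume.withDensity fun z => ENNReal.ofReal (gden w z)).map (fun z => m + z)) =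
      (Real.log (Real.pi * w) + 1) / Real.log 2 := by
  have hp := isProbabilityMeasure_gden hw
  have e : (volume.withDensity fun z => ENNReal.ofReal (gden w z)).map (fun z => m + z) =
      volume.withDensity fun z => ENNReal.ofReal (gden w (z - m)) := by
    refine Measure.ext_of_lintegral _ fun F hF => ?_
    rw [lintegral_map hF (by fun_prop), lintegral_withDensity_eq_lintegral_mul _ (by fun_prop)
      (by fun_prop), lintegral_withDensity_eq_lintegral_mul _ (by fun_prop)
      (by fun_prop), ← lintegral_sub_right_eq_self _ m]
    simp
  have hl : llr ((volume.withDensity fun z => ENNReal.ofReal (gden w z)).map (fun z => m + z)) volume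
      =ᵐ[(volume.withDensity fun z => ENNReal.ofReal (gden w z)).map (fun z => m + z)]
      fun z => Real.log (gden w (z - m)) := by
    rw [e]
    have hmeas : Measurable fun z => ENNReal.ofReal (gden w (z - m)) := by fun_prop
    filter_upwards [(withDensity_absolutelyContinuous volume _).ae_le
      (Measure.rnDeriv_withDensity volume hmeas)] with x hx
    simp only [llr_def, hx, ENNReal.toReal_ofReal (gden_pos hw _).le]
  rw [diffEntropy_eq_llr, integral_congr_ae hl, integral_map (by fun_prop)
    (Measurable.aestronglyMeasurable (by fun_prop))]
  simp only [add_sub_cancel_left, log_gden hw]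
  rw [integral_sub (integrable_const _) ((integrable_norm_sq_gden hw).div_const _), integral_div,
    lintegral_enorm_sq_gden hw, div_self hw.ne']
  simp
  ring

/-- The conditional differential entropy when the residual is Gaussian and independent of the
conditioning variable. -/
lemma condEntropy_eq (hA : Measurable A) (hC : Measurable C) {m : γ → ℂ} (hm : Measurable m)
    {w : ℝ} (hw : 0 < w) (hind : IndepFun (fun ω => A ω - m (C ω)) C P)
    (hlaw : P.map (fun ω => A ω - m (C ω)) = volume.withDensity fun z => ENNReal.ofReal (gden w z)) :
    condEntropy P A C = (Real.log (Real.pi * w) + 1) / Real.log 2 := by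
  have hCp : IsProbabilityMeasure (P.map C) := Measure.isProbabilityMeasure_map hC.aemeasurable
  have hq := isMarkovKernel_gaussKernel hm hw
  have h : condDistrib A C P =ᵐ[P.map C] gaussKernel m w := by
    refine condDistrib_ae_eq_of_measure_eq_compProd C hA.aemeasurable ?_
    refine Measure.ext_of_lintegral _ fun F hF => ?_
    rw [lintegral_map hF (by fun_prop), Measure.lintegral_compProd hF,
      lintegral_eq_of_noise hA hC hm hind hlaw (F := fun p => F (p.2, p.1)) (by fun_prop)]
    refine lintegral_congr fun c => ?_
    rw [lintegral_gaussKernel hm hw _ (by fun_prop)]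
  unfold condEntropy
  rw [integral_congr_ae (g := fun _ => (Real.log (Real.pi * w) + 1) / Real.log 2)]
  · simp
  · filter_upwards [h] with c hc
    rw [hc, gaussKernel_apply hm hw, diffEntropy_gaussian hw]

end CondEntropy

/-! ### The outer bound in closed form

Jointly Gaussian inputs `(X₁, X₂, X₀)` of unit variance with `X₁` and `X₂` independent are described
by `p = (E[X₀ X̄₁], E[X₀ X̄₂])`. -/

/-- Variance of `v₁ X₁ + v₂ X₂ + v₀ X₀` for `v = (v₁, v₂, v₀)`. -/
def formVar (p : ℂ × ℂ) (v : ℂ × ℂ × ℂ) : ℝ :=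
  ‖v.1‖ ^ 2 + ‖v.2.1‖ ^ 2 + ‖v.2.2‖ ^ 2 + 2 * (v.1 * (starRingEnd ℂ) (v.2.2 * p.1)).re +
    2 * (v.2.1 * (starRingEnd ℂ) (v.2.2 * p.2)).re

/-- The admissible correlations of the relay input with the two source inputs. -/
def corrBall : Set (ℂ × ℂ) := {p | ‖p.1‖ ^ 2 + ‖p.2‖ ^ 2 ≤ 1}

/-- Write `X₀ = p₁ X₁ + p₂ X₂ + N` with `N` uncorrelated with both sources and of variance `1 -
‖p₁‖² - ‖p₂‖²`, and collect coefficients. This shows nonnegativity on `corrBall`. -/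
lemma formVar_eq (p : ℂ × ℂ) (v : ℂ × ℂ × ℂ) :
    formVar p v = ‖v.1 + v.2.2 * p.1‖ ^ 2 + ‖v.2.1 + v.2.2 * p.2‖ ^ 2 +
      ‖v.2.2‖ ^ 2 * (1 - (‖p.1‖ ^ 2 + ‖p.2‖ ^ 2)) := by
  unfold formVar
  simp only [← Complex.normSq_eq_norm_sq, Complex.normSq_add, Complex.normSq_mul]
  ring

lemma formVar_nonneg {p : ℂ × ℂ} (hp : p ∈ corrBall) (v : ℂ × ℂ × ℂ) : 0 ≤ formVar p v := by
  rw [formVar_eq]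
  have : 0 ≤ 1 - (‖p.1‖ ^ 2 + ‖p.2‖ ^ 2) := by simpa [corrBall] using hp
  positivity

@[fun_prop]
lemma continuous_formVar (v : ℂ × ℂ × ℂ) : Continuous fun p => formVar p v := by
  unfold formVar; fun_prop

/-- The correlations enter only the cross terms, which are real-linear in `p`. -/
lemma formVar_convexCombo (p q : ℂ × ℂ) (v : ℂ × ℂ × ℂ) {s t : ℝ} (hst : s + t = 1) :
    formVar (s • p + t • q) v = s * formVar p v + t * formVar q v := by
  have ht : t = 1 - s := by linarith
  subst ht
  unfold formVar
  simp
  ring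

lemma isCompact_corrBall : IsCompact corrBall := by
  refine Metric.isCompact_of_isClosed_isBounded ?_ ?_
  · exact isClosed_le (by fun_prop) (by fun_prop)
  · refine (Metric.isBounded_closedBall (x := (0 : ℂ × ℂ)) (r := 1)).subset fun p hp => ?_
    have h : ‖p.1‖ ^ 2 + ‖p.2‖ ^ 2 ≤ 1 := hp
    rw [mem_closedBall_zero_iff, Prod.norm_def]
    exact max_le (by nlinarith [norm_nonneg p.1, norm_nonneg p.2])
      (by nlinarith [norm_nonneg p.1, norm_nonneg p.2])

lemma convex_corrBall : Convex ℝ corrBall := by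
  have h1 : ConvexOn ℝ Set.univ fun p : ℂ × ℂ => ‖p.1‖ ^ 2 :=
    (((convexOn_norm (convex_univ (𝕜 := ℝ) (E := ℂ))).comp_linearMap (LinearMap.fst ℝ ℂ ℂ)).pow
      (fun _ _ => norm_nonneg _) 2)
  have h2 : ConvexOn ℝ Set.univ fun p : ℂ × ℂ => ‖p.2‖ ^ 2 :=
    (((convexOn_norm (convex_univ (𝕜 := ℝ) (E := ℂ))).comp_linearMap (LinearMap.snd ℝ ℂ ℂ)).pow
      (fun _ _ => norm_nonneg _) 2)
  have := (h1.add h2).convex_le 1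
  simpa [corrBall] using this

/-- Concavity of the logarithm of an affine function of the correlations. -/
lemma log_formVar_concave {p q : ℂ × ℂ} (hp : p ∈ corrBall) (hq : q ∈ corrBall) (v : ℂ × ℂ × ℂ)
    {c : ℝ} (hc : 0 < c) {s t : ℝ} (hs : 0 ≤ s) (ht : 0 ≤ t) (hst : s + t = 1) :
    s * Real.log (formVar p v + c) + t * Real.log (formVar q v + c) ≤
      Real.log (formVar (s • p + t • q) v + c) := by
  have h := strictConcaveOn_log_Ioi.concaveOn.2 (x := formVar p v + c) (y := formVar q v + c)
    (by have := formVar_nonneg hp v; simp only [Set.mem_Ioi]; linarith)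
    (by have := formVar_nonneg hq v; simp only [Set.mem_Ioi]; linarith) hs ht hst
  simp only [smul_eq_mul] at h
  rw [formVar_convexCombo p q v hst]
  refine h.trans (le_of_eq ?_)
  congr 1
  have : c = s * c + t * c := by rw [← add_mul, hst, one_mul]
  linarith

/-- Coefficients of `(X₁, X₂, X₀)` in the noiseless part of the first output. -/
def Gains.coef1 (g : Gains) : ℂ × ℂ × ℂ := (‖g.h11‖, g.h12, ‖g.h10‖)

/-- Coefficients of `(X₁, X₂, X₀)` in the noiseless part of the second output. -/
def Gains.coef2 (g : Gains) : ℂ × ℂ × ℂ := (g.h21, ‖g.h22‖, ‖g.h20‖)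

/-- Coefficients of `X₁`. -/
def unit1 : ℂ × ℂ × ℂ := (1, 0, 0)

/-- Coefficients of `X₂`. -/
def unit2 : ℂ × ℂ × ℂ := (0, 1, 0)

/-- Variance of `Z₁ - α Z₂` for standard noises with `E[Z₁ Z̄₂] = s`. -/
def noiseVar (α s : ℂ) : ℝ := ‖α - s‖ ^ 2 + (1 - ‖s‖ ^ 2)

lemma noiseVar_pos (α : ℂ) {s : ℂ} (hs : ‖s‖ < 1) : 0 < noiseVar α s := by
  unfold noiseVar
  have : 0 < 1 - ‖s‖ ^ 2 := by nlinarith [norm_nonneg s]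
  positivity

/-- The seven bounds (in nats) for Gaussian inputs with correlations `p`. Every
conditional variance is replaced by the error variances of all linear estimators. -/
structure Satisfies (g : Gains) (p : ℂ × ℂ) (R : ℝ × ℝ) : Prop where
  single1 : ∀ α : ℂ, R.1 * Real.log 2 ≤ Real.log (formVar p (g.coef1 - α • unit2) + 1)
  single2 : ∀ α : ℂ, R.2 * Real.log 2 ≤ Real.log (formVar p (g.coef2 - α • unit1) + 1)
  genie2 : ∀ s : ℂ, ‖s‖ < 1 → ∀ α β : ℂ, (R.1 + R.2) * Real.log 2 ≤
    Real.log (formVar p g.coef2 + 1) +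
      (Real.log (formVar p (g.coef1 - α • g.coef2 - β • unit2) + noiseVar α s) -
        Real.log (1 - ‖s‖ ^ 2))
  genie1 : ∀ s : ℂ, ‖s‖ < 1 → ∀ α β : ℂ, (R.1 + R.2) * Real.log 2 ≤
    Real.log (formVar p g.coef1 + 1) +
      (Real.log (formVar p (g.coef2 - α • g.coef1 - β • unit1) + noiseVar α s) -
        Real.log (1 - ‖s‖ ^ 2))
  interference : ∀ α β : ℂ, (R.1 + R.2) * Real.log 2 ≤
    Real.log (formVar p (g.coef1 - (α * g.h21) • unit1) + (1 + ‖α‖ ^ 2)) +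
      Real.log (formVar p (g.coef2 - (β * g.h12) • unit2) + (1 + ‖β‖ ^ 2)) +
      mlp2 g * Real.log 2
  weighted1 : ∀ α β γ : ℂ, (2 * R.1 + R.2) * Real.log 2 ≤
    Real.log (formVar p g.coef1 + 1) +
      Real.log (formVar p (g.coef1 - (α * g.h21) • unit1 - β • unit2) + (1 + ‖α‖ ^ 2)) +
      Real.log (formVar p (g.coef2 - (γ * g.h12) • unit2) + (1 + ‖γ‖ ^ 2)) +
      mlp2 g * Real.log 2
  weighted2 : ∀ α β γ : ℂ, (R.1 + 2 * R.2) * Real.log 2 ≤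
    Real.log (formVar p g.coef2 + 1) +
      Real.log (formVar p (g.coef2 - (α * g.h12) • unit2 - β • unit1) + (1 + ‖α‖ ^ 2)) +
      Real.log (formVar p (g.coef1 - (γ * g.h21) • unit1) + (1 + ‖γ‖ ^ 2)) +
      mlp2 g * Real.log 2

/-- The union over all correlations of the regions described by the seven bounds. -/
def closedFormRegion (g : Gains) : Set (ℝ × ℝ) :=
  {R | 0 ≤ R.1 ∧ 0 ≤ R.2 ∧ ∃ p ∈ corrBall, Satisfies g p R}

lemma one_add_norm_sq_pos (α : ℂ) : 0 < 1 + ‖α‖ ^ 2 := by positivity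

/-- The same convex combination of correlations serves all seven bounds at once: for fixed estimator
coefficients each right side is concave in `p`. The minimum over estimators never has to be
computed. -/
lemma convex_closedFormRegion (g : Gains) : Convex ℝ (closedFormRegion g) := by
  rintro R ⟨hR1, hR2, p, hp, hS⟩ R' ⟨hR1', hR2', q, hq, hS'⟩ s t hs ht hst
  refine ⟨?_, ?_, s • p + t • q, convex_corrBall hp hq hs ht hst, ?_⟩
  · simp only [Prod.fst_add, Prod.smul_fst, smul_eq_mul]; positivity
  · simp only [Prod.snd_add, Prod.smul_snd, smul_eq_mul]; positivity
  have combine : ∀ {x y u v : ℝ}, x ≤ u → y ≤ v → s * x + t * y ≤ s * u + t * v := fun h h' =>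
    add_le_add (mul_le_mul_of_nonneg_left h hs) (mul_le_mul_of_nonneg_left h' ht)
  have hc : ∀ c : ℝ, c = s * c + t * c := fun c => by rw [← add_mul, hst, one_mul]
  constructor <;> simp only [Prod.fst_add, Prod.snd_add, Prod.smul_fst, Prod.smul_snd, smul_eq_mul]
  · intro α
    have h := combine (hS.single1 α) (hS'.single1 α)
    have := log_formVar_concave hp hq (g.coef1 - α • unit2) one_pos hs ht hst
    linarith
  · intro α
    have h := combine (hS.single2 α) (hS'.single2 α)
    have := log_formVar_concave hp hq (g.coef2 - α • unit1) one_pos hs ht hst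
    linarith
  · intro z hz α β
    have h := combine (hS.genie2 z hz α β) (hS'.genie2 z hz α β)
    have h1 := log_formVar_concave hp hq g.coef2 one_pos hs ht hst
    have h2 := log_formVar_concave hp hq (g.coef1 - α • g.coef2 - β • unit2)
      (noiseVar_pos α hz) hs ht hst
    have h3 := hc (Real.log (1 - ‖z‖ ^ 2))
    linarith
  · intro z hz α β
    have h := combine (hS.genie1 z hz α β) (hS'.genie1 z hz α β)
    have h1 := log_formVar_concave hp hq g.coef1 one_pos hs ht hst
    have h2 := log_formVar_concave hp hq (g.coef2 - α • g.coef1 - β • unit1)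
      (noiseVar_pos α hz) hs ht hst
    have h3 := hc (Real.log (1 - ‖z‖ ^ 2))
    linarith
  · intro α β
    have h := combine (hS.interference α β) (hS'.interference α β)
    have h1 := log_formVar_concave hp hq (g.coef1 - (α * g.h21) • unit1)
      (one_add_norm_sq_pos α) hs ht hst
    have h2 := log_formVar_concave hp hq (g.coef2 - (β * g.h12) • unit2)
      (one_add_norm_sq_pos β) hs ht hst
    have h3 := hc (mlp2 g * Real.log 2)
    linarith
  · intro α β γ
    have h := combine (hS.weighted1 α β γ) (hS'.weighted1 α β γ)
    have h1 := log_formVar_concave hp hq g.coef1 one_pos hs ht hst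
    have h2 := log_formVar_concave hp hq (g.coef1 - (α * g.h21) • unit1 - β • unit2)
      (one_add_norm_sq_pos α) hs ht hst
    have h3 := log_formVar_concave hp hq (g.coef2 - (γ * g.h12) • unit2)
      (one_add_norm_sq_pos γ) hs ht hst
    have h4 := hc (mlp2 g * Real.log 2)
    linarith
  · intro α β γ
    have h := combine (hS.weighted2 α β γ) (hS'.weighted2 α β γ)
    have h1 := log_formVar_concave hp hq g.coef2 one_pos hs ht hst
    have h2 := log_formVar_concave hp hq (g.coef2 - (α * g.h12) • unit2 - β • unit1)
      (one_add_norm_sq_pos α) hs ht hst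
    have h3 := log_formVar_concave hp hq (g.coef1 - (γ * g.h21) • unit1)
      (one_add_norm_sq_pos γ) hs ht hst
    have h4 := hc (mlp2 g * Real.log 2)
    linarith

/-- The bounds are stable under limits. -/
lemma exists_satisfies_of_tendsto {g : Gains} {R : ℕ → ℝ × ℝ} {R₀ : ℝ × ℝ}
    (hR : Tendsto R atTop (𝓝 R₀)) (h : ∀ n, ∃ p ∈ corrBall, Satisfies g p (R n)) :
    ∃ p ∈ corrBall, Satisfies g p R₀ := by
  choose p hp hS using h
  -- Correlations along a subsequence converge in the compact ball. For fixed coefficients each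
  -- bound is continuous in `p`, the added constant keeping the argument of the logarithm positive.
  obtain ⟨p₀, hp₀, φ, hφ, hlim⟩ := isCompact_corrBall.tendsto_subseq hp
  refine ⟨p₀, hp₀, ?_⟩
  have hR' := hR.comp hφ.tendsto_atTop
  have hR1 := (continuous_fst.tendsto _).comp hR'
  have hR2 := (continuous_snd.tendsto _).comp hR'
  have hlog : ∀ (v : ℂ × ℂ × ℂ) {c : ℝ}, 0 < c →
      Tendsto (fun n => Real.log (formVar (p (φ n)) v + c)) atTop
        (𝓝 (Real.log (formVar p₀ v + c))) := by
    intro v c hc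
    have h1 : Tendsto (fun n => formVar (p (φ n)) v) atTop (𝓝 (formVar p₀ v)) :=
      ((continuous_formVar v).tendsto p₀).comp hlim
    refine (h1.add_const c).log ?_
    have := formVar_nonneg hp₀ v
    positivity
  constructor
  · intro α
    exact le_of_tendsto_of_tendsto' (hR1.mul_const _) (hlog _ one_pos)
      fun n => (hS (φ n)).single1 α
  · intro α
    exact le_of_tendsto_of_tendsto' (hR2.mul_const _) (hlog _ one_pos)
      fun n => (hS (φ n)).single2 α
  · intro z hz α β
    exact le_of_tendsto_of_tendsto' ((hR1.add hR2).mul_const _)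
      (((hlog _ one_pos).add ((hlog _ (noiseVar_pos α hz)).sub_const _)))
      fun n => (hS (φ n)).genie2 z hz α β
  · intro z hz α β
    exact le_of_tendsto_of_tendsto' ((hR1.add hR2).mul_const _)
      (((hlog _ one_pos).add ((hlog _ (noiseVar_pos α hz)).sub_const _)))
      fun n => (hS (φ n)).genie1 z hz α β
  · intro α β
    exact le_of_tendsto_of_tendsto' ((hR1.add hR2).mul_const _)
      ((((hlog _ (one_add_norm_sq_pos α)).add (hlog _ (one_add_norm_sq_pos β))).add_const _))
      fun n => (hS (φ n)).interference α β
  · intro α β γ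
    exact le_of_tendsto_of_tendsto' (((hR1.const_mul 2).add hR2).mul_const _)
      (((((hlog _ one_pos).add (hlog _ (one_add_norm_sq_pos α))).add
        (hlog _ (one_add_norm_sq_pos γ))).add_const _))
      fun n => (hS (φ n)).weighted1 α β γ
  · intro α β γ
    exact le_of_tendsto_of_tendsto' ((hR1.add (hR2.const_mul 2)).mul_const _)
      (((((hlog _ one_pos).add (hlog _ (one_add_norm_sq_pos α))).add
        (hlog _ (one_add_norm_sq_pos γ))).add_const _))
      fun n => (hS (φ n)).weighted2 α β γ

lemma isClosed_closedFormRegion (g : Gains) : IsClosed (closedFormRegion g) := by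
  refine IsSeqClosed.isClosed fun R R₀ hR hlim => ?_
  refine ⟨?_, ?_, ?_⟩
  · exact ge_of_tendsto' ((continuous_fst.tendsto _).comp hlim) fun n => (hR n).1
  · exact ge_of_tendsto' ((continuous_snd.tendsto _).comp hlim) fun n => (hR n).2.1
  · exact exists_satisfies_of_tendsto hlim fun n => (hR n).2.2

/-- Second moments of linear combinations of centred inputs of power at most one. -/
lemma exists_formVar_bound {Ω : Type*} [MeasurableSpace Ω] {P : Measure Ω}
    {U₁ U₂ U₀ : Ω → ℂ} (m₁ : MemLp U₁ 2 P) (m₂ : MemLp U₂ 2 P) (m₀ : MemLp U₀ 2 P)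
    (h₁ : ∫ ω, ‖U₁ ω‖ ^ 2 ∂P ≤ 1) (h₂ : ∫ ω, ‖U₂ ω‖ ^ 2 ∂P ≤ 1) (h₀ : ∫ ω, ‖U₀ ω‖ ^ 2 ∂P ≤ 1)
    (h : ∫ ω, U₁ ω * (starRingEnd ℂ) (U₂ ω) ∂P = 0) :
    ∃ p ∈ corrBall, ∀ v : ℂ × ℂ × ℂ,
      ∫ ω, ‖v.1 * U₁ ω + v.2.1 * U₂ ω + v.2.2 * U₀ ω‖ ^ 2 ∂P ≤ formVar p v := by
  have conj : ∀ {U : Ω → ℂ}, MemLp U 2 P → MemLp (fun ω => (starRingEnd ℂ) (U ω)) 2 P := fun h =>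
    h.star
  have i₁₀ : Integrable (fun ω => U₁ ω * (starRingEnd ℂ) (U₀ ω)) P :=
    m₁.integrable_mul (conj m₀)
  have i₂₀ : Integrable (fun ω => U₂ ω * (starRingEnd ℂ) (U₀ ω)) P :=
    m₂.integrable_mul (conj m₀)
  have i₁₂ : Integrable (fun ω => U₁ ω * (starRingEnd ℂ) (U₂ ω)) P :=
    m₁.integrable_mul (conj m₂)
  have n₁ := m₁.integrable_norm_pow (p := 2) (by norm_num)
  have n₂ := m₂.integrable_norm_pow (p := 2) (by norm_num)
  have n₀ := m₀.integrable_norm_pow (p := 2) (by norm_num)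
  set a := ∫ ω, U₁ ω * (starRingEnd ℂ) (U₀ ω) ∂P with ha
  set b := ∫ ω, U₂ ω * (starRingEnd ℂ) (U₀ ω) ∂P with hb
  have key : ∀ v : ℂ × ℂ × ℂ, ∫ ω, ‖v.1 * U₁ ω + v.2.1 * U₂ ω + v.2.2 * U₀ ω‖ ^ 2 ∂P ≤
      formVar ((starRingEnd ℂ) a, (starRingEnd ℂ) b) v := by
    intro v
    have e : ∀ ω, ‖v.1 * U₁ ω + v.2.1 * U₂ ω + v.2.2 * U₀ ω‖ ^ 2 =
        ‖v.1‖ ^ 2 * ‖U₁ ω‖ ^ 2 + ‖v.2.1‖ ^ 2 * ‖U₂ ω‖ ^ 2 + ‖v.2.2‖ ^ 2 * ‖U₀ ω‖ ^ 2 +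
        2 * (v.1 * (starRingEnd ℂ) v.2.1 * (U₁ ω * (starRingEnd ℂ) (U₂ ω)) +
          v.1 * (starRingEnd ℂ) v.2.2 * (U₁ ω * (starRingEnd ℂ) (U₀ ω)) +
          v.2.1 * (starRingEnd ℂ) v.2.2 * (U₂ ω * (starRingEnd ℂ) (U₀ ω))).re := by
      intro ω
      simp only [← Complex.normSq_eq_norm_sq, Complex.normSq_add, Complex.normSq_mul]
      simp only [map_mul, Complex.add_re, Complex.mul_re, Complex.mul_im, Complex.conj_re,
        Complex.conj_im, Complex.add_im]
      ring
    simp_rw [e]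
    have iC : Integrable (fun ω => v.1 * (starRingEnd ℂ) v.2.1 * (U₁ ω * (starRingEnd ℂ) (U₂ ω)) +
          v.1 * (starRingEnd ℂ) v.2.2 * (U₁ ω * (starRingEnd ℂ) (U₀ ω)) +
          v.2.1 * (starRingEnd ℂ) v.2.2 * (U₂ ω * (starRingEnd ℂ) (U₀ ω))) P :=
      ((i₁₂.const_mul _).add (i₁₀.const_mul _)).add (i₂₀.const_mul _)
    have iC12 : Integrable (fun ω => v.1 * (starRingEnd ℂ) v.2.1 * (U₁ ω * (starRingEnd ℂ) (U₂ ω)) +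
          v.1 * (starRingEnd ℂ) v.2.2 * (U₁ ω * (starRingEnd ℂ) (U₀ ω))) P :=
      (i₁₂.const_mul _).add (i₁₀.const_mul _)
    have iN : Integrable (fun ω => ‖v.1‖ ^ 2 * ‖U₁ ω‖ ^ 2 + ‖v.2.1‖ ^ 2 * ‖U₂ ω‖ ^ 2 +
        ‖v.2.2‖ ^ 2 * ‖U₀ ω‖ ^ 2) P := ((n₁.const_mul _).add (n₂.const_mul _)).add (n₀.const_mul _)
    have iN12 : Integrable (fun ω => ‖v.1‖ ^ 2 * ‖U₁ ω‖ ^ 2 + ‖v.2.1‖ ^ 2 * ‖U₂ ω‖ ^ 2) P :=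
      (n₁.const_mul _).add (n₂.const_mul _)
    have iCr : Integrable (fun ω => (v.1 * (starRingEnd ℂ) v.2.1 * (U₁ ω * (starRingEnd ℂ) (U₂ ω)) +
          v.1 * (starRingEnd ℂ) v.2.2 * (U₁ ω * (starRingEnd ℂ) (U₀ ω)) +
          v.2.1 * (starRingEnd ℂ) v.2.2 * (U₂ ω * (starRingEnd ℂ) (U₀ ω))).re) P := iC.re
    have hre := integral_re iC
    simp only [RCLike.re_to_complex] at hre
    rw [integral_add iN (iCr.const_mul 2), integral_const_mul, hre,
      integral_add iN12 (n₀.const_mul _), integral_add (n₁.const_mul _) (n₂.const_mul _),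
      integral_add iC12 (i₂₀.const_mul _), integral_add (i₁₂.const_mul _) (i₁₀.const_mul _)]
    simp only [integral_const_mul]
    rw [h, ← ha, ← hb]
    unfold formVar
    -- Powers below one only lower the three square terms, and the cross terms are exact; so no
    -- rescaling to unit power is needed.
    have t₁ := mul_le_mul_of_nonneg_left h₁ (sq_nonneg ‖v.1‖)
    have t₂ := mul_le_mul_of_nonneg_left h₂ (sq_nonneg ‖v.2.1‖)
    have t₀ := mul_le_mul_of_nonneg_left h₀ (sq_nonneg ‖v.2.2‖)
    have e2 : (v.1 * (starRingEnd ℂ) v.2.1 * 0 + v.1 * (starRingEnd ℂ) v.2.2 * a +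
        v.2.1 * (starRingEnd ℂ) v.2.2 * b).re =
        (v.1 * (starRingEnd ℂ) (v.2.2 * (starRingEnd ℂ) a)).re +
        (v.2.1 * (starRingEnd ℂ) (v.2.2 * (starRingEnd ℂ) b)).re := by
      rw [← Complex.add_re]
      congr 1
      simp only [map_mul, Complex.conj_conj]
      ring
    rw [e2]
    dsimp only
    linarith
  refine ⟨_, ?_, key⟩
  -- At these coefficients the form is `U₀ - p₁ U₁ - p₂ U₂`, for which `formVar` equals `1 - ‖p₁‖² -
  -- ‖p₂‖²`. Its nonnegativity places the correlations in the ball.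
  have h0 := (integral_nonneg (μ := P) fun ω => by positivity).trans
    (key (-(starRingEnd ℂ) a, -(starRingEnd ℂ) b, 1))
  simp only [formVar, one_mul, norm_neg, RCLike.norm_conj, norm_one, Complex.conj_conj] at h0
  have ea : (-(starRingEnd ℂ) a * a).re = -‖a‖ ^ 2 := by
    rw [← Complex.normSq_eq_norm_sq, neg_mul, mul_comm, Complex.mul_conj]; simp
  have eb : (-(starRingEnd ℂ) b * b).re = -‖b‖ ^ 2 := by
    rw [← Complex.normSq_eq_norm_sq, neg_mul, mul_comm, Complex.mul_conj]; simp
  rw [ea, eb] at h0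
  simp only [corrBall, Set.mem_ofPred_eq, RCLike.norm_conj]
  linarith

/-! ### Invariance of the information measures under changes of the sample space -/

section Map

variable {Ω Ω' β γ : Type*} [MeasurableSpace Ω] [MeasurableSpace Ω'] [MeasurableSpace β]
  [StandardBorelSpace β] [Nonempty β] [MeasurableSpace γ] {P : Measure Ω} [IsProbabilityMeasure P]
  {Φ : Ω → Ω'} {A : Ω' → ℂ} {B : Ω' → β} {C : Ω' → γ}

lemma condMutualInfo_map [IsFiniteMeasure (P.map Φ)] (hΦ : Measurable Φ) (hA : Measurable A)
    (hB : Measurable B) (hC : Measurable C) :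
    condMutualInfo (P.map Φ) A B C =
      condMutualInfo P (fun ω => A (Φ ω)) (fun ω => B (Φ ω)) (fun ω => C (Φ ω)) := by
  unfold condMutualInfo
  rw [Measure.map_map (by fun_prop) hΦ, Measure.map_map hC hΦ]
  have h1 := condDistrib_map (ν := P) hC.aemeasurable hA.aemeasurable hΦ.aemeasurable
  have h2 := condDistrib_map (ν := P) hC.aemeasurable hB.aemeasurable hΦ.aemeasurable
  have : (condDistrib A C (P.map Φ) ×ₖ condDistrib B C (P.map Φ)) =ᵐ[P.map (C ∘ Φ)]
      (condDistrib (A ∘ Φ) (C ∘ Φ) P ×ₖ condDistrib (B ∘ Φ) (C ∘ Φ) P) := by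
    filter_upwards [h1, h2] with c hc1 hc2
    rw [Kernel.prod_apply, Kernel.prod_apply, hc1, hc2]
  rw [Measure.compProd_congr this]
  rfl

omit [StandardBorelSpace β] [Nonempty β] [MeasurableSpace β] in
lemma condEntropy_map [IsFiniteMeasure (P.map Φ)] (hΦ : Measurable Φ) (hA : Measurable A)
    (hC : Measurable C) :
    condEntropy (P.map Φ) A C = condEntropy P (fun ω => A (Φ ω)) (fun ω => C (Φ ω)) := by
  unfold condEntropy
  rw [Measure.map_map hC hΦ]
  have h1 := condDistrib_map (ν := P) hC.aemeasurable hA.aemeasurable hΦ.aemeasurable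
  refine integral_congr_ae ?_
  filter_upwards [h1] with c hc1
  rw [hc1]
  rfl

end Map

/-! ### Second moments and independence in product spaces -/

lemma integral_norm_sq_add_prod {Ω₁ Ω₂ : Type*} [MeasurableSpace Ω₁] [MeasurableSpace Ω₂]
    {μ : Measure Ω₁} {ν : Measure Ω₂} [IsProbabilityMeasure μ] [IsProbabilityMeasure ν]
    {f : Ω₁ → ℂ} {N : Ω₂ → ℂ} (hf : MemLp f 2 μ) (hN : MemLp N 2 ν) (h0 : ∫ z, N z ∂ν = 0) :
    MemLp (fun ω : Ω₁ × Ω₂ => f ω.1 + N ω.2) 2 (μ.prod ν) ∧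
      ∫ ω, ‖f ω.1 + N ω.2‖ ^ 2 ∂(μ.prod ν) = ∫ x, ‖f x‖ ^ 2 ∂μ + ∫ z, ‖N z‖ ^ 2 ∂ν := by
  have m1 : MemLp (fun ω : Ω₁ × Ω₂ => f ω.1) 2 (μ.prod ν) := hf.comp_fst ν
  have m2 : MemLp (fun ω : Ω₁ × Ω₂ => N ω.2) 2 (μ.prod ν) := hN.comp_snd μ
  refine ⟨m1.add m2, ?_⟩
  have n1 := m1.integrable_norm_pow (p := 2) (by norm_num)
  have n2 := m2.integrable_norm_pow (p := 2) (by norm_num)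
  have ic : Integrable (fun ω : Ω₁ × Ω₂ => f ω.1 * (starRingEnd ℂ) (N ω.2)) (μ.prod ν) :=
    m1.integrable_mul m2.star
  have e : ∀ ω : Ω₁ × Ω₂, ‖f ω.1 + N ω.2‖ ^ 2 =
      ‖f ω.1‖ ^ 2 + ‖N ω.2‖ ^ 2 + 2 * (f ω.1 * (starRingEnd ℂ) (N ω.2)).re := by
    intro ω
    simp only [← Complex.normSq_eq_norm_sq, Complex.normSq_add]
  have hre := integral_re ic
  simp only [RCLike.re_to_complex] at hre
  have icr : Integrable (fun ω : Ω₁ × Ω₂ => (f ω.1 * (starRingEnd ℂ) (N ω.2)).re) (μ.prod ν) := ic.re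
  have hc : ∫ ω : Ω₁ × Ω₂, f ω.1 * (starRingEnd ℂ) (N ω.2) ∂(μ.prod ν) = 0 := by
    rw [integral_prod_mul f (fun z => (starRingEnd ℂ) (N z)), integral_conj, h0]
    simp
  have n12 : Integrable (fun ω : Ω₁ × Ω₂ => ‖f ω.1‖ ^ 2 + ‖N ω.2‖ ^ 2) (μ.prod ν) := n1.add n2
  simp_rw [e]
  rw [integral_add n12 (icr.const_mul 2), integral_add n1 n2, integral_const_mul, hre, hc,
    integral_fun_fst (fun x => ‖f x‖ ^ 2), integral_fun_snd (fun x => ‖N x‖ ^ 2)]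
  simp

lemma integral_norm_sq_mul_std (c : ℂ) : MemLp (fun z : ℂ => c * z) 2 stdComplexGaussian ∧
    ∫ z, c * z ∂stdComplexGaussian = 0 ∧ ∫ z, ‖c * z‖ ^ 2 ∂stdComplexGaussian = ‖c‖ ^ 2 := by
  refine ⟨memLp_id_std.const_mul c, ?_, ?_⟩
  · rw [integral_const_mul, integral_id_std, mul_zero]
  · simp_rw [norm_mul, mul_pow]
    rw [integral_const_mul, integral_norm_sq_std, mul_one]

/-- One more independent noise in a linear combination. -/
lemma moments_std_prod {Ω : Type*} [MeasurableSpace Ω] {ν : Measure Ω} [IsProbabilityMeasure ν]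
    {N : Ω → ℂ} {v : ℝ} (hN : MemLp N 2 ν ∧ ∫ z, N z ∂ν = 0 ∧ ∫ z, ‖N z‖ ^ 2 ∂ν = v) (c : ℂ) :
    MemLp (fun z : ℂ × Ω => c * z.1 + N z.2) 2 (stdComplexGaussian.prod ν) ∧
      ∫ z, (c * z.1 + N z.2) ∂(stdComplexGaussian.prod ν) = 0 ∧
      ∫ z, ‖c * z.1 + N z.2‖ ^ 2 ∂(stdComplexGaussian.prod ν) = ‖c‖ ^ 2 + v := by
  obtain ⟨h1, h2, h3⟩ := integral_norm_sq_mul_std c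
  have h := integral_norm_sq_add_prod h1 hN.1 hN.2.1
  refine ⟨h.1, ?_, by rw [h.2, h3, hN.2.2]⟩
  have i1 : Integrable (fun z : ℂ × Ω => c * z.1) (stdComplexGaussian.prod ν) :=
    (h1.integrable one_le_two).comp_fst ν
  have i2 : Integrable (fun z : ℂ × Ω => N z.2) (stdComplexGaussian.prod ν) :=
    (hN.1.integrable one_le_two).comp_snd _
  rw [integral_add i1 i2, integral_fun_fst (fun z => c * z), integral_fun_snd N, h2, hN.2.1]
  simp

section Sample

variable {𝒬 : Type} [MeasurableSpace 𝒬] {μ : Measure (𝒬 × ℂ × ℂ × ℂ)} [IsProbabilityMeasure μ]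

/-- Second moment of the sum of a function of the inputs and of a combination of the noises. -/
lemma sampleLaw_moment {f : 𝒬 × ℂ × ℂ × ℂ → ℂ} (hf : MemLp f 2 μ) (c₁ c₂ c₃ c₄ : ℂ) :
    Integrable (fun ω => ‖f ω.1 + (c₁ * ω.2.1 + (c₂ * ω.2.2.1 + (c₃ * ω.2.2.2.1 +
      c₄ * ω.2.2.2.2)))‖ ^ 2) (sampleLaw μ) ∧
    ∫ ω, ‖f ω.1 + (c₁ * ω.2.1 + (c₂ * ω.2.2.1 + (c₃ * ω.2.2.2.1 +
      c₄ * ω.2.2.2.2)))‖ ^ 2 ∂(sampleLaw μ) =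
      ∫ x, ‖f x‖ ^ 2 ∂μ + (‖c₁‖ ^ 2 + (‖c₂‖ ^ 2 + (‖c₃‖ ^ 2 + ‖c₄‖ ^ 2))) := by
  have h := moments_std_prod (moments_std_prod (moments_std_prod (integral_norm_sq_mul_std c₄) c₃) c₂) c₁
  have h' := integral_norm_sq_add_prod hf h.1 h.2.1
  exact ⟨h'.1.integrable_norm_pow (p := 2) (by norm_num), by rw [h'.2, h.2.2]⟩

lemma pairNoise_moment {f : 𝒬 × ℂ × ℂ × ℂ → ℂ} (hf : MemLp f 2 μ) (c₁ c₂ : ℂ) :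
    Integrable (fun ω : (𝒬 × ℂ × ℂ × ℂ) × (ℂ × ℂ) => ‖f ω.1 + (c₁ * ω.2.1 + c₂ * ω.2.2)‖ ^ 2)
      (μ.prod (stdComplexGaussian.prod stdComplexGaussian)) ∧
    ∫ ω, ‖f ω.1 + (c₁ * ω.2.1 + c₂ * ω.2.2)‖ ^ 2
      ∂(μ.prod (stdComplexGaussian.prod stdComplexGaussian)) =
      ∫ x, ‖f x‖ ^ 2 ∂μ + (‖c₁‖ ^ 2 + ‖c₂‖ ^ 2) := by
  have h := moments_std_prod (integral_norm_sq_mul_std c₂) c₁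
  have h' := integral_norm_sq_add_prod hf h.1 h.2.1
  exact ⟨h'.1.integrable_norm_pow (p := 2) (by norm_num), by rw [h'.2, h.2.2]⟩

end Sample

section Indep

variable {α β γ : Type*} [MeasurableSpace α] [MeasurableSpace β] [MeasurableSpace γ]
  {a : Measure α} {b : Measure β} {c : Measure γ} [IsProbabilityMeasure a] [IsProbabilityMeasure b]
  [IsProbabilityMeasure c]

/-- In a triple product the middle coordinate is independent of the others. -/
lemma indepFun_middle : IndepFun (fun ω : α × β × γ => ω.2.1) (fun ω => (ω.1, ω.2.2))
    (a.prod (b.prod c)) := by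
  have e1 : (a.prod (b.prod c)).map (fun ω => (ω.2.1, (ω.1, ω.2.2))) = b.prod (a.prod c) := by
    refine Measure.ext_of_lintegral _ fun F hF => ?_
    rw [lintegral_map hF (by fun_prop), lintegral_prod _ (by fun_prop), lintegral_prod _ (by fun_prop)]
    have h1 : ∀ x : α, ∫⁻ y : β × γ, F (y.1, x, y.2) ∂(b.prod c) =
        ∫⁻ y, ∫⁻ z, F (y, x, z) ∂c ∂b := fun x => lintegral_prod _ (by fun_prop)
    have h2 : ∀ y : β, ∫⁻ x : α × γ, F (y, x) ∂(a.prod c) =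
        ∫⁻ x, ∫⁻ z, F (y, x, z) ∂c ∂a := fun y => lintegral_prod _ (by fun_prop)
    simp_rw [h1, h2]
    rw [lintegral_lintegral_swap]
    have : Measurable fun p : α × β => ∫⁻ z, F (p.2, p.1, z) ∂c :=
      Measurable.lintegral_prod_right' (f := fun q : (α × β) × γ => F (q.1.2, q.1.1, q.2)) (by fun_prop)
    exact this.aemeasurable
  rw [indepFun_iff_map_prod_eq_prod_map_map (by fun_prop) (by fun_prop), e1]
  have e2 : (a.prod (b.prod c)).map (fun ω => ω.2.1) = b := by
    have := congrArg (Measure.map Prod.fst) e1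
    rwa [Measure.map_map (by fun_prop) (by fun_prop), Measure.map_fst_prod, measure_univ,
      one_smul] at this
  have e3 : (a.prod (b.prod c)).map (fun ω => (ω.1, ω.2.2)) = a.prod c := by
    have := congrArg (Measure.map Prod.snd) e1
    rwa [Measure.map_map (by fun_prop) (by fun_prop), Measure.map_snd_prod, measure_univ,
      one_smul] at this
  rw [e2, e3]

lemma map_middle : (a.prod (b.prod c)).map (fun ω => ω.2.1) = b := by
  have : (fun ω : α × β × γ => ω.2.1) = Prod.fst ∘ Prod.snd := rfl
  rw [this, ← Measure.map_map (by fun_prop) (by fun_prop), Measure.map_snd_prod, measure_univ,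
    one_smul, Measure.map_fst_prod, measure_univ, one_smul]

end Indep

/-! ### Centred inputs -/

/-- Variance is at most second moment. Infinite second moments are allowed, because the bound is
applied to the conditional law of `X₁` for every value of `Q`. -/
lemma lintegral_sub_mean_le (κ : Measure ℂ) [IsProbabilityMeasure κ] :
    ∫⁻ x, ‖x - ∫ y, y ∂κ‖ₑ ^ 2 ∂κ ≤ ∫⁻ x, ‖x‖ₑ ^ 2 ∂κ := by
  by_cases h : ∫⁻ x, ‖x‖ₑ ^ 2 ∂κ = ∞
  · rw [h]; exact le_top
  set m := ∫ y, y ∂κ with hm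
  have h1 : MemLp (fun x : ℂ => x) 2 κ := memLp_two_of_lintegral (by fun_prop) h
  have hi : Integrable (fun x : ℂ => x) κ := h1.integrable one_le_two
  have n1 := h1.integrable_norm_pow (p := 2) (by norm_num)
  have e : ∀ x : ℂ, ‖x - m‖ ^ 2 = ‖x‖ ^ 2 + ‖m‖ ^ 2 - 2 * (x * (starRingEnd ℂ) m).re := by
    intro x
    simp only [← Complex.normSq_eq_norm_sq, Complex.normSq_sub]
  have ic : Integrable (fun x : ℂ => x * (starRingEnd ℂ) m) κ := hi.mul_const _
  have hre := integral_re ic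
  simp only [RCLike.re_to_complex] at hre
  have icr : Integrable (fun x : ℂ => (x * (starRingEnd ℂ) m).re) κ := ic.re
  have n1c : Integrable (fun x : ℂ => ‖x‖ ^ 2 + ‖m‖ ^ 2) κ := n1.add (integrable_const _)
  have hval : ∫ x, ‖x - m‖ ^ 2 ∂κ ≤ ∫ x, ‖x‖ ^ 2 ∂κ := by
    simp_rw [e]
    rw [integral_sub n1c (icr.const_mul 2), integral_add n1 (integrable_const _), integral_const_mul,
      hre, integral_mul_const, ← hm, Complex.mul_conj, Complex.ofReal_re, Complex.normSq_eq_norm_sq]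
    simp only [integral_const, probReal_univ, smul_eq_mul, one_mul]
    nlinarith [sq_nonneg ‖m‖]
  have hsub : MemLp (fun x : ℂ => x - m) 2 κ := h1.sub (memLp_const m)
  have hn := hsub.integrable_norm_pow (p := 2) (by norm_num)
  have conv : ∀ {f : ℂ → ℂ}, Integrable (fun x => ‖f x‖ ^ 2) κ →
      ∫⁻ x, ‖f x‖ₑ ^ 2 ∂κ = ENNReal.ofReal (∫ x, ‖f x‖ ^ 2 ∂κ) := by
    intro f hf
    rw [ofReal_integral_eq_lintegral_ofReal hf (Eventually.of_forall fun x => by positivity)]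
    refine lintegral_congr fun x => ?_
    rw [ENNReal.ofReal_pow (norm_nonneg _), ofReal_norm]
  rw [conv hn, conv n1]
  exact ENNReal.ofReal_le_ofReal hval

/-- Linear combination of the inputs, the first of which is centred by `m`. -/
def centredForm {𝒬 : Type} (m : 𝒬 → ℂ) (v : ℂ × ℂ × ℂ) (x : 𝒬 × ℂ × ℂ × ℂ) : ℂ :=
  v.1 * (x.2.1 - m x.1) + v.2.1 * x.2.2.1 + v.2.2 * x.2.2.2

/-- For an admissible input law the error variances of linear estimators are bounded by those of a
Gaussian input of unit variance. -/
lemma IsInputLaw.exists_formVar_bound {𝒬 : Type} [MeasurableSpace 𝒬]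
    {μ : Measure (𝒬 × ℂ × ℂ × ℂ)} [IsProbabilityMeasure μ] (h : IsInputLaw μ) :
    ∃ p ∈ corrBall, ∃ m : 𝒬 → ℂ, Measurable m ∧ ∀ v : ℂ × ℂ × ℂ,
      MemLp (centredForm m v) 2 μ ∧ ∫ x, ‖centredForm m v x‖ ^ 2 ∂μ ≤ formVar p v := by
  obtain ⟨⟨PQ, K₁, K₂, K₀, hPQ, hK₁, hK₂, hK₀, hμ⟩, hp1, hp2, hp0⟩ := h
  have hlaw : μ.map (fun p => (p.1, p.2.1, p.2.2.1)) = PQ ⊗ₘ (K₁ ×ₖ K₂) := by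
    rw [hμ, Measure.map_map (by fun_prop) (by fun_prop)]
    exact Measure.fst_compProd _ K₀
  -- Subtracting the conditional mean makes `X₁` uncorrelated with `X₂` although both depend on `Q`;
  -- centring one of the two is enough. Every output term conditions on `Q`, so estimators may use
  -- `m`.
  let m : 𝒬 → ℂ := fun q => ∫ x, x ∂(K₁ q)
  have hm : Measurable m :=
    (StronglyMeasurable.integral_kernel_prod_right' (κ := K₁) (f := fun p : 𝒬 × ℂ => p.2)
      (by fun_prop)).measurable
  have hq1 : ∫⁻ p, ‖p.2.1 - m p.1‖ₑ ^ 2 ∂μ ≤ 1 := by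
    have e : ∀ F : 𝒬 × ℂ → ℝ≥0∞, Measurable F →
        ∫⁻ p, F (p.1, p.2.1) ∂μ = ∫⁻ q, ∫⁻ x, F (q, x) ∂(K₁ q) ∂PQ := by
      intro F hF
      have : ∫⁻ p, F (p.1, p.2.1) ∂μ = ∫⁻ p, F (p.1, p.2.1)
          ∂(μ.map (fun p => (p.1, p.2.1, p.2.2.1))) := by
        rw [lintegral_map (by fun_prop) (by fun_prop)]
      rw [this, hlaw, Measure.lintegral_compProd (by fun_prop)]
      refine lintegral_congr fun q => ?_
      rw [Kernel.lintegral_prod _ _ _ (by fun_prop)]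
      simp
    have e1 := e (fun p => ‖p.2‖ₑ ^ 2) (by fun_prop)
    have e2 := e (fun p => ‖p.2 - m p.1‖ₑ ^ 2) (by fun_prop)
    refine le_trans ?_ hp1
    simp only at e1 e2
    rw [e1, e2]
    exact lintegral_mono fun q => lintegral_sub_mean_le (K₁ q)
  have toInt : ∀ {f : 𝒬 × ℂ × ℂ × ℂ → ℂ}, Measurable f → ∫⁻ p, ‖f p‖ₑ ^ 2 ∂μ ≤ 1 →
      MemLp f 2 μ ∧ ∫ p, ‖f p‖ ^ 2 ∂μ ≤ 1 := by
    intro f hf h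
    refine ⟨memLp_two_of_lintegral hf.aestronglyMeasurable (ne_top_of_le_ne_top (by simp) h), ?_⟩
    rw [integral_norm_sq_eq hf.aestronglyMeasurable]
    exact ENNReal.toReal_le_of_le_ofReal zero_le_one (by simpa using h)
  obtain ⟨m1, b1⟩ := toInt (f := fun p => p.2.1 - m p.1) (by fun_prop) hq1
  obtain ⟨m2, b2⟩ := toInt (f := fun p => p.2.2.1) (by fun_prop) hp2
  obtain ⟨m0, b0⟩ := toInt (f := fun p => p.2.2.2) (by fun_prop) hp0
  have horth : ∫ p, (p.2.1 - m p.1) * (starRingEnd ℂ) (p.2.2.1) ∂μ = 0 := by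
    have hF : Integrable (fun p : 𝒬 × ℂ × ℂ => (p.2.1 - m p.1) * (starRingEnd ℂ) p.2.2)
        (PQ ⊗ₘ (K₁ ×ₖ K₂)) := by
      rw [← hlaw, integrable_map_measure (by fun_prop) (by fun_prop)]
      exact m1.integrable_mul m2.star
    have : ∫ p, (p.2.1 - m p.1) * (starRingEnd ℂ) (p.2.2.1) ∂μ =
        ∫ p, (p.2.1 - m p.1) * (starRingEnd ℂ) p.2.2 ∂(μ.map (fun p => (p.1, p.2.1, p.2.2.1))) := by
      rw [integral_map (by fun_prop) (by fun_prop)]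
    rw [this, hlaw, Measure.integral_compProd hF]
    refine integral_eq_zero_of_ae (Eventually.of_forall fun q => ?_)
    simp only [Kernel.prod_apply, Pi.zero_apply]
    rw [integral_prod_mul (fun x => x - m q) (fun y => (starRingEnd ℂ) y)]
    have : ∫ x, (x - m q) ∂(K₁ q) = 0 := by
      -- If the identity is not integrable under `K₁ q`, the integral still vanishes by the default
      -- value, so orthogonality holds for every `q`.
      by_cases hi : Integrable (fun x : ℂ => x) (K₁ q)
      · rw [integral_sub hi (integrable_const _)]
        simp [m]
      · refine integral_undef fun h => hi ?_
        exact (h.add (integrable_const (m q))).congr (Eventually.of_forall fun x => by simp)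
    rw [this, zero_mul]
  obtain ⟨p, hp, hb⟩ := ICCR.exists_formVar_bound m1 m2 m0 b1 b2 b0 horth
  exact ⟨p, hp, m, hm, fun v => ⟨((m1.const_mul _).add (m2.const_mul _)).add (m0.const_mul _), hb v⟩⟩

/-! ### Couplings with Gaussian noises -/

/-- Used with `r = √(1 - ‖s‖²)`: the combination is again standard, and its correlation with the
second Gaussian is `s`. -/
lemma map_std_prod_std {r : ℝ} {s : ℂ} (h : r ^ 2 + ‖s‖ ^ 2 = 1) :
    (stdComplexGaussian.prod stdComplexGaussian).map (fun z => (r : ℂ) * z.1 + s * z.2) =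
      stdComplexGaussian := by
  have h1 : IsProbabilityMeasure ((stdComplexGaussian.prod stdComplexGaussian).map
      (fun z => (r : ℂ) * z.1 + s * z.2)) := Measure.isProbabilityMeasure_map (by fun_prop)
  refine Measure.ext_of_charFunDual ?_
  ext L
  obtain ⟨a, ha⟩ := exists_re_mul_eq L
  simp only [charFunDual_apply, ha]
  rw [integral_map (by fun_prop) (by fun_prop)]
  have e : ∀ z : ℂ × ℂ, Complex.exp (((a * ((r : ℂ) * z.1 + s * z.2)).re : ℂ) * Complex.I) =
      Complex.exp (Complex.I * (((a * r) * z.1).re : ℂ)) *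
        Complex.exp (Complex.I * (((a * s) * z.2).re : ℂ)) := by
    intro z
    rw [← Complex.exp_add, ← mul_add, mul_add a, Complex.add_re, ← mul_assoc, ← mul_assoc,
      mul_comm _ Complex.I]
    push_cast
    rfl
  simp_rw [e]
  rw [integral_prod_mul (f := fun x : ℂ => Complex.exp (Complex.I * (((a * r) * x).re : ℂ)))
    (g := fun x : ℂ => Complex.exp (Complex.I * (((a * s) * x).re : ℂ)))]
  simp_rw [mul_comm _ Complex.I, integral_cexp_std]
  rw [← Complex.exp_add]
  congr 1
  rw [norm_mul, norm_mul, Complex.norm_real, ← add_div, ← Complex.ofReal_neg, ← Complex.ofReal_neg,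
    ← Complex.ofReal_neg, ← Complex.ofReal_add]
  congr 2
  rw [mul_pow, mul_pow, Real.norm_eq_abs, sq_abs]
  linear_combination (-‖a‖ ^ 2) * h

/-- The channel whose noises are the given functions of two independent standard Gaussians. -/
def noiseKernel (g : Gains) (N : ℂ × ℂ → ℂ × ℂ) : Kernel (ℂ × ℂ × ℂ) (ℂ × ℂ) :=
  (Kernel.id ×ₖ Kernel.const _ (stdComplexGaussian.prod stdComplexGaussian)).map
    (fun p => (g.signal1 p.1 + (N p.2).1, g.signal2 p.1 + (N p.2).2))

@[fun_prop]
lemma Gains.measurable_signal1 (g : Gains) : Measurable g.signal1 := by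
  unfold Gains.signal1; fun_prop

@[fun_prop]
lemma Gains.measurable_signal2 (g : Gains) : Measurable g.signal2 := by
  unfold Gains.signal2; fun_prop

variable (g : Gains) {N : ℂ × ℂ → ℂ × ℂ}

lemma isMarkovKernel_noiseKernel (hN : Measurable N) : IsMarkovKernel (noiseKernel g N) :=
  Kernel.IsMarkovKernel.map _ (by fun_prop)

lemma noiseKernel_apply (hN : Measurable N) (x : ℂ × ℂ × ℂ) :
    noiseKernel g N x = (stdComplexGaussian.prod stdComplexGaussian).map
      (fun z => (g.signal1 x + (N z).1, g.signal2 x + (N z).2)) := by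
  unfold noiseKernel
  ext s hs
  rw [Kernel.map_apply' _ (by fun_prop) _ hs, Kernel.id_prod_apply' _ _ ((by fun_prop : Measurable
    fun p : (ℂ × ℂ × ℂ) × ℂ × ℂ => (g.signal1 p.1 + (N p.2).1, g.signal2 p.1 + (N p.2).2)) hs),
    Kernel.const_apply, Measure.map_apply (by fun_prop) hs]
  rfl

lemma isCoupling_noiseKernel (hN : Measurable N)
    (h1 : (stdComplexGaussian.prod stdComplexGaussian).map (fun z => (N z).1) = stdComplexGaussian)
    (h2 : (stdComplexGaussian.prod stdComplexGaussian).map (fun z => (N z).2) = stdComplexGaussian) :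
    IsCoupling g (noiseKernel g N) := by
  have key : ∀ (c : ℂ) (f : ℂ × ℂ → ℂ), Measurable f →
      (stdComplexGaussian.prod stdComplexGaussian).map (fun z => c + f z) =
        ((stdComplexGaussian.prod stdComplexGaussian).map f).map (fun z => c + z) := by
    intro c f hf
    rw [Measure.map_map (by fun_prop) hf]
    rfl
  constructor
  · intro x
    rw [noiseKernel_apply g hN, Gains.channelLaw, Measure.map_map (by fun_prop) (by fun_prop),
      Measure.map_map (by fun_prop) (by fun_prop)]
    refine (key (g.signal1 x) (fun z => (N z).1) (by fun_prop)).trans ?_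
    refine Eq.trans ?_ (key (g.signal1 x) Prod.fst (by fun_prop)).symm
    rw [h1, Measure.map_fst_prod, measure_univ, one_smul]
  · intro x
    rw [noiseKernel_apply g hN, Gains.channelLaw, Measure.map_map (by fun_prop) (by fun_prop),
      Measure.map_map (by fun_prop) (by fun_prop)]
    refine (key (g.signal2 x) (fun z => (N z).2) (by fun_prop)).trans ?_
    refine Eq.trans ?_ (key (g.signal2 x) Prod.snd (by fun_prop)).symm
    rw [h2, Measure.map_snd_prod, measure_univ, one_smul]

lemma couplingLaw_noiseKernel {𝒬 : Type} [MeasurableSpace 𝒬] (μ : Measure (𝒬 × ℂ × ℂ × ℂ))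
    [IsProbabilityMeasure μ] (hN : Measurable N) :
    couplingLaw μ (noiseKernel g N) = (μ.prod (stdComplexGaussian.prod stdComplexGaussian)).map
      (fun ω => (ω.1, (g.signal1 ω.1.2 + (N ω.2).1, g.signal2 ω.1.2 + (N ω.2).2))) := by
  have := isMarkovKernel_noiseKernel g hN
  refine Measure.ext_of_lintegral _ fun F hF => ?_
  rw [Measure.lintegral_compProd hF, lintegral_map hF (by fun_prop), lintegral_prod _ (by fun_prop)]
  refine lintegral_congr fun x => ?_
  rw [Kernel.comap_apply, noiseKernel_apply g hN, lintegral_map (by fun_prop) (by fun_prop)]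

/-! ### Inputs with time sharing are dominated by Gaussian inputs -/

section Outer

variable {𝒬 : Type} [MeasurableSpace 𝒬] {μ : Measure (𝒬 × ℂ × ℂ × ℂ)} [IsProbabilityMeasure μ]

lemma measurable_rvs : Measurable (rvQ : Sample 𝒬 → 𝒬) ∧ Measurable (rvX1 : Sample 𝒬 → ℂ) ∧
    Measurable (rvX2 : Sample 𝒬 → ℂ) ∧ Measurable (rvX0 : Sample 𝒬 → ℂ) ∧
    Measurable (rvY1 g : Sample 𝒬 → ℂ) ∧ Measurable (rvY2 g : Sample 𝒬 → ℂ) ∧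
    Measurable (rvV1 g : Sample 𝒬 → ℂ) ∧ Measurable (rvV2 g : Sample 𝒬 → ℂ) ∧
    Measurable (rvVt1 g : Sample 𝒬 → ℂ) ∧ Measurable (rvVt2 g : Sample 𝒬 → ℂ) := by
  unfold rvQ rvX1 rvX2 rvX0 rvY1 rvY2 rvV1 rvV2 rvVt1 rvVt2 rvX1 rvX2
  refine ⟨?_, ?_, ?_, ?_, ?_, ?_, ?_, ?_, ?_, ?_⟩ <;> fun_prop

lemma map_noise1 : (sampleLaw μ).map (fun ω => ω.2.1) = stdComplexGaussian := map_middle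

lemma map_snd_snd {α β : Type*} [MeasurableSpace α] [MeasurableSpace β] {a : Measure α}
    {b : Measure β} [IsProbabilityMeasure a] [IsProbabilityMeasure b] :
    (a.prod b).map Prod.snd = b := by
  rw [Measure.map_snd_prod, measure_univ, one_smul]

lemma map_noise2 : (sampleLaw μ).map (fun ω => ω.2.2.1) = stdComplexGaussian := by
  have : (fun ω : Sample 𝒬 => ω.2.2.1) = (fun z : ℂ × ℂ × ℂ × ℂ => z.2.1) ∘ Prod.snd := rfl
  rw [this, ← Measure.map_map (by fun_prop) (by fun_prop), map_snd_snd, map_middle]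

lemma map_noise3 : (sampleLaw μ).map (fun ω => ω.2.2.2.1) = stdComplexGaussian := by
  have : (fun ω : Sample 𝒬 => ω.2.2.2.1) = (fun z : ℂ × ℂ × ℂ => z.2.1) ∘ Prod.snd ∘ Prod.snd := rfl
  rw [this, ← Measure.map_map (by fun_prop) (by fun_prop),
    ← Measure.map_map (by fun_prop) (by fun_prop), map_snd_snd, map_snd_snd, map_middle]

lemma map_noise4 : (sampleLaw μ).map (fun ω => ω.2.2.2.2) = stdComplexGaussian := by
  have : (fun ω : Sample 𝒬 => ω.2.2.2.2) =
    (Prod.snd : ℂ × ℂ → ℂ) ∘ Prod.snd ∘ Prod.snd ∘ Prod.snd := rfl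
  rw [this, ← Measure.map_map (by fun_prop) (by fun_prop),
    ← Measure.map_map (by fun_prop) (by fun_prop), ← Measure.map_map (by fun_prop) (by fun_prop),
    map_snd_snd, map_snd_snd, map_snd_snd, map_snd_snd]

lemma indepFun_noise1 : IndepFun (fun ω => ω.2.1) (fun ω => (ω.1, ω.2.2)) (sampleLaw μ) :=
  indepFun_middle

/-- Grouping the first noise with the inputs makes the second noise the middle factor of a triple
product. -/
lemma indepFun_noise2 : IndepFun (fun ω => ω.2.2.1) (fun ω => (ω.1, ω.2.1, ω.2.2.2))
    (sampleLaw μ) := by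
  have e : sampleLaw μ = ((μ.prod stdComplexGaussian).prod (stdComplexGaussian.prod
      (stdComplexGaussian.prod stdComplexGaussian))).map
      (fun ω : ((𝒬 × ℂ × ℂ × ℂ) × ℂ) × ℂ × ℂ × ℂ => (ω.1.1, ω.1.2, ω.2)) :=
    (measurePreserving_prodAssoc μ stdComplexGaussian _).map_eq.symm
  rw [indepFun_iff_map_prod_eq_prod_map_map (by fun_prop) (by fun_prop)]
  have h := (indepFun_iff_map_prod_eq_prod_map_map (by fun_prop) (by fun_prop)).mp
    (indepFun_middle (a := μ.prod stdComplexGaussian) (b := stdComplexGaussian)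
      (c := stdComplexGaussian.prod stdComplexGaussian))
  have h' := (indepFun_iff_map_prod_eq_prod_map_map (by fun_prop) (by fun_prop)).mp
    ((indepFun_middle (a := μ.prod stdComplexGaussian) (b := stdComplexGaussian)
      (c := stdComplexGaussian.prod stdComplexGaussian)).comp measurable_id
      (by fun_prop : Measurable fun p : ((𝒬 × ℂ × ℂ × ℂ) × ℂ) × ℂ × ℂ => (p.1.1, p.1.2, p.2)))
  rw [e, Measure.map_map (by fun_prop) (by fun_prop), Measure.map_map (by fun_prop) (by fun_prop),
    Measure.map_map (by fun_prop) (by fun_prop)]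
  exact h'

variable {g}

/-- A nonnegative right side undoes the truncation in `ENNReal.ofReal`, whatever the sign of `x`. -/
lemma le_of_ofReal_le {x a : ℝ} (ha : 0 ≤ a) {I : ℝ≥0∞} (h : ENNReal.ofReal x ≤ I)
    (hI : I ≤ ENNReal.ofReal (a / Real.log 2)) : x * Real.log 2 ≤ a := by
  have hl2 : 0 < Real.log 2 := Real.log_pos (by norm_num)
  have := (ENNReal.ofReal_le_ofReal_iff (by positivity)).mp (h.trans hI)
  rwa [le_div_iff₀ hl2] at this

lemma le_of_ofReal_le_add {x a b : ℝ} (ha : 0 ≤ a) (hb : 0 ≤ b) {I J : ℝ≥0∞}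
    (h : ENNReal.ofReal x ≤ I + J) (hI : I ≤ ENNReal.ofReal (a / Real.log 2))
    (hJ : J ≤ ENNReal.ofReal (b / Real.log 2)) : x * Real.log 2 ≤ a + b := by
  have hl2 : 0 < Real.log 2 := Real.log_pos (by norm_num)
  refine le_of_ofReal_le (by positivity) h ((add_le_add hI hJ).trans ?_)
  rw [← ENNReal.ofReal_add (by positivity) (by positivity), add_div]

lemma std_eq_gden_one : stdComplexGaussian = volume.withDensity fun z => ENNReal.ofReal (gden 1 z) :=
  stdComplexGaussian_eq_withDensity

/-- The function `S` expresses that `(C, B)` determines the signal, so only `Z₁` remains of the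
output; the estimator `e (C)` then has error variance at most `w + 1`. -/
lemma condMutualInfo_Y1_le {β γ : Type} [MeasurableSpace β] [StandardBorelSpace β] [Nonempty β]
    [MeasurableSpace γ] {B : 𝒬 × ℂ × ℂ × ℂ → β} {C : 𝒬 × ℂ × ℂ × ℂ → γ} (hB : Measurable B)
    (hC : Measurable C) {S : γ × β → ℂ} (hS : Measurable S)
    (hSx : ∀ x, g.signal1 x.2 = S (C x, B x)) {e : γ → ℂ} (he : Measurable e) {w : ℝ}
    (hm : MemLp (fun x => g.signal1 x.2 - e (C x)) 2 μ)
    (hw : ∫ x, ‖g.signal1 x.2 - e (C x)‖ ^ 2 ∂μ ≤ w) :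
    condMutualInfo (sampleLaw μ) (rvY1 g) (fun ω => B ω.1) (fun ω => C ω.1) ≤
      ENNReal.ofReal (Real.log (w + 1) / Real.log 2) := by
  have hw0 : 0 ≤ w := (integral_nonneg fun x => by positivity).trans hw
  obtain ⟨-, -, -, -, hY1, -⟩ := measurable_rvs (𝒬 := 𝒬) g
  have hres : ∀ ω : Sample 𝒬, rvY1 g ω - S (C ω.1, B ω.1) = ω.2.1 := by
    intro ω; rw [← hSx]; unfold rvY1; ring
  obtain ⟨i1, i2⟩ := sampleLaw_moment hm 1 0 0 0
  have hres2 : ∀ ω : Sample 𝒬, rvY1 g ω - e (C ω.1) = (g.signal1 ω.1.2 - e (C ω.1)) +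
      (1 * ω.2.1 + (0 * ω.2.2.1 + (0 * ω.2.2.2.1 + 0 * ω.2.2.2.2))) := by
    intro ω; unfold rvY1; ring
  have h := condMutualInfo_le (P := sampleLaw μ) (A := rvY1 g) (B := fun ω => B ω.1)
    (C := fun ω => C ω.1) hY1 (by fun_prop) (by fun_prop) hS he one_pos
    (w := w + 1) (by positivity) ?_ ?_ ?_ ?_ ?_
  · simpa using h
  · simp only [hres]
    exact indepFun_noise1.comp measurable_id (by fun_prop : Measurable
      fun p : (𝒬 × ℂ × ℂ × ℂ) × ℂ × ℂ × ℂ => (C p.1, B p.1))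
  · simp only [hres]; rw [map_noise1, std_eq_gden_one]
  · simp only [hres]
    rw [← integral_map (μ := sampleLaw μ) (φ := fun ω => ω.2.1) (f := fun z : ℂ => ‖z‖ ^ 2)
      (by fun_prop) (by fun_prop), map_noise1, integral_norm_sq_std]
  · simp only [hres2]; exact i1
  · simp only [hres2]; rw [i2]; simpa using hw

lemma condMutualInfo_Y2_le {β γ : Type} [MeasurableSpace β] [StandardBorelSpace β] [Nonempty β]
    [MeasurableSpace γ] {B : 𝒬 × ℂ × ℂ × ℂ → β} {C : 𝒬 × ℂ × ℂ × ℂ → γ} (hB : Measurable B)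
    (hC : Measurable C) {S : γ × β → ℂ} (hS : Measurable S)
    (hSx : ∀ x, g.signal2 x.2 = S (C x, B x)) {e : γ → ℂ} (he : Measurable e) {w : ℝ}
    (hm : MemLp (fun x => g.signal2 x.2 - e (C x)) 2 μ)
    (hw : ∫ x, ‖g.signal2 x.2 - e (C x)‖ ^ 2 ∂μ ≤ w) :
    condMutualInfo (sampleLaw μ) (rvY2 g) (fun ω => B ω.1) (fun ω => C ω.1) ≤
      ENNReal.ofReal (Real.log (w + 1) / Real.log 2) := by
  have hw0 : 0 ≤ w := (integral_nonneg fun x => by positivity).trans hw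
  obtain ⟨-, -, -, -, -, hY2, -⟩ := measurable_rvs (𝒬 := 𝒬) g
  have hres : ∀ ω : Sample 𝒬, rvY2 g ω - S (C ω.1, B ω.1) = ω.2.2.1 := by
    intro ω; rw [← hSx]; unfold rvY2; ring
  obtain ⟨i1, i2⟩ := sampleLaw_moment hm 0 1 0 0
  have hres2 : ∀ ω : Sample 𝒬, rvY2 g ω - e (C ω.1) = (g.signal2 ω.1.2 - e (C ω.1)) +
      (0 * ω.2.1 + (1 * ω.2.2.1 + (0 * ω.2.2.2.1 + 0 * ω.2.2.2.2))) := by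
    intro ω; unfold rvY2; ring
  have h := condMutualInfo_le (P := sampleLaw μ) (A := rvY2 g) (B := fun ω => B ω.1)
    (C := fun ω => C ω.1) hY2 (by fun_prop) (by fun_prop) hS he one_pos
    (w := w + 1) (by positivity) ?_ ?_ ?_ ?_ ?_
  · simpa using h
  · simp only [hres]
    exact indepFun_noise2.comp measurable_id (by fun_prop : Measurable
      fun p : (𝒬 × ℂ × ℂ × ℂ) × ℂ × ℂ × ℂ => (C p.1, B p.1))
  · simp only [hres]; rw [map_noise2, std_eq_gden_one]
  · simp only [hres]
    rw [← integral_map (μ := sampleLaw μ) (φ := fun ω => ω.2.2.1) (f := fun z : ℂ => ‖z‖ ^ 2)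
      (by fun_prop) (by fun_prop), map_noise2, integral_norm_sq_std]
  · simp only [hres2]; exact i1
  · simp only [hres2]; rw [i2]; simpa using hw

/-- The conditioning variable may contain `Z̃₂`, through `Ṽ₁`. The estimation error is the sum of
the independent terms `f (X)`, `Z₁` and `-α Z̃₂`, whence the addend `1 + ‖α‖²`. -/
lemma condEntropy_Y1_le {γ : Type} [MeasurableSpace γ] {C : (𝒬 × ℂ × ℂ × ℂ) × ℂ → γ}
    (hC : Measurable C) {e : γ → ℂ} (he : Measurable e) {w : ℝ} {f : 𝒬 × ℂ × ℂ × ℂ → ℂ} {α : ℂ}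
    (hf : ∀ x z, g.signal1 x.2 - e (C (x, z)) = f x - α * z) (hm : MemLp f 2 μ)
    (hw : ∫ x, ‖f x‖ ^ 2 ∂μ ≤ w) :
    condEntropy (sampleLaw μ) (rvY1 g) (fun ω => C (ω.1, ω.2.2.2.2)) ≤
      (Real.log (Real.pi * (w + (1 + ‖α‖ ^ 2))) + 1) / Real.log 2 := by
  have hw0 : 0 ≤ w := (integral_nonneg fun x => by positivity).trans hw
  obtain ⟨-, -, -, -, hY1, -⟩ := measurable_rvs (𝒬 := 𝒬) g
  obtain ⟨i1, i2⟩ := sampleLaw_moment hm 1 0 0 (-α)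
  have hres2 : ∀ ω : Sample 𝒬, rvY1 g ω - e (C (ω.1, ω.2.2.2.2)) = f ω.1 +
      (1 * ω.2.1 + (0 * ω.2.2.1 + (0 * ω.2.2.2.1 + (-α) * ω.2.2.2.2))) := by
    intro ω
    have := hf ω.1 ω.2.2.2.2
    unfold rvY1
    linear_combination this
  have hD : ∀ ω : Sample 𝒬, rvY1 g ω - g.signal1 ω.1.2 = ω.2.1 := by
    intro ω; unfold rvY1; ring
  refine condEntropy_le (P := sampleLaw μ) hY1 (by fun_prop) ?_ he ?_ ?_ ?_
  -- Everything except `Z₁` is put into `D`, so that `Z₁` alone provides the density.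
  · refine map_prodMk_absolutelyContinuous_of_noise (P := sampleLaw μ) (v := 1) hY1
      (D := fun ω => (ω.1, ω.2.2)) (by fun_prop) (S := fun d => g.signal1 d.1.2) (by fun_prop) ?_ ?_
      (φ := fun d => C (d.1, d.2.2.2)) (by fun_prop)
    · simp only [hD]; exact indepFun_noise1
    · simp only [hD]; rw [map_noise1, std_eq_gden_one]
  · nlinarith [sq_nonneg ‖α‖]
  · simp only [hres2]; exact i1
  · simp only [hres2]; rw [i2]; simpa using hw

lemma condEntropy_Y2_le {γ : Type} [MeasurableSpace γ] {C : (𝒬 × ℂ × ℂ × ℂ) × ℂ → γ}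
    (hC : Measurable C) {e : γ → ℂ} (he : Measurable e) {w : ℝ} {f : 𝒬 × ℂ × ℂ × ℂ → ℂ} {α : ℂ}
    (hf : ∀ x z, g.signal2 x.2 - e (C (x, z)) = f x - α * z) (hm : MemLp f 2 μ)
    (hw : ∫ x, ‖f x‖ ^ 2 ∂μ ≤ w) :
    condEntropy (sampleLaw μ) (rvY2 g) (fun ω => C (ω.1, ω.2.2.2.1)) ≤
      (Real.log (Real.pi * (w + (1 + ‖α‖ ^ 2))) + 1) / Real.log 2 := by
  have hw0 : 0 ≤ w := (integral_nonneg fun x => by positivity).trans hw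
  obtain ⟨-, -, -, -, -, hY2, -⟩ := measurable_rvs (𝒬 := 𝒬) g
  obtain ⟨i1, i2⟩ := sampleLaw_moment hm 0 1 (-α) 0
  have hres2 : ∀ ω : Sample 𝒬, rvY2 g ω - e (C (ω.1, ω.2.2.2.1)) = f ω.1 +
      (0 * ω.2.1 + (1 * ω.2.2.1 + ((-α) * ω.2.2.2.1 + 0 * ω.2.2.2.2))) := by
    intro ω
    have := hf ω.1 ω.2.2.2.1
    unfold rvY2
    linear_combination this
  have hD : ∀ ω : Sample 𝒬, rvY2 g ω - g.signal2 ω.1.2 = ω.2.2.1 := by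
    intro ω; unfold rvY2; ring
  refine condEntropy_le (P := sampleLaw μ) hY2 (by fun_prop) ?_ he ?_ ?_ ?_
  · refine map_prodMk_absolutelyContinuous_of_noise (P := sampleLaw μ) (v := 1) hY2
      (D := fun ω => (ω.1, ω.2.1, ω.2.2.2)) (by fun_prop) (S := fun d => g.signal2 d.1.2)
      (by fun_prop) ?_ ?_ (φ := fun d => C (d.1, d.2.2.1)) (by fun_prop)
    · simp only [hD]; exact indepFun_noise2
    · simp only [hD]; rw [map_noise2, std_eq_gden_one]
  · nlinarith [sq_nonneg ‖α‖]
  · simp only [hres2]; exact i1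
  · simp only [hres2]; rw [i2]; simpa using hw

/-- The conditional entropies of the interfering signals given the inputs are those of the noise. -/
lemma condEntropy_noise (μ : Measure (𝒬 × ℂ × ℂ × ℂ)) [IsProbabilityMeasure μ] (g : Gains) :
    condEntropy (sampleLaw μ) (rvVt1 g) rvX1 = (Real.log Real.pi + 1) / Real.log 2 ∧
    condEntropy (sampleLaw μ) (rvVt2 g) rvX2 = (Real.log Real.pi + 1) / Real.log 2 ∧
    condEntropy (sampleLaw μ) (rvV1 g) rvX1 = (Real.log Real.pi + 1) / Real.log 2 ∧
    condEntropy (sampleLaw μ) (rvV2 g) rvX2 = (Real.log Real.pi + 1) / Real.log 2 := by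
  obtain ⟨hQ, hX1, hX2, hX0, hY1, hY2, hV1, hV2, hVt1, hVt2⟩ := measurable_rvs (𝒬 := 𝒬) g
  have key : ∀ {A X : Sample 𝒬 → ℂ} {N : ℂ × ℂ × ℂ × ℂ → ℂ} {Y : 𝒬 × ℂ × ℂ × ℂ → ℂ} (h : ℂ),
      Measurable A → Measurable N → Measurable Y → (∀ ω, X ω = Y ω.1) →
      (∀ ω, A ω = h * X ω + N ω.2) →
      (sampleLaw μ).map (fun ω => N ω.2) = stdComplexGaussian →
      condEntropy (sampleLaw μ) A X = (Real.log Real.pi + 1) / Real.log 2 := by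
    intro A X N Y h hA hN hY hX hAX hlaw
    have hXm : Measurable X := by
      have : X = fun ω => Y ω.1 := funext hX
      rw [this]; fun_prop
    have e : ∀ ω, A ω - h * X ω = N ω.2 := by intro ω; rw [hAX]; ring
    have := condEntropy_eq (P := sampleLaw μ) hA hXm (m := fun x => h * x) (by fun_prop) one_pos ?_ ?_
    · rwa [mul_one] at this
    · simp only [e]
      have : X = fun ω => Y ω.1 := funext hX
      rw [this]
      exact (indepFun_prod hY hN).symm
    · simp only [e]; rw [hlaw, std_eq_gden_one]
  refine ⟨?_, ?_, ?_, ?_⟩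
  · exact key (N := fun z => z.2.2.2) (Y := fun x => x.2.1) g.h21 hVt1 (by fun_prop) (by fun_prop)
      (fun _ => rfl) (fun _ => rfl) map_noise4
  · exact key (N := fun z => z.2.2.1) (Y := fun x => x.2.2.1) g.h12 hVt2 (by fun_prop) (by fun_prop)
      (fun _ => rfl) (fun _ => rfl) map_noise3
  · exact key (N := fun z => z.2.1) (Y := fun x => x.2.1) g.h21 hV1 (by fun_prop) (by fun_prop)
      (fun _ => rfl) (fun _ => rfl) map_noise2
  · exact key (N := fun z => z.1) (Y := fun x => x.2.2.1) g.h12 hV2 (by fun_prop) (by fun_prop)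
      (fun _ => rfl) (fun _ => rfl) map_noise1

end Outer

/-! ### Genie terms for Gaussian couplings, and the outer region inside the closed form -/

section Outer

variable {𝒬 : Type} [MeasurableSpace 𝒬] {μ : Measure (𝒬 × ℂ × ℂ × ℂ)} [IsProbabilityMeasure μ]

lemma one_sub_norm_sq_pos {s : ℂ} (hs : ‖s‖ < 1) : 0 < 1 - ‖s‖ ^ 2 := by
  nlinarith [norm_nonneg s]

lemma condMutualInfo_congr_measure {Ω α β γ : Type*} [MeasurableSpace Ω] [MeasurableSpace α]
    [StandardBorelSpace α] [Nonempty α] [MeasurableSpace β] [StandardBorelSpace β] [Nonempty β]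
    [MeasurableSpace γ] {P P' : Measure Ω} [IsFiniteMeasure P] [IsFiniteMeasure P'] (h : P = P')
    (A : Ω → α) (B : Ω → β) (C : Ω → γ) : condMutualInfo P A B C = condMutualInfo P' A B C := by
  subst h; rfl

/-- The conditioning contains the other output `σ' + Z`, and the noise of the observation has
correlation `s` with `Z`. Given all inputs a noise of variance `1 - ‖s‖²` is left, while the
estimator with coefficient `α` incurs the noise variance `noiseVar α s`. -/
lemma condMutualInfo_genie_le {σ σ' X : ℂ × ℂ × ℂ → ℂ} {B : ℂ × ℂ × ℂ → ℂ × ℂ}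
    (hσ : Measurable σ) (hσ' : Measurable σ') (hX : Measurable X) (hB : Measurable B)
    {T T' : ℂ × ℂ × ℂ → ℂ} (hT : Measurable T) (hT' : Measurable T')
    (hσT : ∀ x, σ x = T (X x, B x)) (hσT' : ∀ x, σ' x = T' (X x, B x)) {s : ℂ} (hs : ‖s‖ < 1)
    (α : ℂ) {e : 𝒬 × ℂ → ℂ} (he : Measurable e) {w : ℝ}
    (hm : MemLp (fun x : 𝒬 × ℂ × ℂ × ℂ => σ x.2 - α * σ' x.2 - e (x.1, X x.2)) 2 μ)
    (hw : ∫ x, ‖σ x.2 - α * σ' x.2 - e (x.1, X x.2)‖ ^ 2 ∂μ ≤ w) :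
    condMutualInfo (μ.prod (stdComplexGaussian.prod stdComplexGaussian))
      (fun ω => σ ω.1.2 + (((Real.sqrt (1 - ‖s‖ ^ 2) : ℝ) : ℂ) * ω.2.1 + s * ω.2.2))
      (fun ω => B ω.1.2) (fun ω => (ω.1.1, σ' ω.1.2 + ω.2.2, X ω.1.2)) ≤
      ENNReal.ofReal ((Real.log (w + noiseVar α s) - Real.log (1 - ‖s‖ ^ 2)) / Real.log 2) := by
  have hv := one_sub_norm_sq_pos hs
  have hw0 : 0 ≤ w := (integral_nonneg fun x => by positivity).trans hw
  set r : ℝ := Real.sqrt (1 - ‖s‖ ^ 2) with hr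
  have hr2 : ‖(r : ℂ)‖ ^ 2 = 1 - ‖s‖ ^ 2 := by
    rw [Complex.norm_real, Real.norm_eq_abs, sq_abs, hr, Real.sq_sqrt hv.le]
  obtain ⟨i1, i2⟩ := pairNoise_moment hm r (s - α)
  have hn := noiseVar_pos α hs
  rw [← Real.log_div (by positivity) hv.ne']
  -- Once the inputs are known, the genie's noise is recovered as its output minus `T'`. Multiplying
  -- by `s` predicts the correlated part of the noise.
  let S : (𝒬 × ℂ × ℂ) × ℂ × ℂ → ℂ := fun p => T (p.1.2.2, p.2) + s * (p.1.2.1 - T' (p.1.2.2, p.2))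
  have hres : ∀ ω : (𝒬 × ℂ × ℂ × ℂ) × ℂ × ℂ, σ ω.1.2 + ((r : ℂ) * ω.2.1 + s * ω.2.2) -
      S ((ω.1.1, σ' ω.1.2 + ω.2.2, X ω.1.2), B ω.1.2) = (r : ℂ) * ω.2.1 := by
    intro ω
    simp only [S, ← hσT, ← hσT']
    ring
  have hres2 : ∀ ω : (𝒬 × ℂ × ℂ × ℂ) × ℂ × ℂ, σ ω.1.2 + ((r : ℂ) * ω.2.1 + s * ω.2.2) -
      (α * (σ' ω.1.2 + ω.2.2) + e (ω.1.1, X ω.1.2)) =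
      (σ ω.1.2 - α * σ' ω.1.2 - e (ω.1.1, X ω.1.2)) + (r * ω.2.1 + (s - α) * ω.2.2) := by
    intro ω; ring
  have hlaw : (μ.prod (stdComplexGaussian.prod stdComplexGaussian)).map
      (fun ω => (r : ℂ) * ω.2.1) =
      volume.withDensity fun z => ENNReal.ofReal (gden (1 - ‖s‖ ^ 2) z) := by
    rw [← map_sqrt_std hv, ← map_middle (a := μ) (b := stdComplexGaussian) (c := stdComplexGaussian),
      Measure.map_map (by fun_prop) (by fun_prop), map_middle]
    rfl
  refine condMutualInfo_le (S := S) (m := fun c => α * c.2.1 + e (c.1, c.2.2))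
    (by fun_prop) (by fun_prop) (by fun_prop) (by fun_prop) (by fun_prop) hv (by positivity)
    ?_ ?_ ?_ ?_ ?_
  · simp only [hres]
    exact indepFun_middle.comp (by fun_prop : Measurable fun z : ℂ => (r : ℂ) * z)
      (by fun_prop : Measurable fun p : (𝒬 × ℂ × ℂ × ℂ) × ℂ =>
        ((p.1.1, σ' p.1.2 + p.2, X p.1.2), B p.1.2))
  · simp only [hres]; exact hlaw
  · simp only [hres]
    rw [← integral_map (φ := fun ω : (𝒬 × ℂ × ℂ × ℂ) × ℂ × ℂ => (r : ℂ) * ω.2.1)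
      (f := fun z : ℂ => ‖z‖ ^ 2) (by fun_prop) (by fun_prop), hlaw, lintegral_enorm_sq_gden hv]
  · simp only [hres2]; exact i1
  · simp only [hres2]; rw [i2, hr2, noiseVar, norm_sub_rev s α]; linarith

/-- Inputs with time sharing satisfy the closed-form bounds for some correlations. -/
theorem outerRegion_subset (g : Gains) : outerRegion g ⊆ closedFormRegion g := by
  rintro R ⟨𝒬, _, _, μ, _, hμ, hR1, hR2, ⟨G1, G2, G3, G4⟩, I1, I2, I3⟩
  refine ⟨hR1, hR2, ?_⟩
  obtain ⟨p, hp, m, hm, hb⟩ := hμ.exists_formVar_bound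
  refine ⟨p, hp, ?_⟩
  have hl2 : 0 < Real.log 2 := Real.log_pos (by norm_num)
  have nn : ∀ v, 0 ≤ formVar p v := formVar_nonneg hp
  have lognn : ∀ v, 0 ≤ Real.log (formVar p v + 1) := fun v => Real.log_nonneg (by linarith [nn v])
  obtain ⟨n1, n2, n3, n4⟩ := condEntropy_noise μ g
  -- residuals of linear estimators of the two signals
  have res1 : ∀ (a b : ℂ) (x : 𝒬 × ℂ × ℂ × ℂ), g.signal1 x.2 - (a * x.2.1 + b * x.2.2.1 +
      (‖g.h11‖ - a) * m x.1) = centredForm m (g.coef1 - a • unit1 - b • unit2) x := by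
    intro a b x
    simp [Gains.signal1, centredForm, Gains.coef1, unit1, unit2]
    ring
  have res2 : ∀ (a b : ℂ) (x : 𝒬 × ℂ × ℂ × ℂ), g.signal2 x.2 - (b * x.2.1 + a * x.2.2.1 +
      (g.h21 - b) * m x.1) = centredForm m (g.coef2 - a • unit2 - b • unit1) x := by
    intro a b x
    simp [Gains.signal2, centredForm, Gains.coef2, unit1, unit2]
    ring
  have z0 : ∀ v u : ℂ × ℂ × ℂ, v - (0 : ℂ) • u = v := fun v u => by simp
  -- the mutual information terms
  have MI1 : ∀ α : ℂ, condMutualInfo (sampleLaw μ) (rvY1 g) (fun ω => (rvX1 ω, rvX0 ω))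
      (fun ω => (rvQ ω, rvX2 ω)) ≤
      ENNReal.ofReal (Real.log (formVar p (g.coef1 - α • unit2) + 1) / Real.log 2) := by
    intro α
    -- The estimator may depend on `Q`; its term in `m` turns the `X₁` left in the residual into the
    -- centred `X₁`.
    have e : (fun x : 𝒬 × ℂ × ℂ × ℂ => g.signal1 x.2 - (α * x.2.2.1 + ‖g.h11‖ * m x.1)) =
        centredForm m (g.coef1 - α • unit2) := by
      funext x
      have := res1 0 α x
      rw [z0] at this
      rw [← this]; ring
    exact condMutualInfo_Y1_le (B := fun x => (x.2.1, x.2.2.2)) (C := fun x => (x.1, x.2.2.1))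
      (S := fun p => g.signal1 (p.2.1, p.1.2, p.2.2)) (e := fun c => α * c.2 + ‖g.h11‖ * m c.1)
      (by fun_prop) (by fun_prop) (by fun_prop) (fun _ => rfl) (by fun_prop)
      (by rw [e]; exact (hb _).1) (by
        refine le_trans (le_of_eq ?_) (hb (g.coef1 - α • unit2)).2
        exact integral_congr_ae (Eventually.of_forall fun x => by
          have := congrFun e x
          simp only at this ⊢
          rw [this]))
  have MI2 : ∀ α : ℂ, condMutualInfo (sampleLaw μ) (rvY2 g) (fun ω => (rvX2 ω, rvX0 ω))
      (fun ω => (rvQ ω, rvX1 ω)) ≤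
      ENNReal.ofReal (Real.log (formVar p (g.coef2 - α • unit1) + 1) / Real.log 2) := by
    intro α
    have e : (fun x : 𝒬 × ℂ × ℂ × ℂ => g.signal2 x.2 - (α * x.2.1 + (g.h21 - α) * m x.1)) =
        centredForm m (g.coef2 - α • unit1) := by
      funext x
      have := res2 0 α x
      rw [z0] at this
      rw [← this]; ring
    exact condMutualInfo_Y2_le (B := fun x => (x.2.2.1, x.2.2.2)) (C := fun x => (x.1, x.2.1))
      (S := fun p => g.signal2 (p.1.2, p.2.1, p.2.2)) (e := fun c => α * c.2 + (g.h21 - α) * m c.1)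
      (by fun_prop) (by fun_prop) (by fun_prop) (fun _ => rfl) (by fun_prop)
      (by rw [e]; exact (hb _).1) (by
        refine le_trans (le_of_eq ?_) (hb (g.coef2 - α • unit1)).2
        exact integral_congr_ae (Eventually.of_forall fun x => by
          have := congrFun e x
          simp only at this ⊢
          rw [this]))
  have MIT1 : condMutualInfo (sampleLaw μ) (rvY1 g) (fun ω => (rvX1 ω, rvX2 ω, rvX0 ω)) rvQ ≤
      ENNReal.ofReal (Real.log (formVar p g.coef1 + 1) / Real.log 2) := by
    have e : (fun x : 𝒬 × ℂ × ℂ × ℂ => g.signal1 x.2 - ‖g.h11‖ * m x.1) =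
        centredForm m g.coef1 := by
      funext x
      have := res1 0 0 x
      rw [z0, z0] at this
      rw [← this]; ring
    exact condMutualInfo_Y1_le (B := fun x => x.2) (C := fun x => x.1)
      (S := fun p => g.signal1 p.2) (e := fun c => ‖g.h11‖ * m c)
      (by fun_prop) (by fun_prop) (by fun_prop) (fun _ => rfl) (by fun_prop)
      (by rw [e]; exact (hb _).1) (by
        refine le_trans (le_of_eq ?_) (hb g.coef1).2
        exact integral_congr_ae (Eventually.of_forall fun x => by
          have := congrFun e x
          simp only at this ⊢
          rw [this]))
  have MIT2 : condMutualInfo (sampleLaw μ) (rvY2 g) (fun ω => (rvX1 ω, rvX2 ω, rvX0 ω)) rvQ ≤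
      ENNReal.ofReal (Real.log (formVar p g.coef2 + 1) / Real.log 2) := by
    have e : (fun x : 𝒬 × ℂ × ℂ × ℂ => g.signal2 x.2 - g.h21 * m x.1) =
        centredForm m g.coef2 := by
      funext x
      have := res2 0 0 x
      rw [z0, z0] at this
      rw [← this]; ring
    exact condMutualInfo_Y2_le (B := fun x => x.2) (C := fun x => x.1)
      (S := fun p => g.signal2 p.2) (e := fun c => g.h21 * m c)
      (by fun_prop) (by fun_prop) (by fun_prop) (fun _ => rfl) (by fun_prop)
      (by rw [e]; exact (hb _).1) (by
        refine le_trans (le_of_eq ?_) (hb g.coef2).2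
        exact integral_congr_ae (Eventually.of_forall fun x => by
          have := congrFun e x
          simp only at this ⊢
          rw [this]))
  have genie_nn : ∀ (v : ℂ × ℂ × ℂ) (α : ℂ) {s : ℂ}, ‖s‖ < 1 →
      0 ≤ Real.log (formVar p v + noiseVar α s) - Real.log (1 - ‖s‖ ^ 2) := by
    intro v α s hs
    have hv := one_sub_norm_sq_pos hs
    refine sub_nonneg.mpr (Real.log_le_log hv ?_)
    have := nn v
    unfold noiseVar
    nlinarith [sq_nonneg ‖α - s‖]
  have norm_r : ∀ {s : ℂ}, ‖s‖ < 1 → Real.sqrt (1 - ‖s‖ ^ 2) ^ 2 + ‖s‖ ^ 2 = 1 := by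
    intro s hs
    rw [Real.sq_sqrt (one_sub_norm_sq_pos hs).le]; ring
  -- the entropy terms
  have H1 : ∀ α : ℂ, condEntropy (sampleLaw μ) (rvY1 g) (fun ω => (rvVt1 g ω, rvQ ω)) ≤
      (Real.log (Real.pi * (formVar p (g.coef1 - (α * g.h21) • unit1) + (1 + ‖α‖ ^ 2))) + 1) /
        Real.log 2 := by
    intro α
    refine condEntropy_Y1_le (C := fun d => (g.h21 * d.1.2.1 + d.2, d.1.1))
      (e := fun c => α * c.1 + (‖g.h11‖ - α * g.h21) * m c.2)
      (f := centredForm m (g.coef1 - (α * g.h21) • unit1)) (by fun_prop) (by fun_prop) ?_ (hb _).1 (hb _).2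
    intro x z
    have := res1 (α * g.h21) 0 x
    rw [z0] at this
    rw [← this]; ring
  have H2 : ∀ α : ℂ, condEntropy (sampleLaw μ) (rvY2 g) (fun ω => (rvVt2 g ω, rvQ ω)) ≤
      (Real.log (Real.pi * (formVar p (g.coef2 - (α * g.h12) • unit2) + (1 + ‖α‖ ^ 2))) + 1) /
        Real.log 2 := by
    intro α
    refine condEntropy_Y2_le (C := fun d => (g.h12 * d.1.2.2.1 + d.2, d.1.1))
      (e := fun c => α * c.1 + g.h21 * m c.2)
      (f := centredForm m (g.coef2 - (α * g.h12) • unit2)) (by fun_prop) (by fun_prop) ?_ (hb _).1 (hb _).2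
    intro x z
    have := res2 (α * g.h12) 0 x
    rw [z0] at this
    rw [← this]; ring
  have H1' : ∀ α β : ℂ, condEntropy (sampleLaw μ) (rvY1 g)
      (fun ω => (rvVt1 g ω, rvX2 ω, rvQ ω)) ≤ (Real.log (Real.pi *
        (formVar p (g.coef1 - (α * g.h21) • unit1 - β • unit2) + (1 + ‖α‖ ^ 2))) + 1) /
        Real.log 2 := by
    intro α β
    refine condEntropy_Y1_le (C := fun d => (g.h21 * d.1.2.1 + d.2, d.1.2.2.1, d.1.1))
      (e := fun c => α * c.1 + β * c.2.1 + (‖g.h11‖ - α * g.h21) * m c.2.2)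
      (f := centredForm m (g.coef1 - (α * g.h21) • unit1 - β • unit2)) (by fun_prop) (by fun_prop) ?_
      (hb _).1 (hb _).2
    intro x z
    rw [← res1 (α * g.h21) β x]; ring
  have H2' : ∀ α β : ℂ, condEntropy (sampleLaw μ) (rvY2 g)
      (fun ω => (rvVt2 g ω, rvX1 ω, rvQ ω)) ≤ (Real.log (Real.pi *
        (formVar p (g.coef2 - (α * g.h12) • unit2 - β • unit1) + (1 + ‖α‖ ^ 2))) + 1) /
        Real.log 2 := by
    intro α β
    refine condEntropy_Y2_le (C := fun d => (g.h12 * d.1.2.2.1 + d.2, d.1.2.1, d.1.1))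
      (e := fun c => α * c.1 + β * c.2.1 + (g.h21 - β) * m c.2.2)
      (f := centredForm m (g.coef2 - (α * g.h12) • unit2 - β • unit1)) (by fun_prop) (by fun_prop) ?_
      (hb _).1 (hb _).2
    intro x z
    rw [← res2 (α * g.h12) β x]; ring
  have HT1 : condEntropy (sampleLaw μ) (rvY1 g) rvQ ≤
      (Real.log (Real.pi * (formVar p g.coef1 + 1)) + 1) / Real.log 2 := by
    have := condEntropy_Y1_le (g := g) (μ := μ) (C := fun d => d.1.1) (e := fun c => ‖g.h11‖ * m c)
      (f := centredForm m g.coef1) (α := 0) (by fun_prop) (by fun_prop) (by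
        intro x z
        have := res1 0 0 x
        rw [z0, z0] at this
        rw [← this]; ring) (hb _).1 (hb _).2
    simp only [norm_zero, ne_eq, OfNat.ofNat_ne_zero,
      not_false_eq_true, zero_pow, add_zero] at this
    exact this
  have HT2 : condEntropy (sampleLaw μ) (rvY2 g) rvQ ≤
      (Real.log (Real.pi * (formVar p g.coef2 + 1)) + 1) / Real.log 2 := by
    have := condEntropy_Y2_le (g := g) (μ := μ) (C := fun d => d.1.1) (e := fun c => g.h21 * m c)
      (f := centredForm m g.coef2) (α := 0) (by fun_prop) (by fun_prop) (by
        intro x z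
        have := res2 0 0 x
        rw [z0, z0] at this
        rw [← this]; ring) (hb _).1 (hb _).2
    simp only [norm_zero, ne_eq, OfNat.ofNat_ne_zero,
      not_false_eq_true, zero_pow, add_zero] at this
    exact this
  have logpi : ∀ (v : ℂ × ℂ × ℂ) {c : ℝ}, 0 < c → Real.log (Real.pi * (formVar p v + c)) =
      Real.log Real.pi + Real.log (formVar p v + c) := by
    intro v c hc
    exact Real.log_mul Real.pi_ne_zero (by have := nn v; positivity)
  have fin : ∀ {x a b : ℝ}, x ≤ (a + 1) / Real.log 2 → a = b → x * Real.log 2 ≤ b + 1 := by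
    intro x a b h hab
    rw [le_div_iff₀ hl2] at h
    linarith
  have hn : (Real.log Real.pi + 1) / Real.log 2 * Real.log 2 = Real.log Real.pi + 1 :=
    div_mul_cancel₀ _ hl2.ne'
  constructor
  · intro α
    simpa using le_of_ofReal_le (lognn _) G1 (MI1 α)
  · intro α
    simpa using le_of_ofReal_le (lognn _) G2 (MI2 α)
  · intro s hs α β
    -- The bound is demanded for every coupling; it is used for the Gaussian one in which the first
    -- noise has correlation `s` with the second.
    have hN : Measurable fun z : ℂ × ℂ => (((Real.sqrt (1 - ‖s‖ ^ 2) : ℝ) : ℂ) * z.1 + s * z.2, z.2) := by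
      fun_prop
    have hk := isMarkovKernel_noiseKernel g hN
    have hc := isCoupling_noiseKernel g hN (map_std_prod_std (norm_r hs)) map_snd_snd
    have h := G3 _ hc
    have : IsProbabilityMeasure ((μ.prod (stdComplexGaussian.prod stdComplexGaussian)).map
      (fun ω => (ω.1, (g.signal1 ω.1.2 + (((Real.sqrt (1 - ‖s‖ ^ 2) : ℝ) : ℂ) * ω.2.1 + s * ω.2.2),
        g.signal2 ω.1.2 + ω.2.2)))) := Measure.isProbabilityMeasure_map (by fun_prop)
    rw [condMutualInfo_congr_measure (couplingLaw_noiseKernel g μ hN),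
      condMutualInfo_map (by fun_prop) (by fun_prop) (by fun_prop) (by fun_prop)] at h
    have e : (fun x : 𝒬 × ℂ × ℂ × ℂ => g.signal1 x.2 - α * g.signal2 x.2 - (β * x.2.2.1 +
        (‖g.h11‖ - α * g.h21) * m x.1)) =
        centredForm m (g.coef1 - α • g.coef2 - β • unit2) := by
      funext x
      simp [Gains.signal1, Gains.signal2, centredForm, Gains.coef1, Gains.coef2, unit2]
      ring
    have hb' := hb (g.coef1 - α • g.coef2 - β • unit2)
    rw [← e] at hb'
    have hJ := condMutualInfo_genie_le (μ := μ) (σ := g.signal1) (σ' := g.signal2) (X := fun x => x.2.1)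
      (B := fun x => (x.1, x.2.2)) (T := fun p => g.signal1 (p.2.1, p.1, p.2.2))
      (T' := fun p => g.signal2 (p.2.1, p.1, p.2.2)) (by fun_prop) (by fun_prop) (by fun_prop)
      (by fun_prop) (by fun_prop) (by fun_prop) (fun _ => rfl) (fun _ => rfl) hs α
      (e := fun c => β * c.2 + (‖g.h11‖ - α * g.h21) * m c.1) (by fun_prop) hb'.1 hb'.2
    simpa using le_of_ofReal_le_add (lognn _) (genie_nn _ α hs) h MIT2 hJ
  · intro s hs α β
    have hN : Measurable fun z : ℂ × ℂ => (z.2, ((Real.sqrt (1 - ‖s‖ ^ 2) : ℝ) : ℂ) * z.1 + s * z.2) := by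
      fun_prop
    have hk := isMarkovKernel_noiseKernel g hN
    have hc := isCoupling_noiseKernel g hN map_snd_snd (map_std_prod_std (norm_r hs))
    have h := G4 _ hc
    have : IsProbabilityMeasure ((μ.prod (stdComplexGaussian.prod stdComplexGaussian)).map
      (fun ω => (ω.1, (g.signal1 ω.1.2 + ω.2.2, g.signal2 ω.1.2 +
        (((Real.sqrt (1 - ‖s‖ ^ 2) : ℝ) : ℂ) * ω.2.1 + s * ω.2.2))))) :=
      Measure.isProbabilityMeasure_map (by fun_prop)
    rw [condMutualInfo_congr_measure (couplingLaw_noiseKernel g μ hN),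
      condMutualInfo_map (by fun_prop) (by fun_prop) (by fun_prop) (by fun_prop)] at h
    have e : (fun x : 𝒬 × ℂ × ℂ × ℂ => g.signal2 x.2 - α * g.signal1 x.2 - (β * x.2.1 +
        (g.h21 - α * ‖g.h11‖ - β) * m x.1)) =
        centredForm m (g.coef2 - α • g.coef1 - β • unit1) := by
      funext x
      simp [Gains.signal1, Gains.signal2, centredForm, Gains.coef1, Gains.coef2, unit1]
      ring
    have hb' := hb (g.coef2 - α • g.coef1 - β • unit1)
    rw [← e] at hb'
    have hJ := condMutualInfo_genie_le (μ := μ) (σ := g.signal2) (σ' := g.signal1) (X := fun x => x.1)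
      (B := fun x => (x.2.1, x.2.2)) (T := fun p => g.signal2 (p.1, p.2.1, p.2.2))
      (T' := fun p => g.signal1 (p.1, p.2.1, p.2.2)) (by fun_prop) (by fun_prop) (by fun_prop)
      (by fun_prop) (by fun_prop) (by fun_prop) (fun _ => rfl) (fun _ => rfl) hs α
      (e := fun c => β * c.2 + (g.h21 - α * ‖g.h11‖ - β) * m c.1) (by fun_prop) hb'.1 hb'.2
    simpa using le_of_ofReal_le_add (lognn _) (genie_nn _ α hs) h MIT1 hJ
  · intro α β
    have h1 := fin (H1 α) (logpi _ (one_add_norm_sq_pos α))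
    have h2 := fin (H2 β) (logpi _ (one_add_norm_sq_pos β))
    -- The constants `log π + 1` of the output entropies cancel those of the noise entropies; the
    -- same happens in the two weighted bounds.
    rw [n1, n2] at I1
    have := mul_le_mul_of_nonneg_right I1 hl2.le
    linarith
  · intro α β γ
    have h1 := fin HT1 (logpi _ one_pos)
    have h2 := fin (H1' α β) (logpi _ (one_add_norm_sq_pos α))
    have h3 := fin (H2 γ) (logpi _ (one_add_norm_sq_pos γ))
    rw [n1, n4] at I2
    have := mul_le_mul_of_nonneg_right I2 hl2.le
    linarith
  · intro α β γ
    have h1 := fin HT2 (logpi _ one_pos)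
    have h2 := fin (H2' α β) (logpi _ (one_add_norm_sq_pos α))
    have h3 := fin (H1 γ) (logpi _ (one_add_norm_sq_pos γ))
    rw [n2, n3] at I3
    have := mul_le_mul_of_nonneg_right I3 hl2.le
    linarith

end Outer

/-! ### Jointly Gaussian inputs -/

/-- The linear form in the inputs with the given coefficients. -/
def form (v x : ℂ × ℂ × ℂ) : ℂ := v.1 * x.1 + v.2.1 * x.2.1 + v.2.2 * x.2.2

@[fun_prop]
lemma measurable_form (v : ℂ × ℂ × ℂ) : Measurable (form v) := by
  unfold form; fun_prop

@[fun_prop]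
lemma continuous_form (v : ℂ × ℂ × ℂ) : Continuous (form v) := by
  unfold form; fun_prop

lemma Gains.signal1_eq_form (g : Gains) : g.signal1 = form g.coef1 := by
  funext x; simp only [Gains.signal1, form, Gains.coef1]; ring

lemma Gains.signal2_eq_form (g : Gains) : g.signal2 = form g.coef2 := by
  funext x; simp only [Gains.signal2, form, Gains.coef2]; ring

/-- Standard deviation of the part of the relay input that is independent of the sources. -/
def innovation (p : ℂ × ℂ) : ℝ := Real.sqrt (1 - (‖p.1‖ ^ 2 + ‖p.2‖ ^ 2))

lemma innovation_sq {p : ℂ × ℂ} (hp : p ∈ corrBall) :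
    innovation p ^ 2 = 1 - (‖p.1‖ ^ 2 + ‖p.2‖ ^ 2) :=
  Real.sq_sqrt (by simpa [corrBall] using hp)

/-- The inputs as functions of independent standard Gaussians. -/
def gaussPoint (p : ℂ × ℂ) (w : ℂ × ℂ × ℂ) : ℂ × ℂ × ℂ :=
  (w.1, w.2.1, p.1 * w.1 + p.2 * w.2.1 + innovation p * w.2.2)

@[fun_prop]
lemma measurable_gaussPoint (p : ℂ × ℂ) : Measurable (gaussPoint p) := by
  unfold gaussPoint; fun_prop

/-- The Gaussian input law with correlations `p`, for constant `Q`. -/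
def gaussLaw (p : ℂ × ℂ) : Measure (Unit × ℂ × ℂ × ℂ) :=
  (stdComplexGaussian.prod (stdComplexGaussian.prod stdComplexGaussian)).map
    (fun w => ((), gaussPoint p w))

instance (p : ℂ × ℂ) : IsProbabilityMeasure (gaussLaw p) :=
  Measure.isProbabilityMeasure_map (by fun_prop)

lemma map_stdFamily_succ {n : ℕ} {β : Type*} [MeasurableSpace β] {G : (Fin n → ℂ) → β}
    (hG : Measurable G) : (stdFamily (Fin (n + 1))).map (fun w => (w 0, G fun i => w i.succ)) =
      stdComplexGaussian.prod ((stdFamily (Fin n)).map G) := by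
  have h := (measurePreserving_piFinSuccAbove (fun _ : Fin (n + 1) => stdComplexGaussian) 0).map_eq
  have h2 : (stdFamily (Fin (n + 1))).map (fun w => (w 0, fun i => w i.succ)) =
      stdComplexGaussian.prod (stdFamily (Fin n)) := h
  have h3 := congrArg (Measure.map (Prod.map id G)) h2
  rw [Measure.map_map (by fun_prop) (by fun_prop), ← Measure.map_prod_map _ _ measurable_id hG,
    Measure.map_id] at h3
  exact h3

lemma map_stdFamily_three : (stdFamily (Fin 3)).map (fun w => (w 0, w 1, w 2)) =
    stdComplexGaussian.prod (stdComplexGaussian.prod stdComplexGaussian) := by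
  have h1 : (stdFamily (Fin 1)).map (fun w => w 0) = stdComplexGaussian :=
    (measurePreserving_eval (fun _ : Fin 1 => stdComplexGaussian) 0).map_eq
  have h2 := map_stdFamily_succ (G := fun w : Fin 1 → ℂ => w 0) (by fun_prop)
  have h3 := map_stdFamily_succ (G := fun w : Fin 2 → ℂ => (w 0, w 1)) (by fun_prop)
  rw [h1] at h2
  rw [show (fun w : Fin 2 → ℂ => (w 0, w 1)) = fun w => (w 0, w (Fin.succ 0)) from rfl, h2] at h3
  exact h3

lemma map_stdFamily_seven : (stdFamily (Fin 7)).map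
    (fun w => ((w 0, w 1, w 2), (w 3, w 4, w 5, w 6))) =
    (stdComplexGaussian.prod (stdComplexGaussian.prod stdComplexGaussian)).prod
      (stdComplexGaussian.prod (stdComplexGaussian.prod
        (stdComplexGaussian.prod stdComplexGaussian))) := by
  have h1 : (stdFamily (Fin 1)).map (fun w => w 0) = stdComplexGaussian :=
    (measurePreserving_eval (fun _ : Fin 1 => stdComplexGaussian) 0).map_eq
  have h2 := map_stdFamily_succ (G := fun w : Fin 1 → ℂ => w 0) (by fun_prop)
  have h3 := map_stdFamily_succ (G := fun w : Fin 2 → ℂ => (w 0, w 1)) (by fun_prop)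
  have h4 := map_stdFamily_succ (G := fun w : Fin 3 → ℂ => (w 0, w 1, w 2)) (by fun_prop)
  have h5 := map_stdFamily_succ (G := fun w : Fin 4 → ℂ => (w 0, w 1, w 2, w 3)) (by fun_prop)
  have h6 := map_stdFamily_succ (G := fun w : Fin 5 → ℂ => (w 0, w 1, w 2, w 3, w 4))
    (by fun_prop)
  have h7 := map_stdFamily_succ (G := fun w : Fin 6 → ℂ => (w 0, w 1, w 2, w 3, w 4, w 5))
    (by fun_prop)
  rw [h1] at h2
  rw [show (fun w : Fin 2 → ℂ => (w 0, w 1)) = fun w => (w 0, w (Fin.succ 0)) from rfl, h2] at h3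
  rw [show (fun w : Fin 3 → ℂ => (w 0, w 1, w 2)) =
    fun w => (w 0, w (Fin.succ 0), w (Fin.succ 1)) from rfl, h3] at h4
  rw [show (fun w : Fin 4 → ℂ => (w 0, w 1, w 2, w 3)) =
    fun w => (w 0, w (Fin.succ 0), w (Fin.succ 1), w (Fin.succ 2)) from rfl, h4] at h5
  rw [show (fun w : Fin 5 → ℂ => (w 0, w 1, w 2, w 3, w 4)) =
    fun w => (w 0, w (Fin.succ 0), w (Fin.succ 1), w (Fin.succ 2), w (Fin.succ 3)) from rfl,
    h5] at h6
  rw [show (fun w : Fin 6 → ℂ => (w 0, w 1, w 2, w 3, w 4, w 5)) =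
    fun w => (w 0, w (Fin.succ 0), w (Fin.succ 1), w (Fin.succ 2), w (Fin.succ 3),
      w (Fin.succ 4)) from rfl, h6] at h7
  have h8 := congrArg (Measure.map fun t : ℂ × ℂ × ℂ × ℂ × ℂ × ℂ × ℂ =>
    ((t.1, t.2.1, t.2.2.1), t.2.2.2)) h7
  rw [Measure.map_map (by fun_prop) (by fun_prop)] at h8
  refine h8.trans ?_
  refine Measure.ext_of_lintegral _ fun F hF => ?_
  rw [lintegral_map hF (by fun_prop), lintegral_prod _ (by fun_prop),
    lintegral_prod (μ := stdComplexGaussian.prod (stdComplexGaussian.prod stdComplexGaussian)) _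
      (by fun_prop), lintegral_prod _ (Measurable.lintegral_prod_right' hF).aemeasurable]
  refine lintegral_congr fun x => ?_
  rw [lintegral_prod _ (by fun_prop), lintegral_prod _ (by
    have : Measurable fun q : (ℂ × ℂ) × ℂ × ℂ × ℂ × ℂ => F ((x, q.1), q.2) := by fun_prop
    exact this.lintegral_prod_right'.aemeasurable)]
  refine lintegral_congr fun y => ?_
  rw [lintegral_prod _ (by fun_prop)]

/-- The sample point of the single-letter bounds for Gaussian inputs. -/
def gaussSample (p : ℂ × ℂ) (w : Fin 7 → ℂ) : Sample Unit :=
  (((), gaussPoint p (w 0, w 1, w 2)), (w 3, w 4, w 5, w 6))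

@[fun_prop]
lemma measurable_gaussSample (p : ℂ × ℂ) : Measurable (gaussSample p) := by
  unfold gaussSample; fun_prop

lemma sampleLaw_gaussLaw (p : ℂ × ℂ) :
    sampleLaw (gaussLaw p) = (stdFamily (Fin 7)).map (gaussSample p) := by
  have h := congrArg (Measure.map (Prod.map (fun w => (() , gaussPoint p w)) id)) map_stdFamily_seven
  rw [Measure.map_map (by fun_prop) (by fun_prop), ← Measure.map_prod_map _ _ (by fun_prop)
    measurable_id, Measure.map_id] at h
  exact h.symm

/-- Coefficients, with respect to the seven independent Gaussians, of a linear form in the inputs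
and the noises. -/
def coefVec (p : ℂ × ℂ) (v : ℂ × ℂ × ℂ) (n : ℂ × ℂ × ℂ × ℂ) : Fin 7 → ℂ :=
  ![v.1 + v.2.2 * p.1, v.2.1 + v.2.2 * p.2, v.2.2 * innovation p, n.1, n.2.1, n.2.2.1, n.2.2.2]

lemma linForm_coefVec (p : ℂ × ℂ) (v : ℂ × ℂ × ℂ) (n : ℂ × ℂ × ℂ × ℂ) (w : Fin 7 → ℂ) :
    linForm (coefVec p v n) w = form v (gaussSample p w).1.2 +
      (n.1 * w 3 + n.2.1 * w 4 + n.2.2.1 * w 5 + n.2.2.2 * w 6) := by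
  simp [linForm, coefVec, form, gaussSample, gaussPoint, Fin.sum_univ_seven]
  ring

lemma sum_norm_sq_coefVec {p : ℂ × ℂ} (hp : p ∈ corrBall) (v : ℂ × ℂ × ℂ) (n : ℂ × ℂ × ℂ × ℂ) :
    ∑ i, ‖coefVec p v n i‖ ^ 2 = formVar p v +
      (‖n.1‖ ^ 2 + ‖n.2.1‖ ^ 2 + ‖n.2.2.1‖ ^ 2 + ‖n.2.2.2‖ ^ 2) := by
  rw [formVar_eq, ← innovation_sq hp]
  simp [coefVec, Fin.sum_univ_seven, mul_pow]
  ring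

/-- Linearity of `coefVec` in inputs and noises together: the residual of a linear estimator is
again a form whose variance is read off from `formVar`. -/
lemma coefVec_sub_smul (p : ℂ × ℂ) (v v' : ℂ × ℂ × ℂ) (n n' : ℂ × ℂ × ℂ × ℂ) (α : ℂ) (i : Fin 7) :
    coefVec p v n i - α * coefVec p v' n' i = coefVec p (v - α • v') (n - α • n') i := by
  fin_cases i <;> simp [coefVec] <;> ring

lemma integral_norm_sq_linForm {ι : Type*} [Fintype ι] (c : ι → ℂ) :
    Integrable (fun w => ‖linForm c w‖ ^ 2) (stdFamily ι) ∧
      ∫ w, ‖linForm c w‖ ^ 2 ∂(stdFamily ι) = ∑ i, ‖c i‖ ^ 2 := by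
  have hs : Real.sqrt (∑ i, ‖c i‖ ^ 2) ^ 2 = ∑ i, ‖c i‖ ^ 2 :=
    Real.sq_sqrt (Finset.sum_nonneg fun i _ => by positivity)
  have h := map_linForm c hs
  obtain ⟨h1, -, h3⟩ := integral_norm_sq_mul_std ((Real.sqrt (∑ i, ‖c i‖ ^ 2) : ℝ) : ℂ)
  have hi := h1.integrable_norm_pow (p := 2) (by norm_num)
  have hm : Measurable fun z : ℂ => ((Real.sqrt (∑ i, ‖c i‖ ^ 2) : ℝ) : ℂ) * z := by fun_prop
  constructor
  · have : Integrable (fun z : ℂ => ‖z‖ ^ 2) ((stdFamily ι).map (linForm c)) := by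
      rw [h, integrable_map_measure (by fun_prop) hm.aemeasurable]
      exact hi
    exact this.comp_measurable (measurable_linForm c)
  · rw [← integral_map (f := fun z : ℂ => ‖z‖ ^ 2) (measurable_linForm c).aemeasurable (by fun_prop), h,
      integral_map hm.aemeasurable (by fun_prop), h3, Complex.norm_real, Real.norm_eq_abs, sq_abs, hs]

lemma isInputLaw_gaussLaw {p : ℂ × ℂ} (hp : p ∈ corrBall) : IsInputLaw (gaussLaw p) := by
  have power : ∀ v : ℂ × ℂ × ℂ, formVar p v = 1 →
      ∫⁻ x, ‖form v x.2‖ₑ ^ 2 ∂(gaussLaw p) ≤ 1 := by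
    intro v hv
    have hs := sum_norm_sq_coefVec hp v 0
    obtain ⟨h1, h2⟩ := integral_norm_sq_linForm (coefVec p v 0)
    have e : gaussLaw p = (stdFamily (Fin 7)).map (fun w => (gaussSample p w).1) := by
      rw [show (fun w => (gaussSample p w).1) = Prod.fst ∘ gaussSample p from rfl,
        ← Measure.map_map measurable_fst (by fun_prop), ← sampleLaw_gaussLaw, Measure.map_fst_prod,
        measure_univ, one_smul]
    rw [e, lintegral_map (by fun_prop) (by fun_prop)]
    have e2 : ∀ w, ‖form v (gaussSample p w).1.2‖ₑ ^ 2 =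
        ENNReal.ofReal (‖linForm (coefVec p v 0) w‖ ^ 2) := by
      intro w
      rw [linForm_coefVec, ENNReal.ofReal_pow (norm_nonneg _), ofReal_norm]
      simp
    simp_rw [e2]
    rw [← ofReal_integral_eq_lintegral_ofReal h1 (Eventually.of_forall fun x => by positivity), h2,
      hs, hv]
    simp
  -- The three inputs are themselves forms with `formVar` equal to one, so all power constraints are
  -- tight.
  have h1 := power unit1 (by simp [formVar, unit1])
  have h2 := power unit2 (by simp [formVar, unit2])
  have h0 := power (0, 0, 1) (by simp [formVar])
  simp only [form, unit1, unit2, one_mul, zero_mul, add_zero, zero_add] at h1 h2 h0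
  refine ⟨⟨Measure.dirac (), Kernel.const _ stdComplexGaussian, Kernel.const _ stdComplexGaussian,
    (Kernel.id ×ₖ Kernel.const _ stdComplexGaussian).map
      (fun q : (Unit × ℂ × ℂ) × ℂ => p.1 * q.1.2.1 + p.2 * q.1.2.2 + innovation p * q.2),
    inferInstance, inferInstance, inferInstance, Kernel.IsMarkovKernel.map _ (by fun_prop), ?_⟩,
    h1, h2, h0⟩
  have hK : IsMarkovKernel ((Kernel.id ×ₖ Kernel.const _ stdComplexGaussian).map
      (fun q : (Unit × ℂ × ℂ) × ℂ => p.1 * q.1.2.1 + p.2 * q.1.2.2 + innovation p * q.2)) :=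
    Kernel.IsMarkovKernel.map _ (by fun_prop)
  refine Measure.ext_of_lintegral _ fun F hF => ?_
  have hm : Measurable fun b : Unit × ℂ × ℂ => ∫⁻ z, F (b.1, b.2.1, b.2.2,
      p.1 * b.2.1 + p.2 * b.2.2 + innovation p * z) ∂stdComplexGaussian := by
    have : Measurable fun q : (Unit × ℂ × ℂ) × ℂ => F (q.1.1, q.1.2.1, q.1.2.2,
      p.1 * q.1.2.1 + p.2 * q.1.2.2 + innovation p * q.2) := by fun_prop
    exact this.lintegral_prod_right'
  rw [gaussLaw, lintegral_map hF (by fun_prop), lintegral_map hF (by fun_prop),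
    Measure.lintegral_compProd (by fun_prop)]
  have e : ∀ b : Unit × ℂ × ℂ, ∫⁻ z, F (b.1, b.2.1, b.2.2, z)
      ∂((Kernel.id ×ₖ Kernel.const _ stdComplexGaussian).map
      (fun q : (Unit × ℂ × ℂ) × ℂ => p.1 * q.1.2.1 + p.2 * q.1.2.2 + innovation p * q.2) b) =
      ∫⁻ z, F (b.1, b.2.1, b.2.2, p.1 * b.2.1 + p.2 * b.2.2 + innovation p * z)
        ∂stdComplexGaussian := by
    intro b
    rw [Kernel.lintegral_map _ (by fun_prop) _ (by fun_prop), Kernel.lintegral_id_prod (by fun_prop),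
      Kernel.const_apply]
  simp_rw [e]
  rw [Measure.lintegral_compProd hm, lintegral_dirac, Kernel.prod_apply, Kernel.const_apply,
    lintegral_prod _ (by fun_prop), lintegral_prod _ (by fun_prop)]
  refine lintegral_congr fun x => ?_
  rw [lintegral_prod _ (by fun_prop)]
  rfl

lemma isProperGaussian_gaussLaw (p : ℂ × ℂ) : IsProperGaussian ((gaussLaw p).map Prod.snd) := by
  refine ⟨!![1, 0, 0; 0, 1, 0; p.1, p.2, innovation p], ?_⟩
  rw [gaussLaw, Measure.map_map (by fun_prop) (by fun_prop), ← map_stdFamily_three,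
    Measure.map_map (by fun_prop) (by fun_prop)]
  congr 1
  funext w
  simp [gaussPoint, Matrix.mulVec, dotProduct, Fin.sum_univ_three]

/-! ### Entropy and mutual information of linear forms in independent Gaussians -/

section Exact

variable {ι : Type*} [Fintype ι] {γ : Type*} [MeasurableSpace γ]

/-- Conditional entropy of a linear form in Gaussians given two others: for some estimator it is the
entropy of the estimation error. -/
lemma exists_condEntropy_linForm_eq {y c₁ c₂ : ι → ℂ} {C : (ι → ℂ) → γ} {E : ℂ × ℂ → γ}
    {D : γ → ℂ × ℂ} (hE : Measurable E) (hD : Measurable D)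
    (hCE : ∀ w, C w = E (linForm c₁ w, linForm c₂ w))
    (hCD : ∀ w, D (C w) = (linForm c₁ w, linForm c₂ w)) {f : ℂ → ℂ → ℝ}
    (hf : ∀ α β, ∑ i, ‖y i - α * c₁ i - β * c₂ i‖ ^ 2 = f α β) (hpos : ∀ α β, 0 < f α β) :
    ∃ α β, condEntropy (stdFamily ι) (linForm y) C =
      (Real.log (Real.pi * f α β) + 1) / Real.log 2 := by
  -- For jointly proper Gaussians the orthogonal residual is independent of both forms, hence of
  -- `C`. The maps `E` and `D` say that `C` and the pair of forms determine each other.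
  obtain ⟨α, β, h1, h2⟩ := exists_orthogonal_residual y c₁ c₂
  refine ⟨α, β, ?_⟩
  have hC : Measurable C := by
    rw [show C = fun w => E (linForm c₁ w, linForm c₂ w) from funext hCE]
    exact hE.comp ((measurable_linForm c₁).prodMk (measurable_linForm c₂))
  have hres : ∀ w, linForm y w - (α * (D (C w)).1 + β * (D (C w)).2) =
      linForm (fun i => y i - α * c₁ i - β * c₂ i) w := by
    intro w
    rw [hCD]
    simp only [linForm, sub_mul, Finset.sum_sub_distrib, Finset.mul_sum, mul_assoc]
    ring
  refine condEntropy_eq (measurable_linForm y) hC (m := fun c => α * (D c).1 + β * (D c).2)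
    (by fun_prop) (hpos α β) ?_ ?_
  · simp only [hres]
    rw [show C = fun w => E (linForm c₁ w, linForm c₂ w) from funext hCE]
    exact (indepFun_linForm h1 h2).comp measurable_id hE
  · simp only [hres]
    rw [← map_sqrt_std (hpos α β)]
    exact map_linForm _ (by rw [Real.sq_sqrt (hpos α β).le, hf])

/-- Mutual information of Gaussian inputs and outputs: it is at least that of the estimation error
for some linear estimator. -/
lemma exists_le_condMutualInfo_linForm {β : Type*} [MeasurableSpace β] [StandardBorelSpace β]
    [Nonempty β] {y s c : ι → ℂ} {B : (ι → ℂ) → β} {C : (ι → ℂ) → γ} {E : ℂ → γ}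
    {D : γ → ℂ} (hE : Measurable E) (hD : Measurable D) (hB : Measurable B)
    (hCE : ∀ w, C w = E (linForm c w)) (hCD : ∀ w, D (C w) = linForm c w)
    {S : γ × β → ℂ} (hS : Measurable S) (hSw : ∀ w, S (C w, B w) = linForm s w) {f : ℂ → ℝ}
    (hf : ∀ α, ∑ i, ‖s i - α * c i‖ ^ 2 = f α) (hfy : ∀ α, ∑ i, ‖y i - α * c i‖ ^ 2 = f α + 1)
    (hys : ∑ i, ‖y i - s i‖ ^ 2 = 1) :
    ∃ α, ENNReal.ofReal (Real.log (f α + 1) / Real.log 2) ≤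
      condMutualInfo (stdFamily ι) (linForm y) B C := by
  -- Regression on a single form is regression on two, one of which is zero.
  obtain ⟨α, _, h1, _⟩ := exists_orthogonal_residual s c 0
  simp only [Pi.zero_apply, mul_zero, sub_zero] at h1
  refine ⟨α, ?_⟩
  have hf0 : 0 ≤ f α := by rw [← hf]; positivity
  have hC : Measurable C := by
    rw [show C = fun w => E (linForm c w) from funext hCE]
    exact hE.comp (measurable_linForm c)
  have hsub : ∀ a b : ι → ℂ, ∀ w, linForm a w - linForm b w = linForm (fun i => a i - b i) w := by
    intro a b w; simp only [linForm, sub_mul, Finset.sum_sub_distrib]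
  have r1 : ∀ w, S (C w, B w) - α * D (C w) = linForm (fun i => s i - α * c i) w := by
    intro w; rw [hSw, hCD, linForm_mul, hsub]
  have r2 : ∀ w, linForm y w - S (C w, B w) = linForm (fun i => y i - s i) w := by
    intro w; rw [hSw, hsub]
  have r3 : ∀ w, linForm y w - α * D (C w) = linForm (fun i => y i - α * c i) w := by
    intro w; rw [hCD, linForm_mul, hsub]
  have h := le_condMutualInfo (P := stdFamily ι) (measurable_linForm y) hB hC hS
    (m := fun c => α * D c) (by fun_prop) (v := 1) (d := Real.sqrt (f α)) (w := f α + 1) one_pos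
    (by rw [Real.sq_sqrt hf0]; ring) ?_ ?_ ?_ ?_
  -- The second moments equal the variances `f α + 1` and `1` used in the test function, so both
  -- quotients are one and cancel.
  · refine le_trans (le_of_eq ?_) h
    simp only [r2, r3]
    rw [(integral_norm_sq_linForm _).2, (integral_norm_sq_linForm _).2, hfy, hys,
      div_self (by positivity : f α + 1 ≠ 0)]
    simp
  · simp only [r1]
    rw [show C = fun w => E (linForm c w) from funext hCE]
    exact (indepFun_linForm (c₂ := 0) h1 (by simp)).comp measurable_id
      (hE.comp measurable_fst)
  · simp only [r1]
    exact map_linForm _ (by rw [Real.sq_sqrt hf0, hf])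
  · simp only [r2]; exact (integral_norm_sq_linForm _).1
  · simp only [r3]; exact (integral_norm_sq_linForm _).1

end Exact

/-! ### Evaluation of the single-letter terms at Gaussian inputs -/

section Gauss

variable {p : ℂ × ℂ}

lemma condEntropy_congr_measure {Ω γ : Type*} [MeasurableSpace Ω] [MeasurableSpace γ]
    {P P' : Measure Ω} [IsFiniteMeasure P] [IsFiniteMeasure P'] (h : P = P') (A : Ω → ℂ)
    (C : Ω → γ) : condEntropy P A C = condEntropy P' A C := by
  subst h; rfl

lemma condEntropy_gauss {γ : Type*} [MeasurableSpace γ] {A : Sample Unit → ℂ}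
    {C : Sample Unit → γ} (hA : Measurable A) (hC : Measurable C) :
    condEntropy (sampleLaw (gaussLaw p)) A C =
      condEntropy (stdFamily (Fin 7)) (fun w => A (gaussSample p w))
        (fun w => C (gaussSample p w)) := by
  rw [condEntropy_congr_measure (sampleLaw_gaussLaw p), condEntropy_map (by fun_prop) hA hC]

lemma condMutualInfo_gauss {β γ : Type*} [MeasurableSpace β] [StandardBorelSpace β] [Nonempty β]
    [MeasurableSpace γ] {A : Sample Unit → ℂ} {B : Sample Unit → β}
    {C : Sample Unit → γ} (hA : Measurable A) (hB : Measurable B) (hC : Measurable C) :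
    condMutualInfo (sampleLaw (gaussLaw p)) A B C =
      condMutualInfo (stdFamily (Fin 7)) (fun w => A (gaussSample p w))
        (fun w => B (gaussSample p w)) (fun w => C (gaussSample p w)) := by
  rw [condMutualInfo_congr_measure (sampleLaw_gaussLaw p), condMutualInfo_map (by fun_prop) hA hB hC]

/-- Conditional entropies for Gaussian inputs. -/
lemma exists_condEntropy_gauss_eq (hp : p ∈ corrBall) {γ : Type*} [MeasurableSpace γ]
    {A : Sample Unit → ℂ} {C : Sample Unit → γ} (hA : Measurable A) (hC : Measurable C)
    (v v₁ v₂ : ℂ × ℂ × ℂ) (n n₁ n₂ : ℂ × ℂ × ℂ × ℂ) {E : ℂ × ℂ → γ} {D : γ → ℂ × ℂ}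
    (hE : Measurable E) (hD : Measurable D)
    (hAw : ∀ w, A (gaussSample p w) = linForm (coefVec p v n) w)
    (hCE : ∀ w, C (gaussSample p w) = E (linForm (coefVec p v₁ n₁) w, linForm (coefVec p v₂ n₂) w))
    (hCD : ∀ w, D (C (gaussSample p w)) =
      (linForm (coefVec p v₁ n₁) w, linForm (coefVec p v₂ n₂) w)) {c : ℂ → ℂ → ℝ}
    (hc : ∀ α β, ‖(n - α • n₁ - β • n₂).1‖ ^ 2 + ‖(n - α • n₁ - β • n₂).2.1‖ ^ 2 +
      ‖(n - α • n₁ - β • n₂).2.2.1‖ ^ 2 + ‖(n - α • n₁ - β • n₂).2.2.2‖ ^ 2 = c α β)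
    (hc0 : ∀ α β, 0 < c α β) :
    ∃ α β, condEntropy (sampleLaw (gaussLaw p)) A C * Real.log 2 =
      Real.log Real.pi + Real.log (formVar p (v - α • v₁ - β • v₂) + c α β) + 1 := by
  have hl2 : 0 < Real.log 2 := Real.log_pos (by norm_num)
  have hpos : ∀ α β, 0 < formVar p (v - α • v₁ - β • v₂) + c α β := fun α β =>
    add_pos_of_nonneg_of_pos (formVar_nonneg hp _) (hc0 α β)
  obtain ⟨α, β, h⟩ := exists_condEntropy_linForm_eq (y := coefVec p v n) (c₁ := coefVec p v₁ n₁)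
    (c₂ := coefVec p v₂ n₂) (C := fun w => C (gaussSample p w)) hE hD hCE hCD
    (f := fun α β => formVar p (v - α • v₁ - β • v₂) + c α β) (by
      intro α β
      simp_rw [coefVec_sub_smul]
      rw [sum_norm_sq_coefVec hp, hc]) hpos
  refine ⟨α, β, ?_⟩
  rw [condEntropy_gauss hA hC, show (fun w => A (gaussSample p w)) = linForm (coefVec p v n) from
    funext hAw, h, div_mul_cancel₀ _ hl2.ne', Real.log_mul Real.pi_ne_zero (hpos α β).ne']

/-- Conditional mutual informations for Gaussian inputs. -/
lemma exists_le_condMutualInfo_gauss (hp : p ∈ corrBall) {β γ : Type*} [MeasurableSpace β]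
    [StandardBorelSpace β] [Nonempty β] [MeasurableSpace γ]
    {A : Sample Unit → ℂ} {B : Sample Unit → β} {C : Sample Unit → γ} (hA : Measurable A)
    (hB : Measurable B) (hC : Measurable C) (v v₁ : ℂ × ℂ × ℂ) (n : ℂ × ℂ × ℂ × ℂ)
    (hn : ‖n.1‖ ^ 2 + ‖n.2.1‖ ^ 2 + ‖n.2.2.1‖ ^ 2 + ‖n.2.2.2‖ ^ 2 = 1)
    {E : ℂ → γ} {D : γ → ℂ} (hE : Measurable E) (hD : Measurable D)
    (hAw : ∀ w, A (gaussSample p w) = linForm (coefVec p v n) w)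
    (hCE : ∀ w, C (gaussSample p w) = E (linForm (coefVec p v₁ 0) w))
    (hCD : ∀ w, D (C (gaussSample p w)) = linForm (coefVec p v₁ 0) w)
    {S : γ × β → ℂ} (hS : Measurable S)
    (hSw : ∀ w, S (C (gaussSample p w), B (gaussSample p w)) = linForm (coefVec p v 0) w) :
    ∃ α : ℂ, ENNReal.ofReal (Real.log (formVar p (v - α • v₁) + 1) / Real.log 2) ≤
      condMutualInfo (sampleLaw (gaussLaw p)) A B C := by
  rw [condMutualInfo_gauss hA hB hC, show (fun w => A (gaussSample p w)) = linForm (coefVec p v n)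
    from funext hAw]
  refine exists_le_condMutualInfo_linForm (s := coefVec p v 0) (c := coefVec p v₁ 0)
    (f := fun α : ℂ => formVar p (v - α • v₁)) hE hD (hB.comp (by fun_prop)) hCE hCD hS hSw ?_ ?_ ?_
  · intro α
    simp_rw [coefVec_sub_smul]
    rw [sum_norm_sq_coefVec hp]
    simp
  · intro α
    simp_rw [coefVec_sub_smul]
    rw [sum_norm_sq_coefVec hp]
    simp [hn]
  · have e : ∀ i, coefVec p v n i - coefVec p v 0 i = coefVec p 0 n i := by
      intro i
      have := coefVec_sub_smul p v v n 0 1 i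
      simpa using this
    simp_rw [e]
    rw [sum_norm_sq_coefVec hp, hn]
    simp [formVar]

end Gauss

/-! ### Genie bounds for arbitrary couplings of the two outputs -/

section Coupling

variable {Ω : Type*} [MeasurableSpace Ω] {P : Measure Ω}

/-- Transports independence of explicit Gaussian forms to the sample space of an arbitrary coupling,
where the inputs and one of the two noises have the same joint law. -/
lemma indepFun_of_map_eq [IsProbabilityMeasure P] {Ω' β γ δ : Type*} [MeasurableSpace Ω'] [MeasurableSpace β]
    [MeasurableSpace γ] [MeasurableSpace δ] {Q : Measure Ω'} [IsProbabilityMeasure Q] {W : Ω → β}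
    {W' : Ω' → β} (hW : Measurable W) (hW' : Measurable W') (h : P.map W = Q.map W') {F : β → γ}
    {G : β → δ} (hF : Measurable F) (hG : Measurable G)
    (hi : IndepFun (fun ω => F (W' ω)) (fun ω => G (W' ω)) Q) :
    IndepFun (fun ω => F (W ω)) (fun ω => G (W ω)) P := by
  have keyF := congrArg (Measure.map F) h
  have keyG := congrArg (Measure.map G) h
  have keyFG := congrArg (Measure.map fun b => (F b, G b)) h
  rw [Measure.map_map (by fun_prop) hW, Measure.map_map (by fun_prop) hW'] at keyF keyG keyFG
  rw [indepFun_iff_map_prod_eq_prod_map_map (by fun_prop) (by fun_prop)] at hi ⊢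
  exact keyFG.trans (hi.trans (congrArg₂ _ keyF.symm keyG.symm))

/-- Second moment of `U + Z₁ - α Z₂` when `U` is uncorrelated with the noises. -/
lemma integral_norm_sq_add_sub {U Z₁ Z₂ : Ω → ℂ} (hU : MemLp U 2 P) (h₁ : MemLp Z₁ 2 P)
    (h₂ : MemLp Z₂ 2 P) (c₁ : ∫ ω, U ω * (starRingEnd ℂ) (Z₁ ω) ∂P = 0)
    (c₂ : ∫ ω, U ω * (starRingEnd ℂ) (Z₂ ω) ∂P = 0) (n₁ : ∫ ω, ‖Z₁ ω‖ ^ 2 ∂P = 1)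
    (n₂ : ∫ ω, ‖Z₂ ω‖ ^ 2 ∂P = 1) (α : ℂ) :
    Integrable (fun ω => ‖U ω + Z₁ ω - α * Z₂ ω‖ ^ 2) P ∧
    ∫ ω, ‖U ω + Z₁ ω - α * Z₂ ω‖ ^ 2 ∂P = ∫ ω, ‖U ω‖ ^ 2 ∂P + 1 + ‖α‖ ^ 2 -
      2 * ((starRingEnd ℂ) α * ∫ ω, Z₁ ω * (starRingEnd ℂ) (Z₂ ω) ∂P).re := by
  have conj : ∀ {U : Ω → ℂ}, MemLp U 2 P → MemLp (fun ω => (starRingEnd ℂ) (U ω)) 2 P := fun h =>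
    h.star
  have hS : MemLp (fun ω => U ω + Z₁ ω - α * Z₂ ω) 2 P := (hU.add h₁).sub (h₂.const_mul α)
  refine ⟨hS.integrable_norm_pow (p := 2) (by norm_num), ?_⟩
  have iU1 : Integrable (fun ω => U ω * (starRingEnd ℂ) (Z₁ ω)) P := hU.integrable_mul (conj h₁)
  have iU2 : Integrable (fun ω => U ω * (starRingEnd ℂ) (Z₂ ω)) P := hU.integrable_mul (conj h₂)
  have i12 : Integrable (fun ω => Z₁ ω * (starRingEnd ℂ) (Z₂ ω)) P := h₁.integrable_mul (conj h₂)
  have nU := hU.integrable_norm_pow (p := 2) (by norm_num)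
  have nZ₁ := h₁.integrable_norm_pow (p := 2) (by norm_num)
  have nZ₂ := h₂.integrable_norm_pow (p := 2) (by norm_num)
  have e : ∀ ω, ‖U ω + Z₁ ω - α * Z₂ ω‖ ^ 2 = ‖U ω‖ ^ 2 + ‖Z₁ ω‖ ^ 2 + ‖α‖ ^ 2 * ‖Z₂ ω‖ ^ 2 +
      2 * (U ω * (starRingEnd ℂ) (Z₁ ω) - (starRingEnd ℂ) α * (U ω * (starRingEnd ℂ) (Z₂ ω)) -
        (starRingEnd ℂ) α * (Z₁ ω * (starRingEnd ℂ) (Z₂ ω))).re := by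
    intro ω
    simp only [← Complex.normSq_eq_norm_sq, Complex.normSq_sub, Complex.normSq_add,
      Complex.normSq_mul]
    simp only [map_mul, Complex.add_re, Complex.sub_re, Complex.mul_re, Complex.mul_im,
      Complex.conj_re, Complex.conj_im, Complex.add_im]
    ring
  have iA : Integrable (fun ω => U ω * (starRingEnd ℂ) (Z₁ ω) -
      (starRingEnd ℂ) α * (U ω * (starRingEnd ℂ) (Z₂ ω))) P := iU1.sub (iU2.const_mul _)
  have iC : Integrable (fun ω => U ω * (starRingEnd ℂ) (Z₁ ω) -
      (starRingEnd ℂ) α * (U ω * (starRingEnd ℂ) (Z₂ ω)) -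
        (starRingEnd ℂ) α * (Z₁ ω * (starRingEnd ℂ) (Z₂ ω))) P := iA.sub (i12.const_mul _)
  have icr : Integrable (fun ω => (U ω * (starRingEnd ℂ) (Z₁ ω) -
      (starRingEnd ℂ) α * (U ω * (starRingEnd ℂ) (Z₂ ω)) -
        (starRingEnd ℂ) α * (Z₁ ω * (starRingEnd ℂ) (Z₂ ω))).re) P := iC.re
  have hre := integral_re iC
  simp only [RCLike.re_to_complex] at hre
  have nN1 : Integrable (fun ω => ‖U ω‖ ^ 2 + ‖Z₁ ω‖ ^ 2) P := nU.add nZ₁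
  have nN : Integrable (fun ω => ‖U ω‖ ^ 2 + ‖Z₁ ω‖ ^ 2 + ‖α‖ ^ 2 * ‖Z₂ ω‖ ^ 2) P :=
    nN1.add (nZ₂.const_mul _)
  simp_rw [e]
  rw [integral_add nN (icr.const_mul 2), integral_add nN1 (nZ₂.const_mul _), integral_add nU nZ₁,
    integral_const_mul, integral_const_mul, hre, integral_sub iA (i12.const_mul _),
    integral_sub iU1 (iU2.const_mul _), integral_const_mul, integral_const_mul, c₁, c₂, n₁, n₂]
  simp
  ring

variable {p : ℂ × ℂ} {X : Ω → ℂ × ℂ × ℂ} {Y : Ω → ℂ}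

/-- In any admissible coupling each output's noise, taken alone, is standard and independent of the
inputs. Hence the single coordinate `w 3` can model the noise of either output. -/
lemma map_inputs_noise (p : ℂ × ℂ) : ((gaussLaw p).map Prod.snd).prod stdComplexGaussian =
    (stdFamily (Fin 7)).map (fun w => ((gaussSample p w).1.2, w 3)) := by
  have h : (sampleLaw (gaussLaw p)).map (Prod.map Prod.snd Prod.fst) =
      ((gaussLaw p).map Prod.snd).prod stdComplexGaussian := by
    rw [← Measure.map_prod_map _ _ (by fun_prop) (by fun_prop), Measure.map_fst_prod, measure_univ,
      one_smul]
  rw [← h, sampleLaw_gaussLaw, Measure.map_map (by fun_prop) (by fun_prop)]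
  rfl

/-- Moments of the inputs and of the noise of one output. -/
lemma moments_of_law (hp : p ∈ corrBall) (hX : Measurable X) (hY : Measurable Y)
    (v : ℂ × ℂ × ℂ) (h : P.map (fun ω => (X ω, Y ω - form v (X ω))) =
      ((gaussLaw p).map Prod.snd).prod stdComplexGaussian) :
    MemLp (fun ω => Y ω - form v (X ω)) 2 P ∧ ∫ ω, ‖Y ω - form v (X ω)‖ ^ 2 ∂P = 1 ∧
    ∀ u, MemLp (fun ω => form u (X ω)) 2 P ∧ ∫ ω, ‖form u (X ω)‖ ^ 2 ∂P = formVar p u ∧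
      ∫ ω, form u (X ω) * (starRingEnd ℂ) (Y ω - form v (X ω)) ∂P = 0 := by
  have hW : Measurable fun ω => (X ω, Y ω - form v (X ω)) := by fun_prop
  have hν : IsProbabilityMeasure ((gaussLaw p).map Prod.snd) :=
    Measure.isProbabilityMeasure_map (by fun_prop)
  have hZ : P.map (fun ω => Y ω - form v (X ω)) = stdComplexGaussian := by
    have := congrArg (Measure.map Prod.snd) h
    rwa [Measure.map_map (by fun_prop) hW, Measure.map_snd_prod, measure_univ, one_smul] at this
  have hXl : P.map X = (gaussLaw p).map Prod.snd := by
    have := congrArg (Measure.map Prod.fst) h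
    rwa [Measure.map_map (by fun_prop) hW, Measure.map_fst_prod, measure_univ, one_smul] at this
  have hXw : P.map X = (stdFamily (Fin 7)).map (fun w => (gaussSample p w).1.2) := by
    have := congrArg (Measure.map Prod.fst) (map_inputs_noise p)
    rw [Measure.map_map (by fun_prop) (by fun_prop), Measure.map_fst_prod, measure_univ,
      one_smul] at this
    rw [hXl, this]
    rfl
  refine ⟨?_, ?_, fun u => ⟨?_, ?_, ?_⟩⟩
  · have := memLp_id_std
    rw [← hZ, memLp_map_measure_iff (by fun_prop) (by fun_prop)] at this
    exact this
  · rw [← integral_map (f := fun z : ℂ => ‖z‖ ^ 2) (by fun_prop) (by fun_prop), hZ,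
      integral_norm_sq_std]
  · have h1 : MemLp (form u) 2 (P.map X) := by
      rw [hXw, memLp_map_measure_iff (by fun_prop) (by fun_prop),
        memLp_two_iff_integrable_sq_norm
          ((measurable_form u).comp (by fun_prop)).aestronglyMeasurable]
      have := (integral_norm_sq_linForm (coefVec p u 0)).1
      simp_rw [linForm_coefVec] at this
      simpa using this
    exact h1.comp_of_map hX.aemeasurable
  · rw [← integral_map (f := fun x => ‖form u x‖ ^ 2) (by fun_prop) (by fun_prop), hXw,
      integral_map (by fun_prop) (by fun_prop)]
    have := (integral_norm_sq_linForm (coefVec p u 0)).2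
    simp_rw [linForm_coefVec, sum_norm_sq_coefVec hp] at this
    simpa using this
  · rw [← integral_map (φ := fun ω => (X ω, Y ω - form v (X ω)))
      (f := fun q : (ℂ × ℂ × ℂ) × ℂ => form u q.1 * (starRingEnd ℂ) q.2) (by fun_prop)
      (by fun_prop), h, integral_prod_mul (fun x => form u x) (fun z => (starRingEnd ℂ) z),
      integral_conj, integral_id_std]
    simp

lemma norm_sub_sq (α s : ℂ) : ‖α - s‖ ^ 2 =
    ‖α‖ ^ 2 + ‖s‖ ^ 2 - 2 * ((starRingEnd ℂ) α * s).re := by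
  simp only [← Complex.normSq_eq_norm_sq, Complex.normSq_sub, Complex.mul_re, Complex.conj_re,
    Complex.conj_im]
  ring

/-- A sum rate that satisfies the genie-aided bounds for all Gaussian genies satisfies them for
every genie with the right marginal law. -/
lemma le_add_condMutualInfo_genie [IsProbabilityMeasure P] (hp : p ∈ corrBall) {Y' : Ω → ℂ} (hX : Measurable X)
    (hY : Measurable Y) (hY' : Measurable Y') {v v' u : ℂ × ℂ × ℂ}
    (h : P.map (fun ω => (X ω, Y ω - form v (X ω))) =
      ((gaussLaw p).map Prod.snd).prod stdComplexGaussian)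
    (h' : P.map (fun ω => (X ω, Y' ω - form v' (X ω))) =
      ((gaussLaw p).map Prod.snd).prod stdComplexGaussian)
    {B : Ω → ℂ × ℂ} (hB : Measurable B) {q : Ω → Unit} {C : Ω → Unit × ℂ × ℂ}
    (hC : ∀ ω, C ω = (q ω, Y' ω, form u (X ω)))
    {T T' : ℂ × ℂ × ℂ → ℂ} (hT : Measurable T) (hT' : Measurable T')
    (hvT : ∀ ω, form v (X ω) = T (form u (X ω), B ω))
    (hvT' : ∀ ω, form v' (X ω) = T' (form u (X ω), B ω)) {x a : ℝ}
    (hx : ∀ s : ℂ, ‖s‖ < 1 → ∀ α β : ℂ, x * Real.log 2 ≤ a +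
      (Real.log (formVar p (v - α • v' - β • u) + noiseVar α s) - Real.log (1 - ‖s‖ ^ 2)))
    {I : ℝ≥0∞} (hI : ENNReal.ofReal (a / Real.log 2) ≤ I) :
    ENNReal.ofReal x ≤ I + condMutualInfo P Y B C := by
  have hl2 : 0 < Real.log 2 := Real.log_pos (by norm_num)
  have hq : ∀ ω, q ω = () := fun _ => rfl
  have hC' : C = fun ω => ((), Y' ω, form u (X ω)) := funext fun ω => by rw [hC, hq]
  have hCm : Measurable C := by rw [hC']; fun_prop
  obtain ⟨m1, n1, k1⟩ := moments_of_law hp hX hY v h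
  obtain ⟨m2, n2, k2⟩ := moments_of_law hp hX hY' v' h'
  -- This correlation is the only feature of the coupling that the second moments below can see.
  set ρ := ∫ ω, (Y ω - form v (X ω)) * (starRingEnd ℂ) (Y' ω - form v' (X ω)) ∂P with hρ
  have mom := fun u α => integral_norm_sq_add_sub (k1 u).1 m1 m2 (k1 u).2.2 (k2 u).2.2 n1 n2 α
  simp only [(k1 _).2.1, ← hρ] at mom
  have mom0 : ∀ α : ℂ, Integrable (fun ω => ‖(Y ω - form v (X ω)) -
      α * (Y' ω - form v' (X ω))‖ ^ 2) P ∧ ∫ ω, ‖(Y ω - form v (X ω)) -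
      α * (Y' ω - form v' (X ω))‖ ^ 2 ∂P = 1 + ‖α‖ ^ 2 - 2 * ((starRingEnd ℂ) α * ρ).re := by
    intro α
    have := mom 0 α
    simpa [form, formVar] using this
  have hself : ((starRingEnd ℂ) ρ * ρ).re = ‖ρ‖ ^ 2 := by
    rw [mul_comm, Complex.mul_conj, Complex.normSq_eq_norm_sq, Complex.ofReal_re]
  -- The second moment of `Z₁ - ρ Z₂` is `1 - ‖ρ‖²`.
  have hρ1 : ‖ρ‖ ≤ 1 := by
    have h0 := (integral_nonneg (μ := P) fun ω => by positivity).trans_eq (mom0 ρ).2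
    rw [hself] at h0
    nlinarith [norm_nonneg ρ]
  have key : ∀ s : ℂ, ‖s‖ < 1 → ∃ α β : ℂ, ENNReal.ofReal ((Real.log
      ((formVar p (v - α • v' - β • u) + noiseVar α s) / (1 - ‖s‖ ^ 2)) +
      (formVar p (v - α • v' - β • u) + 1 + ‖α‖ ^ 2 - 2 * ((starRingEnd ℂ) α * ρ).re) /
        (formVar p (v - α • v' - β • u) + noiseVar α s) -
      (1 + ‖s‖ ^ 2 - 2 * ((starRingEnd ℂ) s * ρ).re) / (1 - ‖s‖ ^ 2)) / Real.log 2) ≤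
        condMutualInfo P Y B C := by
    intro s hs
    -- The quantity estimated is `form v X + s Z₂`, from `Y' = form v' X + Z₂` and `form u X`. It
    -- involves the inputs and the second noise only, whose joint law is the Gaussian one for every
    -- coupling; so the residual is Gaussian and independent of `C`, as `le_condMutualInfo`
    -- requires.
    obtain ⟨α, β, o1, o2⟩ := exists_orthogonal_residual (coefVec p v (s, 0, 0, 0))
      (coefVec p v' (1, 0, 0, 0)) (coefVec p u 0)
    refine ⟨α, β, ?_⟩
    have hfv := formVar_nonneg hp (v - α • v' - β • u)
    have hform : ∀ x, form (v - α • v' - β • u) x = form v x - α * form v' x - β * form u x := by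
      intro x; simp [form]; ring
    have rSm : ∀ ω, (T ((C ω).2.2, B ω) + s * ((C ω).2.1 - T' ((C ω).2.2, B ω))) -
        (α * (C ω).2.1 + β * (C ω).2.2) = form (v - α • v' - β • u) (X ω) +
          (s - α) * (Y' ω - form v' (X ω)) := by
      intro ω
      rw [hC']
      simp only [← hvT, ← hvT', hform]
      ring
    have rAS : ∀ ω, Y ω - (T ((C ω).2.2, B ω) + s * ((C ω).2.1 - T' ((C ω).2.2, B ω))) =
        (Y ω - form v (X ω)) - s * (Y' ω - form v' (X ω)) := by
      intro ω
      rw [hC']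
      simp only [← hvT, ← hvT']
      ring
    have rAm : ∀ ω, Y ω - (α * (C ω).2.1 + β * (C ω).2.2) = form (v - α • v' - β • u) (X ω) +
        (Y ω - form v (X ω)) - α * (Y' ω - form v' (X ω)) := by
      intro ω
      rw [hC']
      simp only [hform]
      ring
    have hWm : Measurable fun ω => (X ω, Y' ω - form v' (X ω)) := by fun_prop
    have hlin : ∀ w, form (v - α • v' - β • u) (gaussSample p w).1.2 + (s - α) * w 3 =
        linForm (coefVec p (v - α • v' - β • u) (s - α, 0, 0, 0)) w := by
      intro w; rw [linForm_coefVec]; simp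
    have hcoef : ∀ i, coefVec p v (s, 0, 0, 0) i - α * coefVec p v' (1, 0, 0, 0) i -
        β * coefVec p u 0 i = coefVec p (v - α • v' - β • u) (s - α, 0, 0, 0) i := by
      intro i
      rw [coefVec_sub_smul, coefVec_sub_smul]
      simp
      rfl
    simp_rw [hcoef] at o1 o2
    have hmap := h'.trans (map_inputs_noise p)
    have hsum := sum_norm_sq_coefVec hp (v - α • v' - β • u) (s - α, 0, 0, 0)
    have hd : 0 ≤ formVar p (v - α • v' - β • u) + ‖α - s‖ ^ 2 := by positivity
    have hle := le_condMutualInfo (P := P) hY hB hCm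
      (S := fun c => T (c.1.2.2, c.2) + s * (c.1.2.1 - T' (c.1.2.2, c.2))) (by fun_prop)
      (m := fun c => α * c.2.1 + β * c.2.2) (by fun_prop) (v := 1 - ‖s‖ ^ 2)
      (d := Real.sqrt (formVar p (v - α • v' - β • u) + ‖α - s‖ ^ 2))
      (w := formVar p (v - α • v' - β • u) + noiseVar α s) (one_sub_norm_sq_pos hs)
      (by rw [Real.sq_sqrt hd]; unfold noiseVar; ring) ?_ ?_ ?_ ?_
    · simp only [rAm, rAS, (mom0 _).2, (mom _ _).2] at hle
      exact hle
    · simp only [rSm]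
      rw [hC']
      have hG : Measurable fun y : (ℂ × ℂ × ℂ) × ℂ => ((() : Unit), form v' y.1 + y.2, form u y.1) := by
        fun_prop
      have := indepFun_of_map_eq (W := fun ω => (X ω, Y' ω - form v' (X ω)))
        (W' := fun w : Fin 7 → ℂ => ((gaussSample p w).1.2, w 3)) hWm (by fun_prop) hmap
        (F := fun y => form (v - α • v' - β • u) y.1 + (s - α) * y.2)
        (G := fun y => ((() : Unit), form v' y.1 + y.2, form u y.1)) (by fun_prop) hG ?_
      · simpa only [add_sub_cancel] using this
      · simp only [hlin]
        have e1 : ∀ w, form v' (gaussSample p w).1.2 + w 3 =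
            linForm (coefVec p v' (1, 0, 0, 0)) w := by
          intro w; rw [linForm_coefVec]; simp
        have e2 : ∀ w, form u (gaussSample p w).1.2 = linForm (coefVec p u 0) w := by
          intro w; rw [linForm_coefVec]; simp
        simp only [e1, e2]
        exact (indepFun_linForm o1 o2).comp measurable_id
          (by fun_prop : Measurable fun y : ℂ × ℂ => ((() : Unit), y.1, y.2))
    · simp only [rSm]
      have hF : Measurable fun y : (ℂ × ℂ × ℂ) × ℂ =>
        form (v - α • v' - β • u) y.1 + (s - α) * y.2 := by fun_prop
      have := congrArg (Measure.map fun y : (ℂ × ℂ × ℂ) × ℂ =>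
        form (v - α • v' - β • u) y.1 + (s - α) * y.2) hmap
      rw [Measure.map_map hF hWm, Measure.map_map hF (by fun_prop)] at this
      refine this.trans ?_
      rw [show ((fun y : (ℂ × ℂ × ℂ) × ℂ => form (v - α • v' - β • u) y.1 + (s - α) * y.2) ∘
        fun w : Fin 7 → ℂ => ((gaussSample p w).1.2, w 3)) =
        linForm (coefVec p (v - α • v' - β • u) (s - α, 0, 0, 0)) from funext hlin]
      refine map_linForm _ ?_
      rw [hsum, Real.sq_sqrt hd, norm_sub_rev]
      simp
    · simp only [rAS]; exact (mom0 s).1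
    · simp only [rAm]; exact (mom _ α).1
  have fin : ∀ {c ε : ℝ}, 0 ≤ ε → x * Real.log 2 ≤ a + c →
      ENNReal.ofReal ((c - ε) / Real.log 2) ≤ condMutualInfo P Y B C →
      ENNReal.ofReal (x - ε / Real.log 2) ≤ I + condMutualInfo P Y B C := by
    intro c ε hε hc hcm
    have e : x - ε / Real.log 2 ≤ a / Real.log 2 + (c - ε) / Real.log 2 := by
      rw [← add_div, le_div_iff₀ hl2, sub_mul, div_mul_cancel₀ _ hl2.ne']
      linarith
    exact (ENNReal.ofReal_le_ofReal e).trans (ENNReal.ofReal_add_le.trans (add_le_add hI hcm))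
  rcases hρ1.lt_or_eq with hlt | heq
  -- With `s = ρ` the second moments agree with those of the Gaussian coupling, so both quotients
  -- are one and no loss occurs.
  · obtain ⟨α, β, hk⟩ := key ρ hlt
    have hv := one_sub_norm_sq_pos hlt
    have hn := noiseVar_pos α hlt
    have hfv := formVar_nonneg hp (v - α • v' - β • u)
    have hw : 0 < formVar p (v - α • v' - β • u) + noiseVar α ρ := by positivity
    have e1 : formVar p (v - α • v' - β • u) + 1 + ‖α‖ ^ 2 - 2 * ((starRingEnd ℂ) α * ρ).re =
        formVar p (v - α • v' - β • u) + noiseVar α ρ := by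
      unfold noiseVar
      rw [norm_sub_sq]
      ring
    have e2 : 1 + ‖ρ‖ ^ 2 - 2 * ((starRingEnd ℂ) ρ * ρ).re = 1 - ‖ρ‖ ^ 2 := by rw [hself]; ring
    rw [e1, e2, div_self hw.ne', div_self hv.ne', add_sub_cancel_right,
      Real.log_div hw.ne' hv.ne'] at hk
    have := fin le_rfl (hx ρ hlt α β) (by rwa [sub_zero])
    simpa using this
  -- For `‖ρ‖ = 1` the variance `1 - ‖ρ‖²` degenerates. The choice `s = (1 - ε) ρ` loses at most `ε`
  -- nats, and `ε` then tends to zero.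
  · have hlim : Tendsto (fun ε : ℝ => ENNReal.ofReal (x - ε / Real.log 2)) (𝓝[>] 0)
        (𝓝 (ENNReal.ofReal x)) := by
      have : Tendsto (fun ε : ℝ => x - ε / Real.log 2) (𝓝[>] 0) (𝓝 (x - 0 / Real.log 2)) :=
        Tendsto.mono_left (Continuous.tendsto (by fun_prop) 0) nhdsWithin_le_nhds
      rw [zero_div, sub_zero] at this
      exact (ENNReal.continuous_ofReal.tendsto x).comp this
    refine le_of_tendsto hlim ?_
    filter_upwards [Ioo_mem_nhdsGT (zero_lt_one (α := ℝ))] with ε hε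
    obtain ⟨h0, h1⟩ := hε
    have hns : ‖((1 - ε : ℝ) : ℂ) * ρ‖ = 1 - ε := by
      rw [norm_mul, heq, mul_one, Complex.norm_real, Real.norm_of_nonneg (by linarith)]
    have hs : ‖((1 - ε : ℝ) : ℂ) * ρ‖ < 1 := by rw [hns]; linarith
    obtain ⟨α, β, hk⟩ := key _ hs
    have hv := one_sub_norm_sq_pos hs
    have hn := noiseVar_pos α hs
    have hfv := formVar_nonneg hp (v - α • v' - β • u)
    have hw : 0 < formVar p (v - α • v' - β • u) + noiseVar α (((1 - ε : ℝ) : ℂ) * ρ) := by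
      positivity
    have hnum : 0 ≤ formVar p (v - α • v' - β • u) + 1 + ‖α‖ ^ 2 -
        2 * ((starRingEnd ℂ) α * ρ).re := by
      have := norm_sub_sq α ρ
      rw [heq] at this
      nlinarith [sq_nonneg ‖α - ρ‖]
    -- The numerator is `ε²` and the denominator `2 ε - ε²`, so the quotient is `ε / (2 - ε)`. The
    -- other quotient is nonnegative and is dropped.
    have e2 : (1 + ‖((1 - ε : ℝ) : ℂ) * ρ‖ ^ 2 -
        2 * ((starRingEnd ℂ) (((1 - ε : ℝ) : ℂ) * ρ) * ρ).re) /
        (1 - ‖((1 - ε : ℝ) : ℂ) * ρ‖ ^ 2) ≤ ε := by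
      rw [map_mul, Complex.conj_ofReal, mul_assoc, Complex.re_ofReal_mul, hself, heq, hns,
        div_le_iff₀ (by rwa [hns] at hv)]
      nlinarith [mul_nonneg (sq_nonneg ε) (sub_nonneg.mpr h1.le)]
    refine fin h0.le (hx _ hs α β) (le_trans (ENNReal.ofReal_le_ofReal ?_) hk)
    rw [← Real.log_div hw.ne' hv.ne']
    refine div_le_div_of_nonneg_right ?_ hl2.le
    have := div_nonneg hnum hw.le
    linarith

end Coupling

/-! ### From the closed form to Gaussian inputs -/

variable {𝒬 : Type} [MeasurableSpace 𝒬] {μ : Measure (𝒬 × ℂ × ℂ × ℂ)} [IsProbabilityMeasure μ]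

/-- Under a channel with the right marginal laws the noise of the first output is standard and
independent of the inputs. -/
lemma IsCoupling.map_noise_fst {g : Gains} {κ : Kernel (ℂ × ℂ × ℂ) (ℂ × ℂ)} [IsMarkovKernel κ]
    (h : IsCoupling g κ) : (couplingLaw μ κ).map (fun p => (p.1.2, p.2.1 - g.signal1 p.1.2)) =
      (μ.map Prod.snd).prod stdComplexGaussian := by
  refine Measure.ext_of_lintegral _ fun F hF => ?_
  rw [lintegral_map hF (by fun_prop), Measure.lintegral_compProd (by fun_prop),
    lintegral_prod _ (by fun_prop), lintegral_map (Measurable.lintegral_prod_right' hF) (by fun_prop)]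
  refine lintegral_congr fun x => ?_
  rw [Kernel.comap_apply]
  have e1 := lintegral_map (μ := κ x.2) (f := fun y => F (x.2, y - g.signal1 x.2)) (g := Prod.fst)
    (by fun_prop) (by fun_prop)
  rw [← e1, h.fst_eq, Gains.channelLaw, Measure.map_map (by fun_prop) (by fun_prop),
    lintegral_map (by fun_prop) (by fun_prop)]
  simp only [Function.comp, add_sub_cancel_left]
  have e2 := lintegral_map (μ := stdComplexGaussian.prod stdComplexGaussian) (f := fun z => F (x.2, z))
    (g := Prod.fst) (by fun_prop) (by fun_prop)
  rw [← e2, Measure.map_fst_prod, measure_univ, one_smul]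

lemma IsCoupling.map_noise_snd {g : Gains} {κ : Kernel (ℂ × ℂ × ℂ) (ℂ × ℂ)} [IsMarkovKernel κ]
    (h : IsCoupling g κ) : (couplingLaw μ κ).map (fun p => (p.1.2, p.2.2 - g.signal2 p.1.2)) =
      (μ.map Prod.snd).prod stdComplexGaussian := by
  refine Measure.ext_of_lintegral _ fun F hF => ?_
  rw [lintegral_map hF (by fun_prop), Measure.lintegral_compProd (by fun_prop),
    lintegral_prod _ (by fun_prop), lintegral_map (Measurable.lintegral_prod_right' hF) (by fun_prop)]
  refine lintegral_congr fun x => ?_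
  rw [Kernel.comap_apply]
  have e1 := lintegral_map (μ := κ x.2) (f := fun y => F (x.2, y - g.signal2 x.2)) (g := Prod.snd)
    (by fun_prop) (by fun_prop)
  rw [← e1, h.snd_eq, Gains.channelLaw, Measure.map_map (by fun_prop) (by fun_prop),
    lintegral_map (by fun_prop) (by fun_prop)]
  simp only [Function.comp, add_sub_cancel_left]
  have e2 := lintegral_map (μ := stdComplexGaussian.prod stdComplexGaussian) (f := fun z => F (x.2, z))
    (g := Prod.snd) (by fun_prop) (by fun_prop)
  rw [← e2, map_snd_snd]

/-- Gaussian inputs with the correlations `p` realise the point. For each term the regression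
coefficients are those of the optimal estimator, and the closed form is applied at precisely these
coefficients; the genie terms go through `le_add_condMutualInfo_genie`. -/
lemma closedFormRegion_subset (g : Gains) : closedFormRegion g ⊆ gaussianOuterRegion g := by
  rintro R ⟨hR1, hR2, p, hp, hS⟩
  have hl2 : 0 < Real.log 2 := Real.log_pos (by norm_num)
  have nn := formVar_nonneg hp
  obtain ⟨hQ, hX1, hX2, hX0, hY1, hY2, hV1, hV2, hVt1, hVt2⟩ := measurable_rvs (𝒬 := Unit) g
  have wX1 : ∀ w, rvX1 (gaussSample p w) = linForm (coefVec p unit1 0) w := by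
    intro w; rw [linForm_coefVec]; simp [form, unit1, rvX1]
  have wX2 : ∀ w, rvX2 (gaussSample p w) = linForm (coefVec p unit2 0) w := by
    intro w; rw [linForm_coefVec]; simp [form, unit2, rvX2]
  have wY1 : ∀ w, rvY1 g (gaussSample p w) = linForm (coefVec p g.coef1 (1, 0, 0, 0)) w := by
    intro w; rw [linForm_coefVec, rvY1, g.signal1_eq_form]; simp [gaussSample]
  have wY2 : ∀ w, rvY2 g (gaussSample p w) = linForm (coefVec p g.coef2 (0, 1, 0, 0)) w := by
    intro w; rw [linForm_coefVec, rvY2, g.signal2_eq_form]; simp [gaussSample]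
  have wVt1 : ∀ w, rvVt1 g (gaussSample p w) =
      linForm (coefVec p (g.h21 • unit1) (0, 0, 0, 1)) w := by
    intro w; rw [linForm_coefVec]; simp [form, unit1, rvVt1, rvX1, gaussSample]
  have wVt2 : ∀ w, rvVt2 g (gaussSample p w) =
      linForm (coefVec p (g.h12 • unit2) (0, 0, 1, 0)) w := by
    intro w; rw [linForm_coefVec]; simp [form, unit2, rvVt2, rvX2, gaussSample]
  have w0 : ∀ w, (0 : ℂ) = linForm (coefVec p 0 0) w := by
    intro w; rw [linForm_coefVec]; simp [form]
  have wS1 : ∀ w, g.signal1 (gaussSample p w).1.2 = linForm (coefVec p g.coef1 0) w := by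
    intro w; rw [linForm_coefVec, g.signal1_eq_form]; simp
  have wS2 : ∀ w, g.signal2 (gaussSample p w).1.2 = linForm (coefVec p g.coef2 0) w := by
    intro w; rw [linForm_coefVec, g.signal2_eq_form]; simp
  -- mutual informations
  obtain ⟨α₁, I1⟩ := exists_le_condMutualInfo_gauss hp hY1
    (B := fun ω : Sample Unit => (rvX1 ω, rvX0 ω)) (C := fun ω => (rvQ ω, rvX2 ω))
    (by fun_prop) (by fun_prop) g.coef1 unit2 (1, 0, 0, 0) (by simp)
    (E := fun c => ((), c)) (D := fun c => c.2) (by fun_prop) (by fun_prop) wY1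
    (by intro w; rw [← wX2]) (by intro w; rw [← wX2])
    (S := fun q => g.signal1 (q.2.1, q.1.2, q.2.2)) (by fun_prop) wS1
  obtain ⟨α₂, I2⟩ := exists_le_condMutualInfo_gauss hp hY2
    (B := fun ω : Sample Unit => (rvX2 ω, rvX0 ω)) (C := fun ω => (rvQ ω, rvX1 ω))
    (by fun_prop) (by fun_prop) g.coef2 unit1 (0, 1, 0, 0) (by simp)
    (E := fun c => ((), c)) (D := fun c => c.2) (by fun_prop) (by fun_prop) wY2
    (by intro w; rw [← wX1]) (by intro w; rw [← wX1])
    (S := fun q => g.signal2 (q.1.2, q.2.1, q.2.2)) (by fun_prop) wS2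
  -- Conditioning on the constant `Q` is treated as regression on the zero form, whose coefficient
  -- disappears.
  obtain ⟨α₃, J1⟩ := exists_le_condMutualInfo_gauss hp hY1
    (B := fun ω : Sample Unit => (rvX1 ω, rvX2 ω, rvX0 ω)) (C := rvQ)
    (by fun_prop) (by fun_prop) g.coef1 0 (1, 0, 0, 0) (by simp)
    (E := fun _ => ()) (D := fun _ => 0) (by fun_prop) (by fun_prop) wY1
    (by intro w; rfl) w0 (S := fun q => g.signal1 q.2) (by fun_prop) wS1
  obtain ⟨α₄, J2⟩ := exists_le_condMutualInfo_gauss hp hY2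
    (B := fun ω : Sample Unit => (rvX1 ω, rvX2 ω, rvX0 ω)) (C := rvQ)
    (by fun_prop) (by fun_prop) g.coef2 0 (0, 1, 0, 0) (by simp)
    (E := fun _ => ()) (D := fun _ => 0) (by fun_prop) (by fun_prop) wY2
    (by intro w; rfl) w0 (S := fun q => g.signal2 q.2) (by fun_prop) wS2
  simp only [smul_zero, sub_zero] at J1 J2
  -- entropies
  obtain ⟨α₅, _, H1⟩ := exists_condEntropy_gauss_eq hp hY1
    (C := fun ω : Sample Unit => (rvVt1 g ω, rvQ ω)) (by fun_prop) g.coef1 (g.h21 • unit1) 0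
    (1, 0, 0, 0) (0, 0, 0, 1) 0 (E := fun c => (c.1, ())) (D := fun c => (c.1, 0)) (by fun_prop)
    (by fun_prop) wY1 (by intro w; rw [← wVt1]) (by intro w; rw [← wVt1, ← w0])
    (c := fun α _ => 1 + ‖α‖ ^ 2) (by intro α β; simp) (fun α _ => one_add_norm_sq_pos α)
  obtain ⟨α₆, _, H2⟩ := exists_condEntropy_gauss_eq hp hY2
    (C := fun ω : Sample Unit => (rvVt2 g ω, rvQ ω)) (by fun_prop) g.coef2 (g.h12 • unit2) 0
    (0, 1, 0, 0) (0, 0, 1, 0) 0 (E := fun c => (c.1, ())) (D := fun c => (c.1, 0)) (by fun_prop)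
    (by fun_prop) wY2 (by intro w; rw [← wVt2]) (by intro w; rw [← wVt2, ← w0])
    (c := fun α _ => 1 + ‖α‖ ^ 2) (by intro α β; simp) (fun α _ => one_add_norm_sq_pos α)
  obtain ⟨_, _, T1⟩ := exists_condEntropy_gauss_eq hp hY1 (C := rvQ) hQ g.coef1 0 0
    (1, 0, 0, 0) 0 0 (E := fun _ => ()) (D := fun _ => (0, 0)) (by fun_prop)
    (by fun_prop) wY1 (by intro w; rfl) (by intro w; rw [← w0])
    (c := fun _ _ => 1) (by intro α β; simp) (fun _ _ => one_pos)
  obtain ⟨_, _, T2⟩ := exists_condEntropy_gauss_eq hp hY2 (C := rvQ) hQ g.coef2 0 0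
    (0, 1, 0, 0) 0 0 (E := fun _ => ()) (D := fun _ => (0, 0)) (by fun_prop)
    (by fun_prop) wY2 (by intro w; rfl) (by intro w; rw [← w0])
    (c := fun _ _ => 1) (by intro α β; simp) (fun _ _ => one_pos)
  obtain ⟨α₇, β₇, U1⟩ := exists_condEntropy_gauss_eq hp hY1
    (C := fun ω : Sample Unit => (rvVt1 g ω, rvX2 ω, rvQ ω)) (by fun_prop) g.coef1
    (g.h21 • unit1) unit2 (1, 0, 0, 0) (0, 0, 0, 1) 0 (E := fun c => (c.1, c.2, ()))
    (D := fun c => (c.1, c.2.1)) (by fun_prop)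
    (by fun_prop) wY1 (by intro w; rw [← wVt1, ← wX2]) (by intro w; rw [← wVt1, ← wX2])
    (c := fun α _ => 1 + ‖α‖ ^ 2) (by intro α β; simp) (fun α _ => one_add_norm_sq_pos α)
  obtain ⟨α₈, β₈, U2⟩ := exists_condEntropy_gauss_eq hp hY2
    (C := fun ω : Sample Unit => (rvVt2 g ω, rvX1 ω, rvQ ω)) (by fun_prop) g.coef2
    (g.h12 • unit2) unit1 (0, 1, 0, 0) (0, 0, 1, 0) 0 (E := fun c => (c.1, c.2, ()))
    (D := fun c => (c.1, c.2.1)) (by fun_prop)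
    (by fun_prop) wY2 (by intro w; rw [← wVt2, ← wX1]) (by intro w; rw [← wVt2, ← wX1])
    (c := fun α _ => 1 + ‖α‖ ^ 2) (by intro α β; simp) (fun α _ => one_add_norm_sq_pos α)
  simp only [smul_zero, sub_zero, smul_smul] at H1 H2 T1 T2 U1 U2
  obtain ⟨n1, n2, n3, n4⟩ := condEntropy_noise (gaussLaw p) g
  have hn : (Real.log Real.pi + 1) / Real.log 2 * Real.log 2 = Real.log Real.pi + 1 :=
    div_mul_cancel₀ _ hl2.ne'
  have lognn : ∀ v, 0 ≤ Real.log (formVar p v + 1) := fun v =>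
    Real.log_nonneg (by linarith [nn v])
  have single : ∀ {x a : ℝ} {I : ℝ≥0∞}, x * Real.log 2 ≤ a →
      ENNReal.ofReal (a / Real.log 2) ≤ I → ENNReal.ofReal x ≤ I := by
    intro x a I h hI
    refine le_trans (ENNReal.ofReal_le_ofReal ?_) hI
    rw [le_div_iff₀ hl2]
    exact h
  refine ⟨gaussLaw p, inferInstance, isInputLaw_gaussLaw hp, isProperGaussian_gaussLaw p, hR1, hR2,
    ⟨single (hS.single1 α₁) I1, single (hS.single2 α₂) I2, ?_, ?_⟩, ?_, ?_, ?_⟩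
  · intro κ hκ hc
    have h1 := hc.map_noise_fst (μ := gaussLaw p)
    have h2 := hc.map_noise_snd (μ := gaussLaw p)
    rw [g.signal1_eq_form] at h1
    rw [g.signal2_eq_form] at h2
    refine le_add_condMutualInfo_genie hp (X := fun p => p.1.2) (by fun_prop) (by fun_prop)
      (Y' := fun p => p.2.2) (by fun_prop) h1 h2 (u := unit2) (by fun_prop) (q := fun p => p.1.1)
      (by intro ω; simp [form, unit2]) (T := fun b => form g.coef1 (b.2.1, b.1, b.2.2))
      (T' := fun b => form g.coef2 (b.2.1, b.1, b.2.2)) (by fun_prop) (by fun_prop)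
      (by intro ω; simp [form, unit2]) (by intro ω; simp [form, unit2])
      ?_ J2
    intro s hs α β
    simpa using hS.genie2 s hs α β
  · intro κ hκ hc
    have h1 := hc.map_noise_fst (μ := gaussLaw p)
    have h2 := hc.map_noise_snd (μ := gaussLaw p)
    rw [g.signal1_eq_form] at h1
    rw [g.signal2_eq_form] at h2
    refine le_add_condMutualInfo_genie hp (X := fun p => p.1.2) (by fun_prop) (by fun_prop)
      (Y' := fun p => p.2.1) (by fun_prop) h2 h1 (u := unit1) (by fun_prop) (q := fun p => p.1.1)
      (by intro ω; simp [form, unit1]) (T := fun b => form g.coef2 (b.1, b.2.1, b.2.2))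
      (T' := fun b => form g.coef1 (b.1, b.2.1, b.2.2)) (by fun_prop) (by fun_prop)
      (by intro ω; simp [form, unit1]) (by intro ω; simp [form, unit1])
      ?_ J1
    intro s hs α β
    simpa using hS.genie1 s hs α β
  · have := hS.interference α₅ α₆
    rw [n1, n2]
    refine le_of_mul_le_mul_right ?_ hl2
    linarith
  · have := hS.weighted1 α₇ β₇ α₆
    rw [n1, n4]
    refine le_of_mul_le_mul_right ?_ hl2
    linarith
  · have := hS.weighted2 α₈ β₈ α₅
    rw [n2, n3]
    refine le_of_mul_le_mul_right ?_ hl2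
    linarith

lemma gaussianOuterRegion_subset (g : Gains) : gaussianOuterRegion g ⊆ outerRegion g := by
  rintro R ⟨μ, hμ, h1, -, h2⟩
  exact ⟨Unit, inferInstance, inferInstance, μ, hμ, h1, h2⟩

/-! ### Gaussian vectors -/

variable {n : ℕ}

/-- Density of `n` independent complex Gaussians of variance `v`. -/
def vden (v : ℝ) (y : Fin n → ℂ) : ℝ := ∏ t, gden v (y t)

lemma vden_pos {v : ℝ} (hv : 0 < v) (y : Fin n → ℂ) : 0 < vden v y :=
  Finset.prod_pos fun t _ => gden_pos hv (y t)

@[fun_prop]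
lemma measurable_vden (v : ℝ) : Measurable (vden v : (Fin n → ℂ) → ℝ) := by
  unfold vden; fun_prop

lemma log_vden {v : ℝ} (hv : 0 < v) (y : Fin n → ℂ) :
    Real.log (vden v y) = -(n * Real.log (Real.pi * v)) - (∑ t, ‖y t‖ ^ 2) / v := by
  unfold vden
  rw [Real.log_prod fun t _ => (gden_pos hv (y t)).ne']
  simp_rw [log_gden hv]
  rw [Finset.sum_sub_distrib, Finset.sum_div]
  simp

lemma pi_gden {v : ℝ} (hv : 0 < v) :
    (Measure.pi fun _ : Fin n => (volume : Measure ℂ).withDensity fun z => ENNReal.ofReal (gden v z)) =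
      (volume : Measure (Fin n → ℂ)).withDensity fun y => ENNReal.ofReal (vden v y) := by
  have := isProbabilityMeasure_gden hv
  refine Measure.pi_eq fun s hs => ?_
  have hi : Integrable (vden v : (Fin n → ℂ) → ℝ) volume :=
    Integrable.fintype_prod (f := fun _ : Fin n => gden v) fun _ => integrable_gden hv
  rw [withDensity_apply _ (MeasurableSet.univ_pi hs), ← ofReal_integral_eq_lintegral_ofReal
    hi.integrableOn (Eventually.of_forall fun y => (vden_pos hv y).le), volume_pi,
    Measure.restrict_pi_pi]
  unfold vden
  rw [integral_fintype_prod_eq_prod (fun _ => gden v), ENNReal.ofReal_prod_of_nonneg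
    fun i _ => integral_nonneg fun z => (gden_pos hv z).le]
  refine Finset.prod_congr rfl fun i _ => ?_
  rw [withDensity_apply _ (hs i), ofReal_integral_eq_lintegral_ofReal
    (integrable_gden hv).integrableOn (Eventually.of_forall fun z => (gden_pos hv z).le)]

/-- The law of independent Gaussians of variance `v` with means `m`. -/
lemma lintegral_add_sqrt_mul {v : ℝ} (hv : 0 < v) (m : Fin n → ℂ) {F : (Fin n → ℂ) → ℝ≥0∞}
    (hF : Measurable F) :
    ∫⁻ z, F (fun t => m t + ((Real.sqrt v : ℝ) : ℂ) * z t) ∂stdFamily (Fin n) =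
      ∫⁻ y, F y * ENNReal.ofReal (vden v (y - m)) := by
  have h1 : (stdFamily (Fin n)).map (fun z t => ((Real.sqrt v : ℝ) : ℂ) * z t) =
      (volume : Measure (Fin n → ℂ)).withDensity fun y => ENNReal.ofReal (vden v y) := by
    have : ∀ i : Fin n, IsProbabilityMeasure
        (stdComplexGaussian.map fun z => ((Real.sqrt v : ℝ) : ℂ) * z) := fun i =>
      Measure.isProbabilityMeasure_map (by fun_prop)
    rw [← pi_gden hv, Measure.pi_map_pi (f := fun (_ : Fin n) z => ((Real.sqrt v : ℝ) : ℂ) * z)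
      (fun i => by fun_prop)]
    simp_rw [map_sqrt_std hv]
  have h2 : ∫⁻ z, F (fun t => m t + ((Real.sqrt v : ℝ) : ℂ) * z t) ∂stdFamily (Fin n) =
      ∫⁻ y, F (m + y) ∂((stdFamily (Fin n)).map (fun z t => ((Real.sqrt v : ℝ) : ℂ) * z t)) := by
    rw [lintegral_map (by fun_prop) (by fun_prop)]
    rfl
  rw [h2, h1, lintegral_withDensity_eq_lintegral_mul _ (by fun_prop) (by fun_prop)]
  have h3 := lintegral_add_left_eq_self (μ := (volume : Measure (Fin n → ℂ)))
    (fun y => F y * ENNReal.ofReal (vden v (y - m))) m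
  rw [← h3]
  refine lintegral_congr fun y => ?_
  simp [mul_comm]

/-- Expectations over the noise become Lebesgue integrals, where the factor `vden 1 (y - m)` cancels
the denominator of a likelihood ratio. All changes of measure for block codes use this. -/
lemma lintegral_add_noise (m : Fin n → ℂ) {F : (Fin n → ℂ) → ℝ≥0∞} (hF : Measurable F) :
    ∫⁻ z, F (m + z) ∂stdFamily (Fin n) = ∫⁻ y, F y * ENNReal.ofReal (vden 1 (y - m)) := by
  rw [← lintegral_add_sqrt_mul one_pos m hF]
  simp only [Real.sqrt_one, Complex.ofReal_one, one_mul]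
  rfl

lemma lintegral_vden {v : ℝ} (hv : 0 < v) (m : Fin n → ℂ) :
    ∫⁻ y, ENNReal.ofReal (vden v (y - m)) = 1 := by
  have := lintegral_add_sqrt_mul hv m (F := fun _ => 1) measurable_const
  simpa using this.symm

/-- A combination of two independent standard Gaussian vectors. -/
lemma map_stdFamily_prod {r : ℝ} {s : ℂ} (h : r ^ 2 + ‖s‖ ^ 2 = 1) :
    ((stdFamily (Fin n)).prod (stdFamily (Fin n))).map
      (fun z t => (r : ℂ) * z.2 t + s * z.1 t) = stdFamily (Fin n) := by
  have h1 := (measurePreserving_arrowProdEquivProdArrow ℂ ℂ (Fin n) (fun _ => stdComplexGaussian)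
    (fun _ => stdComplexGaussian)).map_eq
  have hsw : (stdComplexGaussian.prod stdComplexGaussian).map (fun z => (r : ℂ) * z.2 + s * z.1) =
      stdComplexGaussian := by
    have := congrArg (Measure.map (fun z : ℂ × ℂ => (r : ℂ) * z.1 + s * z.2))
      (Measure.prod_swap (μ := stdComplexGaussian) (ν := stdComplexGaussian))
    rw [map_std_prod_std h, Measure.map_map (by fun_prop) (by fun_prop)] at this
    exact this
  have : ∀ i : Fin n, IsProbabilityMeasure ((stdComplexGaussian.prod stdComplexGaussian).map
      fun z => (r : ℂ) * z.2 + s * z.1) := fun i => Measure.isProbabilityMeasure_map (by fun_prop)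
  unfold stdFamily
  rw [← h1, Measure.map_map (by fun_prop) (MeasurableEquiv.measurable _)]
  have h2 := Measure.pi_map_pi (μ := fun _ : Fin n => stdComplexGaussian.prod stdComplexGaussian)
    (f := fun _ z => (r : ℂ) * z.2 + s * z.1) (fun i => by fun_prop)
  simp_rw [hsw] at h2
  exact h2

/-- Second moment of a combination of two noise vectors. -/
lemma integral_sum_norm_sq (c : Fin n → ℂ) (β β' : ℂ) :
    Integrable (fun z : (Fin n → ℂ) × (Fin n → ℂ) => ∑ t, ‖c t + (β * z.1 t + β' * z.2 t)‖ ^ 2)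
      ((stdFamily (Fin n)).prod (stdFamily (Fin n))) ∧
    ∫ z, ∑ t, ‖c t + (β * z.1 t + β' * z.2 t)‖ ^ 2
      ∂((stdFamily (Fin n)).prod (stdFamily (Fin n))) =
      ∑ t, ‖c t‖ ^ 2 + n * (‖β‖ ^ 2 + ‖β'‖ ^ 2) := by
  have key : ∀ t : Fin n, ∀ β : ℂ, MemLp (fun z : Fin n → ℂ => β * z t) 2 (stdFamily (Fin n)) ∧
      ∫ z, β * z t ∂stdFamily (Fin n) = 0 ∧ ∫ z, ‖β * z t‖ ^ 2 ∂stdFamily (Fin n) = ‖β‖ ^ 2 := by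
    intro t β
    have hp := measurePreserving_eval (fun _ : Fin n => stdComplexGaussian) t
    obtain ⟨h1, h2, h3⟩ := integral_norm_sq_mul_std β
    refine ⟨h1.comp_measurePreserving hp, ?_, ?_⟩
    · rw [← h2, ← hp.map_eq, integral_map hp.aemeasurable (by fun_prop)]
    · rw [← h3, ← hp.map_eq, integral_map hp.aemeasurable (by fun_prop)]
  have one : ∀ t : Fin n, Integrable (fun z : (Fin n → ℂ) × (Fin n → ℂ) =>
      ‖c t + (β * z.1 t + β' * z.2 t)‖ ^ 2) ((stdFamily (Fin n)).prod (stdFamily (Fin n))) ∧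
      ∫ z, ‖c t + (β * z.1 t + β' * z.2 t)‖ ^ 2 ∂((stdFamily (Fin n)).prod (stdFamily (Fin n))) =
      ‖c t‖ ^ 2 + (‖β‖ ^ 2 + ‖β'‖ ^ 2) := by
    intro t
    obtain ⟨a1, a2, a3⟩ := key t β
    obtain ⟨b1, b2, b3⟩ := key t β'
    have h1 := integral_norm_sq_add_prod ((memLp_const (c t)).add a1) b1 b2
    have h2 := integral_norm_sq_add_prod (μ := Measure.dirac ()) (f := fun _ => c t)
      (memLp_const (c t)) a1 a2
    have h3 : ∫ z, ‖c t + β * z t‖ ^ 2 ∂stdFamily (Fin n) = ‖c t‖ ^ 2 + ‖β‖ ^ 2 := by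
      have := h2.2
      rw [a3, integral_fun_snd (fun z : Fin n → ℂ => ‖c t + β * z t‖ ^ 2)] at this
      simpa using this
    simp_rw [← add_assoc]
    refine ⟨h1.1.integrable_norm_pow (p := 2) (by norm_num), h1.2.trans ?_⟩
    simp only [Pi.add_apply]
    rw [h3, b3]
  refine ⟨integrable_finsetSum _ fun t _ => (one t).1, ?_⟩
  rw [integral_finsetSum _ fun t _ => (one t).1]
  simp_rw [(one _).2]
  rw [Finset.sum_add_distrib]
  simp [mul_add]

/-- Expectation of the logarithm of a Gaussian density. -/
lemma integral_log_vden {v : ℝ} (hv : 0 < v) (c : Fin n → ℂ) (β β' : ℂ) :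
    Integrable (fun z : (Fin n → ℂ) × (Fin n → ℂ) =>
      Real.log (vden v fun t => c t + (β * z.1 t + β' * z.2 t)))
      ((stdFamily (Fin n)).prod (stdFamily (Fin n))) ∧
    ∫ z, Real.log (vden v fun t => c t + (β * z.1 t + β' * z.2 t))
      ∂((stdFamily (Fin n)).prod (stdFamily (Fin n))) =
      -(n * Real.log (Real.pi * v)) - (∑ t, ‖c t‖ ^ 2 + n * (‖β‖ ^ 2 + ‖β'‖ ^ 2)) / v := by
  obtain ⟨h1, h2⟩ := integral_sum_norm_sq c β β'
  simp_rw [log_vden hv]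
  refine ⟨(integrable_const _).sub (h1.div_const v), ?_⟩
  rw [integral_sub (integrable_const _) (h1.div_const v), integral_div, h2]
  simp

/-! ### Densities of output sequences -/

/-- Positive probability densities whose logarithm is integrable under Gaussian laws. -/
structure IsDensity (r : (Fin n → ℂ) → ℝ) : Prop where
  measurable : Measurable r
  pos : ∀ y, 0 < r y
  lintegral_eq_one : ∫⁻ y, ENNReal.ofReal (r y) = 1
  integrable_log : ∀ m : Fin n → ℂ, Integrable (fun z => Real.log (r (m + z))) (stdFamily (Fin n))

lemma integrable_sum_norm_sq (c : Fin n → ℂ) :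
    Integrable (fun z : Fin n → ℂ => ∑ t, ‖c t + z t‖ ^ 2) (stdFamily (Fin n)) := by
  have := (integral_sum_norm_sq c 1 0).1
  simp only [one_mul, zero_mul, add_zero] at this
  exact this.of_comp_fst (IsProbabilityMeasure.ne_zero _)

/-- The uniform mixture of unit-variance Gaussian densities with means `m i`. -/
def mixDen {ι : Type*} [Fintype ι] (m : ι → Fin n → ℂ) (y : Fin n → ℂ) : ℝ :=
  (∑ i, vden 1 (y - m i)) / Fintype.card ι

lemma vden_one_le (y : Fin n → ℂ) : vden 1 y ≤ 1 := by
  refine Finset.prod_le_one (fun t _ => (gden_pos one_pos _).le) fun t _ => ?_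
  refine (gden_le one_pos (y t)).trans ?_
  rw [mul_one]
  exact inv_le_one_of_one_le₀ (by linarith [Real.pi_gt_three])

/-- Integrability of the logarithm: the mixture is at most one because `π ≥ 1`, and at least any
single component divided by the number of components. Its logarithm is thus bounded by a constant
plus a quadratic function. -/
lemma isDensity_mixDen {ι : Type*} [Fintype ι] [Nonempty ι] (m : ι → Fin n → ℂ) :
    IsDensity (mixDen m) := by
  have hc : 0 < (Fintype.card ι : ℝ) := by exact_mod_cast Fintype.card_pos
  have hm : Measurable (mixDen m) := by unfold mixDen; fun_prop
  have hpos : ∀ y, 0 < mixDen m y := fun y =>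
    div_pos (Finset.sum_pos (fun i _ => vden_pos one_pos _) Finset.univ_nonempty) hc
  refine ⟨hm, hpos, ?_, fun c => ?_⟩
  · unfold mixDen
    have : ∀ y : Fin n → ℂ, ENNReal.ofReal ((∑ i, vden 1 (y - m i)) / Fintype.card ι) =
        (∑ i, ENNReal.ofReal (vden 1 (y - m i))) * (Fintype.card ι : ℝ≥0∞)⁻¹ := by
      intro y
      rw [ENNReal.ofReal_div_of_pos hc, ENNReal.ofReal_sum_of_nonneg
        fun i _ => (vden_pos one_pos _).le, ENNReal.ofReal_natCast, div_eq_mul_inv]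
    simp_rw [this]
    rw [lintegral_mul_const _ (by fun_prop), lintegral_finsetSum _ (by fun_prop)]
    simp_rw [lintegral_vden one_pos]
    simp only [Finset.sum_const, Finset.card_univ, nsmul_eq_mul, mul_one]
    exact ENNReal.mul_inv_cancel (by simp) (by simp)
  · obtain ⟨i⟩ := ‹Nonempty ι›
    have hlow : ∀ y, -Real.log (Fintype.card ι) - n * Real.log Real.pi - ∑ t, ‖(y - m i) t‖ ^ 2 ≤
        Real.log (mixDen m y) := by
      intro y
      have h1 : vden 1 (y - m i) / Fintype.card ι ≤ mixDen m y := by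
        unfold mixDen
        gcongr
        exact Finset.single_le_sum (f := fun i => vden 1 (y - m i))
          (fun i _ => (vden_pos one_pos _).le) (Finset.mem_univ i)
      have h2 := Real.log_le_log (div_pos (vden_pos one_pos _) hc) h1
      rw [Real.log_div (vden_pos one_pos _).ne' hc.ne', log_vden one_pos] at h2
      simp only [mul_one, div_one] at h2
      linarith
    have hup : ∀ y, Real.log (mixDen m y) ≤ 0 := by
      intro y
      refine Real.log_nonpos (hpos y).le ?_
      unfold mixDen
      rw [div_le_one hc]
      refine (Finset.sum_le_sum fun i _ => vden_one_le (y - m i)).trans ?_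
      simp
    have hi := integrable_sum_norm_sq (c - m i)
    refine Integrable.mono' (g := fun z => (Real.log (Fintype.card ι) + n * Real.log Real.pi) +
      ∑ t, ‖(c - m i) t + z t‖ ^ 2) ((integrable_const _).add hi)
      (hm.comp (measurable_const_add c)).log.aestronglyMeasurable
      (Eventually.of_forall fun z => ?_)
    rw [Real.norm_eq_abs, abs_of_nonpos (hup _)]
    have := hlow (c + z)
    have e : ∀ t, (c + z - m i) t = (c - m i) t + z t := by
      intro t; simp only [Pi.sub_apply, Pi.add_apply]; ring
    simp_rw [e] at this
    linarith

lemma isDensity_vden : IsDensity (vden 1 : (Fin n → ℂ) → ℝ) := by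
  have := isDensity_mixDen (n := n) (fun _ : Unit => 0)
  have e : mixDen (fun _ : Unit => (0 : Fin n → ℂ)) = vden 1 := by
    funext y; simp [mixDen]
  rwa [e] at this

/-! ### Averages over message pairs and Fano's inequality -/

section Average

variable {A B : Type*} [Fintype A] [Fintype B]

/-- Expectation over two independent uniformly distributed messages. -/
def average (f : A → B → ℝ) : ℝ := (∑ a, ∑ b, f a b) / (Fintype.card A * Fintype.card B)

lemma average_add (f f' : A → B → ℝ) :
    average (fun a b => f a b + f' a b) = average f + average f' := by
  simp only [average, Finset.sum_add_distrib, add_div]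

lemma average_sub (f f' : A → B → ℝ) :
    average (fun a b => f a b - f' a b) = average f - average f' := by
  simp only [average, Finset.sum_sub_distrib, sub_div]

lemma average_const_mul (c : ℝ) (f : A → B → ℝ) :
    average (fun a b => c * f a b) = c * average f := by
  simp only [average, ← Finset.mul_sum, mul_div_assoc]

lemma average_mono {f f' : A → B → ℝ} (h : ∀ a b, f a b ≤ f' a b) : average f ≤ average f' := by
  unfold average
  gcongr with a _ b _
  exact h a b

lemma average_swap (f : A → B → ℝ) : average (fun b a => f a b) = average f := by
  unfold average
  rw [Finset.sum_comm, mul_comm]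

variable [Nonempty A] [Nonempty B]

lemma average_const_fun (c : ℝ) :
    average (fun (_ : A) (_ : B) => c) = c := by
  unfold average
  simp only [Finset.sum_const, Finset.card_univ, nsmul_eq_mul]
  field_simp

/-- Jensen's inequality for the logarithm. -/
lemma average_integral_log_le {Ω : Type*} [MeasurableSpace Ω] {N : Measure Ω}
    [IsProbabilityMeasure N] {f : A → B → Ω → ℝ} (hpos : ∀ a b ω, 0 < f a b ω)
    (hmeas : ∀ a b, Measurable (f a b))
    (hlog : ∀ a b, Integrable (fun ω => Real.log (f a b ω)) N) {c : ℝ} (hc : 0 < c)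
    (hf : ∑ a, ∑ b, ∫⁻ ω, ENNReal.ofReal (f a b ω) ∂N ≤
      ENNReal.ofReal (c * (Fintype.card A * Fintype.card B))) :
    average (fun a b => ∫ ω, Real.log (f a b ω) ∂N) ≤ Real.log c := by
  have hcard : 0 < (Fintype.card A * Fintype.card B : ℝ) := by
    have h1 : 0 < (Fintype.card A : ℝ) := by exact_mod_cast Fintype.card_pos
    have h2 : 0 < (Fintype.card B : ℝ) := by exact_mod_cast Fintype.card_pos
    positivity
  have hfin : ∀ a b, ∫⁻ ω, ENNReal.ofReal (f a b ω) ∂N ≠ ∞ := by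
    intro a b
    refine ne_top_of_le_ne_top ENNReal.ofReal_ne_top (le_trans ?_ hf)
    refine le_trans ?_ (Finset.single_le_sum (f := fun a => ∑ b, ∫⁻ ω, ENNReal.ofReal (f a b ω) ∂N)
      (fun _ _ => zero_le) (Finset.mem_univ a))
    exact Finset.single_le_sum (f := fun b => ∫⁻ ω, ENNReal.ofReal (f a b ω) ∂N)
      (fun _ _ => zero_le) (Finset.mem_univ b)
  have hint : ∀ a b, Integrable (f a b) N := by
    intro a b
    refine ⟨(hmeas a b).aestronglyMeasurable, ?_⟩
    rw [hasFiniteIntegral_iff_ofReal (Eventually.of_forall fun ω => (hpos a b ω).le)]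
    exact (hfin a b).lt_top
  have hsum : average (fun a b => ∫ ω, f a b ω ∂N) ≤ c := by
    unfold average
    rw [div_le_iff₀ hcard]
    have e : ENNReal.ofReal (∑ a, ∑ b, ∫ ω, f a b ω ∂N) =
        ∑ a, ∑ b, ∫⁻ ω, ENNReal.ofReal (f a b ω) ∂N := by
      rw [ENNReal.ofReal_sum_of_nonneg fun a _ => Finset.sum_nonneg fun b _ =>
        integral_nonneg fun ω => (hpos a b ω).le]
      refine Finset.sum_congr rfl fun a _ => ?_
      rw [ENNReal.ofReal_sum_of_nonneg fun b _ => integral_nonneg fun ω => (hpos a b ω).le]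
      refine Finset.sum_congr rfl fun b _ => ?_
      rw [ofReal_integral_eq_lintegral_ofReal (hint a b)
        (Eventually.of_forall fun ω => (hpos a b ω).le)]
    rw [← e] at hf
    exact (ENNReal.ofReal_le_ofReal_iff (by positivity)).mp hf
  -- The tangent of the logarithm at `c`, namely `log x ≤ x / c - 1 + log c`, is integrated.
  calc average (fun a b => ∫ ω, Real.log (f a b ω) ∂N)
      ≤ average (fun a b => c⁻¹ * (∫ ω, f a b ω ∂N) + (Real.log c - 1)) := by
        refine average_mono fun a b => ?_
        have : ∫ ω, Real.log (f a b ω) ∂N ≤ ∫ ω, (c⁻¹ * f a b ω + (Real.log c - 1)) ∂N := by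
          refine integral_mono (hlog a b) (((hint a b).const_mul _).add (integrable_const _))
            fun ω => ?_
          have h := Real.log_le_sub_one_of_pos (mul_pos (inv_pos.mpr hc) (hpos a b ω))
          rw [Real.log_mul (inv_pos.mpr hc).ne' (hpos a b ω).ne', Real.log_inv] at h
          simp only
          linarith
        rw [integral_add ((hint a b).const_mul _) (integrable_const _), integral_const_mul] at this
        simpa using this
    _ = c⁻¹ * average (fun a b => ∫ ω, f a b ω ∂N) + (Real.log c - 1) := by
        rw [average_add, average_const_mul, average_const_fun]
    _ ≤ c⁻¹ * c + (Real.log c - 1) := by gcongr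
    _ = Real.log c := by rw [inv_mul_cancel₀ hc.ne']; ring

/-- Fano's inequality, in terms of a likelihood ratio `ρ` that turns the laws of the observation
`y a b`, averaged over `b`, into a measure `Q` that does not depend on the message `a`. -/
lemma fano {Ω 𝒴 : Type*} [MeasurableSpace Ω] [MeasurableSpace 𝒴] {N : Measure Ω}
    [IsProbabilityMeasure N] [MeasurableSpace A] [MeasurableSingletonClass A] {y : A → B → Ω → 𝒴}
    (hy : ∀ a b, Measurable (y a b)) {dec : 𝒴 → A} (hdec : Measurable dec) {ρ : A → B → Ω → ℝ}
    (hpos : ∀ a b ω, 0 < ρ a b ω) (hmeas : ∀ a b, Measurable (ρ a b))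
    (hlog : ∀ a b, Integrable (fun ω => Real.log (ρ a b ω)) N) {Q : Measure 𝒴}
    (hQ : Q Set.univ ≤ Fintype.card B)
    (h : ∀ a, ∀ D : 𝒴 → ℝ≥0∞, Measurable D →
      ∑ b, ∫⁻ ω, D (y a b ω) * ENNReal.ofReal (ρ a b ω) ∂N ≤ ∫⁻ u, D u ∂Q) :
    (1 - average fun a b => N.real {ω | dec (y a b ω) ≠ a}) * Real.log (Fintype.card A) -
      Real.log 2 ≤ -average fun a b => ∫ ω, Real.log (ρ a b ω) ∂N := by
  classical
  have hA : 0 < (Fintype.card A : ℝ) := by exact_mod_cast Fintype.card_pos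
  -- The expectation of `log D` is `log |A|` times the probability of correct decoding. For each
  -- output the sum of `D` over all messages is at most `2 |A|`; this gives `c = 2` in Jensen's
  -- inequality and so the loss `log 2`.
  let D : A → 𝒴 → ℝ := fun a u => if dec u = a then Fintype.card A else 1
  have hDpos : ∀ a u, 0 < D a u := by
    intro a u; simp only [D]; split_ifs <;> positivity
  have hset : ∀ a, MeasurableSet {u | dec u = a} := fun a => hdec (measurableSet_singleton a)
  have hDm : ∀ a, Measurable (D a) := fun a => Measurable.ite (hset a) (by fun_prop) (by fun_prop)
  have hlogD : ∀ a u, Real.log (D a u) =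
      Set.indicator {u | dec u = a} (fun _ => Real.log (Fintype.card A)) u := by
    intro a u
    simp only [D, Set.indicator_apply, Set.mem_ofPred_eq]
    split_ifs <;> simp
  have hset' : ∀ a b, MeasurableSet {ω | dec (y a b ω) = a} := fun a b => hy a b (hset a)
  have hlogDi : ∀ a b, Integrable (fun ω => Real.log (D a (y a b ω))) N ∧
      ∫ ω, Real.log (D a (y a b ω)) ∂N =
        Real.log (Fintype.card A) * (1 - N.real {ω | dec (y a b ω) ≠ a}) := by
    intro a b
    have e : (fun ω => Real.log (D a (y a b ω))) =
        Set.indicator {ω | dec (y a b ω) = a} (fun _ => Real.log (Fintype.card A)) := by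
      funext ω
      rw [hlogD]
      rfl
    rw [e]
    refine ⟨(integrable_const _).indicator (hset' a b), ?_⟩
    rw [integral_indicator_const _ (hset' a b), smul_eq_mul, mul_comm]
    congr 1
    have := probReal_compl_eq_one_sub (μ := N) (hset' a b)
    rw [show {ω | dec (y a b ω) ≠ a} = {ω | dec (y a b ω) = a}ᶜ from rfl, this]
    ring
  have key := average_integral_log_le (N := N) (f := fun a b ω => D a (y a b ω) * ρ a b ω)
    (fun a b ω => mul_pos (hDpos _ _) (hpos _ _ _))
    (fun a b => ((hDm a).comp (hy a b)).mul (hmeas a b)) ?_ (c := 2) two_pos ?_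
  · have e : ∀ a b, ∫ ω, Real.log (D a (y a b ω) * ρ a b ω) ∂N =
        Real.log (Fintype.card A) * (1 - N.real {ω | dec (y a b ω) ≠ a}) +
          ∫ ω, Real.log (ρ a b ω) ∂N := by
      intro a b
      rw [← (hlogDi a b).2, ← integral_add (hlogDi a b).1 (hlog a b)]
      exact integral_congr_ae (Eventually.of_forall fun ω =>
        Real.log_mul (hDpos _ _).ne' (hpos _ _ _).ne')
    simp_rw [e] at key
    rw [average_add, average_const_mul, average_sub, average_const_fun] at key
    linarith
  · intro a b
    refine ((hlogDi a b).1.add (hlog a b)).congr (Eventually.of_forall fun ω => ?_)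
    exact (Real.log_mul (hDpos _ _).ne' (hpos _ _ _).ne').symm
  · calc ∑ a, ∑ b, ∫⁻ ω, ENNReal.ofReal (D a (y a b ω) * ρ a b ω) ∂N
        ≤ ∑ a, ∫⁻ u, ENNReal.ofReal (D a u) ∂Q := by
          refine Finset.sum_le_sum fun a _ => ?_
          refine le_trans (le_of_eq ?_) (h a (fun u => ENNReal.ofReal (D a u)) (hDm a).ennreal_ofReal)
          simp_rw [ENNReal.ofReal_mul (hDpos _ _).le]
      _ = ∫⁻ u, ∑ a, ENNReal.ofReal (D a u) ∂Q :=
          (lintegral_finsetSum _ fun a _ => (hDm a).ennreal_ofReal).symm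
      _ ≤ ∫⁻ _, ENNReal.ofReal (2 * Fintype.card A) ∂Q := by
          refine lintegral_mono fun u => ?_
          rw [← ENNReal.ofReal_sum_of_nonneg fun a _ => (hDpos a u).le]
          refine ENNReal.ofReal_le_ofReal ?_
          calc ∑ a, D a u ≤ ∑ a, ((if dec u = a then (Fintype.card A : ℝ) else 0) + 1) := by
                refine Finset.sum_le_sum fun a _ => ?_
                simp only [D]
                split_ifs <;> linarith
            _ = 2 * Fintype.card A := by
                rw [Finset.sum_add_distrib, Finset.sum_ite_eq]
                simp
                ring
      _ ≤ ENNReal.ofReal (2 * Fintype.card A) * Fintype.card B := by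
          rw [lintegral_const]
          gcongr
      _ = ENNReal.ofReal (2 * (Fintype.card A * Fintype.card B)) := by
          rw [← mul_assoc, ENNReal.ofReal_mul (by positivity) (q := (Fintype.card B : ℝ)),
            ENNReal.ofReal_natCast]

end Average

/-! ### Rate bounds for a receiver with side information -/

section Rate

variable {n : ℕ}

/-- Law of the second component of a pair with first component of density `r` and conditionally
Gaussian second component. -/
def testLaw (r : (Fin n → ℂ) → ℝ) (w : ℝ) (α : ℂ) (μ : Fin n → ℂ) : Measure (Fin n → ℂ) :=
  ((volume.prod volume).withDensity fun p : (Fin n → ℂ) × (Fin n → ℂ) =>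
    ENNReal.ofReal (r p.1) * ENNReal.ofReal (vden w (p.2 - (α • p.1 + μ)))).map Prod.snd

lemma lintegral_testLaw {r : (Fin n → ℂ) → ℝ} (hr : IsDensity r) (w : ℝ) (α : ℂ) (μ : Fin n → ℂ)
    {D : (Fin n → ℂ) → ℝ≥0∞} (hD : Measurable D) :
    ∫⁻ y, D y ∂testLaw r w α μ =
      ∫⁻ v, ENNReal.ofReal (r v) * ∫⁻ y, D y * ENNReal.ofReal (vden w (y - (α • v + μ))) := by
  have := hr.measurable
  rw [testLaw, lintegral_map hD measurable_snd, lintegral_withDensity_eq_lintegral_mul _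
    (by fun_prop) (by fun_prop), lintegral_prod _ (by
      refine Measurable.aemeasurable ?_
      fun_prop)]
  refine lintegral_congr fun v => ?_
  rw [← lintegral_const_mul _ (by fun_prop)]
  refine lintegral_congr fun y => ?_
  simp only [Pi.mul_apply]
  ring

lemma testLaw_univ {r : (Fin n → ℂ) → ℝ} (hr : IsDensity r) {w : ℝ} (hw : 0 < w) (α : ℂ)
    (μ : Fin n → ℂ) : testLaw r w α μ Set.univ = 1 := by
  rw [← lintegral_one, lintegral_testLaw hr w α μ measurable_const]
  simp_rw [one_mul, lintegral_vden hw]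
  simpa using hr.lintegral_eq_one

lemma measurable_lintegral_vden {D : (Fin n → ℂ) → ℝ≥0∞} (hD : Measurable D) (w : ℝ) (α : ℂ)
    (μ : Fin n → ℂ) :
    Measurable fun v => ∫⁻ y, D y * ENNReal.ofReal (vden w (y - (α • v + μ))) := by
  have : Measurable fun p : (Fin n → ℂ) × (Fin n → ℂ) =>
    D p.2 * ENNReal.ofReal (vden w (p.2 - (α • p.1 + μ))) := by fun_prop
  exact this.lintegral_prod_right'

variable {A B : Type*} [Fintype A] [Fintype B] [Nonempty A] [Nonempty B] [MeasurableSpace A]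
  [MeasurableSingletonClass A]

/-- Rate of a user whose receiver also knows the other message and a further Gaussian observation
`τ + Z'`: the conditional entropies are estimated by those of Gaussians. -/
lemma rate_le_of_conditional {σ τ : A → B → Fin n → ℂ} {dec : (Fin n → ℂ) → A}
    (hdec : Measurable dec) {r : B → (Fin n → ℂ) → ℝ} (hr : ∀ b, IsDensity (r b)) {s : ℂ}
    (hs : ‖s‖ < 1) (α : ℂ) (μ : B → Fin n → ℂ) {w : ℝ} (hw : 0 < w)
    (hq : average (fun a b => ∑ t, ‖σ a b t - α * τ a b t - μ b t‖ ^ 2) + n * noiseVar α s ≤ n * w) :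
    (1 - average fun a b => (stdFamily (Fin n)).real {z | dec (σ a b + z) ≠ a}) *
        Real.log (Fintype.card A) - Real.log 2 ≤
      -(average fun a b => ∫ z, Real.log (r b (τ a b + z)) ∂stdFamily (Fin n)) -
        n * (Real.log Real.pi + 1) + n * (Real.log w - Real.log (1 - ‖s‖ ^ 2)) := by
  have hv := one_sub_norm_sq_pos hs
  set v := 1 - ‖s‖ ^ 2 with hvdef
  let N := (stdFamily (Fin n)).prod (stdFamily (Fin n))
  have hrm := fun b => (hr b).measurable
  let V : A → B → (Fin n → ℂ) × (Fin n → ℂ) → Fin n → ℂ := fun a b z => τ a b + z.1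
  let c : A → B → (Fin n → ℂ) → Fin n → ℂ := fun a b z' => σ a b + s • z'
  -- The output noise `s z₁ + √v z₂` is standard and has correlation `s` with the genie's noise
  -- `z₁`. The decoder sees only `Y`, so the correlation does not change the error probability.
  let Y : A → B → (Fin n → ℂ) × (Fin n → ℂ) → Fin n → ℂ := fun a b z t =>
    c a b z.1 t + ((Real.sqrt v : ℝ) : ℂ) * z.2 t
  have hYm : ∀ a b, Measurable (Y a b) := fun a b => by
    simp only [Y, c, Pi.add_apply, Pi.smul_apply]; fun_prop
  have hVm : ∀ a b, Measurable (V a b) := fun a b => by simp only [V]; fun_prop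
  have hcm : ∀ a b, Measurable (c a b) := fun a b => by simp only [c]; fun_prop
  -- A test density of `(V, Y)` that knows only `b`, namely `r b` followed by a Gaussian of mean `α
  -- V + μ b` and variance `w`, over the true density given both messages.
  let ρ : A → B → (Fin n → ℂ) × (Fin n → ℂ) → ℝ := fun a b z =>
    r b (V a b z) / vden 1 (V a b z - τ a b) *
      (vden w (Y a b z - (α • V a b z + μ b)) / vden v (Y a b z - c a b z.1))
  have hρpos : ∀ a b z, 0 < ρ a b z := fun a b z =>
    mul_pos (div_pos ((hr b).pos _) (vden_pos one_pos _)) (div_pos (vden_pos hw _) (vden_pos hv _))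
  have hρm : ∀ a b, Measurable (ρ a b) := fun a b => by
    have := hYm a b; have := hVm a b; have := hcm a b; have := hrm b
    simp only [ρ]; fun_prop
  -- the logarithm of the likelihood ratio
  have e1 : ∀ a b z, V a b z - τ a b = fun t => 0 + (1 * z.1 t + 0 * z.2 t) := by
    intro a b z; funext t; simp [V]
  have e2 : ∀ a b z, Y a b z - c a b z.1 =
      fun t => 0 + (0 * z.1 t + ((Real.sqrt v : ℝ) : ℂ) * z.2 t) := by
    intro a b z; funext t; simp [Y]
  have e3 : ∀ a b z, Y a b z - (α • V a b z + μ b) = fun t => (σ a b t - α * τ a b t - μ b t) +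
      ((s - α) * z.1 t + ((Real.sqrt v : ℝ) : ℂ) * z.2 t) := by
    intro a b z; funext t
    simp only [Y, V, c, Pi.sub_apply, Pi.add_apply, Pi.smul_apply, smul_eq_mul]
    ring
  have hlogρ : ∀ a b z, Real.log (ρ a b z) = Real.log (r b (τ a b + z.1)) -
      Real.log (vden 1 fun t => (0 : ℂ) + (1 * z.1 t + 0 * z.2 t)) +
      (Real.log (vden w fun t => (σ a b t - α * τ a b t - μ b t) +
        ((s - α) * z.1 t + ((Real.sqrt v : ℝ) : ℂ) * z.2 t)) -
      Real.log (vden v fun t => (0 : ℂ) + (0 * z.1 t + ((Real.sqrt v : ℝ) : ℂ) * z.2 t))) := by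
    intro a b z
    simp only [ρ]
    rw [Real.log_mul (div_pos ((hr b).pos _) (vden_pos one_pos _)).ne'
      (div_pos (vden_pos hw _) (vden_pos hv _)).ne', Real.log_div ((hr b).pos _).ne'
      (vden_pos one_pos _).ne', Real.log_div (vden_pos hw _).ne' (vden_pos hv _).ne', e1, e2, e3]
  have hsq : ‖((Real.sqrt v : ℝ) : ℂ)‖ ^ 2 = v := by
    rw [Complex.norm_real, Real.norm_eq_abs, sq_abs, Real.sq_sqrt hv.le]
  have hint : ∀ a b, Integrable (fun z => Real.log (ρ a b z)) N ∧ ∫ z, Real.log (ρ a b z) ∂N =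
      (∫ z, Real.log (r b (τ a b + z)) ∂stdFamily (Fin n)) + (n * (Real.log Real.pi + 2) +
        n * (Real.log v - Real.log w)) -
        w⁻¹ * (∑ t, ‖σ a b t - α * τ a b t - μ b t‖ ^ 2 + n * noiseVar α s) := by
    intro a b
    have i0 : Integrable (fun z : (Fin n → ℂ) × (Fin n → ℂ) => Real.log (r b (τ a b + z.1))) N :=
      ((hr b).integrable_log (τ a b)).comp_fst _
    obtain ⟨i1, j1⟩ := integral_log_vden (n := n) one_pos 0 1 0
    obtain ⟨i2, j2⟩ := integral_log_vden (n := n) hw (fun t => σ a b t - α * τ a b t - μ b t) (s - α)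
      ((Real.sqrt v : ℝ) : ℂ)
    obtain ⟨i3, j3⟩ := integral_log_vden (n := n) hv 0 0 ((Real.sqrt v : ℝ) : ℂ)
    simp only [Pi.zero_apply] at i1 j1 i3 j3
    simp_rw [hlogρ]
    refine ⟨(i0.sub i1).add (i2.sub i3), ?_⟩
    have i01 := i0.sub i1
    have i23 := i2.sub i3
    simp only [Pi.sub_def] at i01 i23
    rw [integral_add i01 i23, integral_sub i0 i1, integral_sub i2 i3, j1, j2, j3,
      integral_fun_fst (fun z => Real.log (r b (τ a b + z))), hsq, Real.log_mul Real.pi_ne_zero hw.ne',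
      Real.log_mul Real.pi_ne_zero hv.ne']
    unfold noiseVar
    rw [norm_sub_rev s α, ← hvdef]
    generalize ∑ t, ‖σ a b t - α * τ a b t - μ b t‖ ^ 2 = T
    simp
    field_simp
    ring
  have hfano := fano (N := N) hYm hdec hρpos hρm (fun a b => (hint a b).1)
    (Q := ∑ b, testLaw (r b) w α (μ b)) ?_ ?_
  · have herr : ∀ a b, N.real {z | dec (Y a b z) ≠ a} =
        (stdFamily (Fin n)).real {z | dec (σ a b + z) ≠ a} := by
      intro a b
      have hset : MeasurableSet {z : Fin n → ℂ | dec (σ a b + z) ≠ a} :=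
        (hdec.comp (by fun_prop)) (measurableSet_singleton a).compl
      have hm := map_stdFamily_prod (n := n) (r := Real.sqrt v) (s := s)
        (by rw [Real.sq_sqrt hv.le, hvdef]; ring)
      conv_rhs => rw [← hm]
      rw [map_measureReal_apply (by fun_prop) hset]
      congr 1
      ext z
      simp only [Set.mem_ofPred_eq, Set.mem_preimage]
      have : Y a b z = σ a b + fun t => ((Real.sqrt v : ℝ) : ℂ) * z.2 t + s * z.1 t := by
        funext t; simp [Y, c]; ring
      rw [this]
    simp_rw [herr, (hint _ _).2] at hfano
    rw [average_sub, average_add, average_const_fun, average_const_mul, average_add,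
      average_const_fun] at hfano
    -- The power hypothesis on `w` says exactly that the quadratic part of the cross entropy is at
    -- most `n`, as for a Gaussian of variance `w`.
    have h1 : w⁻¹ * (average (fun a b => ∑ t, ‖σ a b t - α * τ a b t - μ b t‖ ^ 2) +
        n * noiseVar α s) ≤ n := by
      rw [inv_mul_le_iff₀ hw]
      linarith
    linarith
  · rw [Measure.finsetSum_apply]
    simp_rw [testLaw_univ (hr _) hw]
    simp
  · intro a D hD
    rw [lintegral_finsetSum_measure]
    refine Finset.sum_le_sum fun b _ => le_of_eq ?_
    have hK := measurable_lintegral_vden hD w α (μ b)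
    have := hrm b
    have := hYm a b; have := hVm a b
    rw [lintegral_testLaw (hr b) w α (μ b) hD, lintegral_prod _ (by fun_prop)]
    -- Integration against the noises cancels the true densities in the denominator. What remains is
    -- the test law, which does not depend on the message `a`.
    have inner : ∀ z', ∫⁻ z, D (Y a b (z', z)) * ENNReal.ofReal (ρ a b (z', z)) ∂stdFamily (Fin n) =
        ENNReal.ofReal (r b (τ a b + z') / vden 1 (τ a b + z' - τ a b)) *
          ∫⁻ y, D y * ENNReal.ofReal (vden w (y - (α • (τ a b + z') + μ b))) := by
      intro z'
      have h1 := lintegral_add_sqrt_mul hv (c a b z') (F := fun y => D y * ENNReal.ofReal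
        (r b (τ a b + z') / vden 1 (τ a b + z' - τ a b) *
          (vden w (y - (α • (τ a b + z') + μ b)) / vden v (y - c a b z')))) (by fun_prop)
      refine h1.trans ?_
      rw [← lintegral_const_mul _ (by fun_prop)]
      refine lintegral_congr fun y => ?_
      have hp := vden_pos hv (y - c a b z')
      rw [ENNReal.ofReal_mul (div_pos ((hr b).pos _) (vden_pos one_pos _)).le, mul_assoc, mul_assoc,
        ← ENNReal.ofReal_mul (div_pos (vden_pos hw _) hp).le, div_mul_cancel₀ _ hp.ne']
      ring
    simp_rw [inner]
    rw [lintegral_add_noise (τ a b) (F := fun x => ENNReal.ofReal (r b x / vden 1 (x - τ a b)) *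
      ∫⁻ y, D y * ENNReal.ofReal (vden w (y - (α • x + μ b)))) (by fun_prop)]
    refine lintegral_congr fun x => ?_
    have hp := vden_pos one_pos (x - τ a b)
    rw [mul_right_comm, ← ENNReal.ofReal_mul (div_pos ((hr b).pos _) hp).le, div_mul_cancel₀ _ hp.ne']

/-- Rate of a user whose receiver also has a further Gaussian observation `τ + Z'` of its signal: the
entropy of the output given the own message remains. -/
lemma rate_le_of_mixture {σ : A → B → Fin n → ℂ} {τ : A → Fin n → ℂ} {dec : (Fin n → ℂ) → A}
    (hdec : Measurable dec) {r : (Fin n → ℂ) → ℝ} (hr : IsDensity r) (α : ℂ) (μ : Fin n → ℂ)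
    {w : ℝ} (hw : 0 < w) (hq : average (fun a b => ∑ t, ‖σ a b t - α * τ a t - μ t‖ ^ 2) +
      n * (1 + ‖α‖ ^ 2) ≤ n * w) :
    (1 - average fun a b => (stdFamily (Fin n)).real {z | dec (σ a b + z) ≠ a}) *
        Real.log (Fintype.card A) - Real.log 2 ≤
      (average fun a b => ∫ z, Real.log (mixDen (σ a) (σ a b + z)) ∂stdFamily (Fin n)) -
      (average fun (a : A) (_ : B) => ∫ z, Real.log (r (τ a + z)) ∂stdFamily (Fin n)) +
        n * Real.log w := by
  let N := (stdFamily (Fin n)).prod (stdFamily (Fin n))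
  have hrm := hr.measurable
  have hp := fun a => isDensity_mixDen (σ a)
  let V : A → (Fin n → ℂ) × (Fin n → ℂ) → Fin n → ℂ := fun a z => τ a + z.1
  let Y : A → B → (Fin n → ℂ) × (Fin n → ℂ) → Fin n → ℂ := fun a b z => σ a b + z.2
  have hYm : ∀ a b, Measurable (Y a b) := fun a b => by simp only [Y]; fun_prop
  have hVm : ∀ a, Measurable (V a) := fun a => by simp only [V]; fun_prop
  -- The denominator is the true density of `(V, Y)` given `a` alone: the two noises are independent
  -- and the output is mixed over `b`. The mixture is kept as the entropy of the output given the
  -- own message.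
  let ρ : A → B → (Fin n → ℂ) × (Fin n → ℂ) → ℝ := fun a b z =>
    r (V a z) / vden 1 (V a z - τ a) *
      (vden w (Y a b z - (α • V a z + μ)) / mixDen (σ a) (Y a b z))
  have hρpos : ∀ a b z, 0 < ρ a b z := fun a b z =>
    mul_pos (div_pos (hr.pos _) (vden_pos one_pos _)) (div_pos (vden_pos hw _) ((hp a).pos _))
  have hρm : ∀ a b, Measurable (ρ a b) := fun a b => by
    have := hYm a b; have := hVm a; have := (hp a).measurable
    simp only [ρ]; fun_prop
  have e1 : ∀ a z, V a z - τ a = fun t => 0 + (1 * z.1 t + 0 * z.2 t) := by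
    intro a z; funext t; simp [V]
  have e3 : ∀ a b z, Y a b z - (α • V a z + μ) = fun t => (σ a b t - α * τ a t - μ t) +
      (-α * z.1 t + 1 * z.2 t) := by
    intro a b z; funext t
    simp only [Y, V, Pi.sub_apply, Pi.add_apply, Pi.smul_apply, smul_eq_mul]
    ring
  have hlogρ : ∀ a b z, Real.log (ρ a b z) = Real.log (r (τ a + z.1)) -
      Real.log (vden 1 fun t => (0 : ℂ) + (1 * z.1 t + 0 * z.2 t)) +
      (Real.log (vden w fun t => (σ a b t - α * τ a t - μ t) + (-α * z.1 t + 1 * z.2 t)) -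
      Real.log (mixDen (σ a) (σ a b + z.2))) := by
    intro a b z
    simp only [ρ]
    rw [Real.log_mul (div_pos (hr.pos _) (vden_pos one_pos _)).ne'
      (div_pos (vden_pos hw _) ((hp a).pos _)).ne', Real.log_div (hr.pos _).ne'
      (vden_pos one_pos _).ne', Real.log_div (vden_pos hw _).ne' ((hp a).pos _).ne', e1, e3]
  have hint : ∀ a b, Integrable (fun z => Real.log (ρ a b z)) N ∧ ∫ z, Real.log (ρ a b z) ∂N =
      (∫ z, Real.log (r (τ a + z)) ∂stdFamily (Fin n)) -
      (∫ z, Real.log (mixDen (σ a) (σ a b + z)) ∂stdFamily (Fin n)) + (n - n * Real.log w) -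
        w⁻¹ * (∑ t, ‖σ a b t - α * τ a t - μ t‖ ^ 2 + n * (1 + ‖α‖ ^ 2)) := by
    intro a b
    have i0 : Integrable (fun z : (Fin n → ℂ) × (Fin n → ℂ) => Real.log (r (τ a + z.1))) N :=
      (hr.integrable_log (τ a)).comp_fst _
    have i3 : Integrable (fun z : (Fin n → ℂ) × (Fin n → ℂ) =>
        Real.log (mixDen (σ a) (σ a b + z.2))) N := ((hp a).integrable_log (σ a b)).comp_snd _
    obtain ⟨i1, j1⟩ := integral_log_vden (n := n) one_pos 0 1 0
    obtain ⟨i2, j2⟩ := integral_log_vden (n := n) hw (fun t => σ a b t - α * τ a t - μ t) (-α) 1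
    simp only [Pi.zero_apply] at i1 j1
    simp_rw [hlogρ]
    refine ⟨(i0.sub i1).add (i2.sub i3), ?_⟩
    have i01 := i0.sub i1
    have i23 := i2.sub i3
    simp only [Pi.sub_def] at i01 i23
    rw [integral_add i01 i23, integral_sub i0 i1, integral_sub i2 i3, j1, j2,
      integral_fun_fst (fun z => Real.log (r (τ a + z))),
      integral_fun_snd (fun z => Real.log (mixDen (σ a) (σ a b + z))),
      Real.log_mul Real.pi_ne_zero hw.ne']
    generalize ∑ t, ‖σ a b t - α * τ a t - μ t‖ ^ 2 = T
    simp
    field_simp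
    ring
  have hfano := fano (N := N) hYm hdec hρpos hρm (fun a b => (hint a b).1)
    (Q := (Fintype.card B : ℝ≥0∞) • testLaw r w α μ) ?_ ?_
  · have herr : ∀ a b, N.real {z | dec (Y a b z) ≠ a} =
        (stdFamily (Fin n)).real {z | dec (σ a b + z) ≠ a} := by
      intro a b
      have hset : MeasurableSet {z : Fin n → ℂ | dec (σ a b + z) ≠ a} :=
        (hdec.comp (by fun_prop)) (measurableSet_singleton a).compl
      conv_rhs => rw [← map_snd_snd (a := stdFamily (Fin n)) (b := stdFamily (Fin n))]
      rw [map_measureReal_apply (by fun_prop) hset]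
      rfl
    simp_rw [herr, (hint _ _).2] at hfano
    rw [average_sub, average_add, average_sub, average_const_fun, average_const_mul, average_add,
      average_const_fun] at hfano
    have h1 : w⁻¹ * (average (fun a b => ∑ t, ‖σ a b t - α * τ a t - μ t‖ ^ 2) +
        n * (1 + ‖α‖ ^ 2)) ≤ n := by
      rw [inv_mul_le_iff₀ hw]
      linarith
    linarith
  · rw [Measure.smul_apply, testLaw_univ hr hw]
    simp
  · intro a D hD
    refine le_of_eq ?_
    have hK := measurable_lintegral_vden hD w α μ
    have hpm := (hp a).measurable
    have hB : 0 < (Fintype.card B : ℝ) := by exact_mod_cast Fintype.card_pos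
    have inner : ∀ b z', ∫⁻ z, D (Y a b (z', z)) * ENNReal.ofReal (ρ a b (z', z))
          ∂stdFamily (Fin n) =
        ∫⁻ y, ENNReal.ofReal (r (τ a + z') / vden 1 (τ a + z' - τ a)) * (D y *
          ENNReal.ofReal (vden w (y - (α • (τ a + z') + μ)) / mixDen (σ a) y)) *
            ENNReal.ofReal (vden 1 (y - σ a b)) := by
      intro b z'
      rw [← lintegral_add_noise (σ a b) (by fun_prop)]
      refine lintegral_congr fun z => ?_
      simp only [ρ]
      rw [ENNReal.ofReal_mul (div_pos (hr.pos _) (vden_pos one_pos _)).le]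
      simp only [V, Y]
      ring
    have outer : ∀ b, ∫⁻ z, D (Y a b z) * ENNReal.ofReal (ρ a b z) ∂N =
        ∫⁻ z', ∫⁻ z, D (Y a b (z', z)) * ENNReal.ofReal (ρ a b (z', z))
          ∂stdFamily (Fin n) ∂stdFamily (Fin n) := by
      intro b
      have := hYm a b
      have := hρm a b
      exact lintegral_prod _ (by fun_prop)
    -- The mixture in the denominator cancels only after summation over `b`, which is why `fano`
    -- asks for the sum.
    have hmix : ∀ y, ∑ b, ENNReal.ofReal (vden 1 (y - σ a b)) =
        Fintype.card B * ENNReal.ofReal (mixDen (σ a) y) := by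
      intro y
      rw [← ENNReal.ofReal_sum_of_nonneg fun b _ => (vden_pos one_pos _).le, mixDen,
        ← ENNReal.ofReal_natCast, ← ENNReal.ofReal_mul hB.le, mul_div_cancel₀ _ hB.ne']
    simp_rw [outer, inner]
    rw [← lintegral_finsetSum _ fun b _ => by
      have : Measurable fun p : (Fin n → ℂ) × (Fin n → ℂ) =>
        ENNReal.ofReal (r (τ a + p.1) / vden 1 (τ a + p.1 - τ a)) * (D p.2 *
          ENNReal.ofReal (vden w (p.2 - (α • (τ a + p.1) + μ)) / mixDen (σ a) p.2)) *
            ENNReal.ofReal (vden 1 (p.2 - σ a b)) := by fun_prop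
      exact this.lintegral_prod_right']
    have step : ∀ z', ∑ b, ∫⁻ y, ENNReal.ofReal (r (τ a + z') / vden 1 (τ a + z' - τ a)) * (D y *
          ENNReal.ofReal (vden w (y - (α • (τ a + z') + μ)) / mixDen (σ a) y)) *
            ENNReal.ofReal (vden 1 (y - σ a b)) =
        Fintype.card B * (ENNReal.ofReal (r (τ a + z') / vden 1 (τ a + z' - τ a)) *
          ∫⁻ y, D y * ENNReal.ofReal (vden w (y - (α • (τ a + z') + μ)))) := by
      intro z'
      rw [← lintegral_finsetSum _ fun b _ => by fun_prop, ← lintegral_const_mul _ (by fun_prop),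
        ← lintegral_const_mul _ (by fun_prop)]
      refine lintegral_congr fun y => ?_
      rw [← Finset.mul_sum, hmix]
      have hpy := (hp a).pos y
      have : ENNReal.ofReal (vden w (y - (α • (τ a + z') + μ)) / mixDen (σ a) y) *
          ENNReal.ofReal (mixDen (σ a) y) =
          ENNReal.ofReal (vden w (y - (α • (τ a + z') + μ))) := by
        rw [← ENNReal.ofReal_mul (div_pos (vden_pos hw _) hpy).le, div_mul_cancel₀ _ hpy.ne']
      rw [← this]
      ring
    simp_rw [step]
    rw [lintegral_smul_measure, lintegral_testLaw hr w α μ hD, lintegral_const_mul _ (by fun_prop),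
      smul_eq_mul]
    congr 1
    rw [lintegral_add_noise (τ a) (F := fun x => ENNReal.ofReal (r x / vden 1 (x - τ a)) *
      ∫⁻ y, D y * ENNReal.ofReal (vden w (y - (α • x + μ)))) (by fun_prop)]
    refine lintegral_congr fun x => ?_
    have hpx := vden_pos one_pos (x - τ a)
    rw [mul_right_comm, ← ENNReal.ofReal_mul (div_pos (hr.pos _) hpx).le, div_mul_cancel₀ _ hpx.ne']

end Rate

/-! ### The multi-letter terms -/

section MultiLetter

variable {n : ℕ}

/-- Cross entropy of a Gaussian relative to a Gaussian density. -/
lemma integral_log_vden_add {w : ℝ} (hw : 0 < w) (m : Fin n → ℂ) :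
    Integrable (fun z => Real.log (vden w (m + z))) (stdFamily (Fin n)) ∧
    ∫ z, Real.log (vden w (m + z)) ∂stdFamily (Fin n) =
      -(n * Real.log (Real.pi * w)) - (∑ t, ‖m t‖ ^ 2 + n) / w := by
  obtain ⟨h1, h2⟩ := integral_log_vden hw m 1 0
  have e : ∀ z : (Fin n → ℂ) × (Fin n → ℂ), (fun t => m t + (1 * z.1 t + 0 * z.2 t)) = m + z.1 := by
    intro z; funext t; simp
  simp_rw [e] at h1 h2
  have h3 : Integrable (fun z => Real.log (vden w (m + z))) (stdFamily (Fin n)) :=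
    h1.of_comp_fst (IsProbabilityMeasure.ne_zero _)
  refine ⟨h3, ?_⟩
  rw [integral_fun_fst (fun z => Real.log (vden w (m + z)))] at h2
  simpa using h2

lemma integral_log_vden_one : ∫ z, Real.log (vden 1 z) ∂stdFamily (Fin n) =
    -(n * (Real.log Real.pi + 1)) := by
  have := (integral_log_vden_add (n := n) one_pos 0).2
  simp only [zero_add, mul_one, Pi.zero_apply, norm_zero] at this
  rw [this]
  simp
  ring

/-- With `Y = s + z₂` and `V = t + z₁`, this compares the reverse test channel `V ∼ CN (Y - k, w)`
and the density `p` of `Y` with the true noise of `Y` and the density `r` of `V`. The residual `V -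
Y + k` contains both noises, hence the term `n * 2`. -/
lemma integral_log_ratio (s t k : Fin n → ℂ) {p r : (Fin n → ℂ) → ℝ} (hp : IsDensity p)
    (hr : IsDensity r) {w : ℝ} (hw : 0 < w) :
    Integrable (fun z : (Fin n → ℂ) × (Fin n → ℂ) => Real.log
        ((p (s + z.2) / vden 1 (s + z.2 - s)) * (vden w (t + z.1 - (s + z.2 - k)) / r (t + z.1))))
      ((stdFamily (Fin n)).prod (stdFamily (Fin n))) ∧
    ∫ z : (Fin n → ℂ) × (Fin n → ℂ), Real.log
        ((p (s + z.2) / vden 1 (s + z.2 - s)) * (vden w (t + z.1 - (s + z.2 - k)) / r (t + z.1)))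
        ∂(stdFamily (Fin n)).prod (stdFamily (Fin n)) =
      (∫ z, Real.log (p (s + z)) ∂stdFamily (Fin n)) -
      (∫ z, Real.log (r (t + z)) ∂stdFamily (Fin n)) + (n - n * Real.log w) -
        w⁻¹ * (∑ i, ‖t i - s i + k i‖ ^ 2 + n * 2) := by
  have e3 : ∀ z : (Fin n → ℂ) × (Fin n → ℂ), t + z.1 - (s + z.2 - k) = fun i =>
      (t i - s i + k i) + (1 * z.1 i + -1 * z.2 i) := by
    intro z; funext i
    simp only [Pi.sub_apply, Pi.add_apply]
    ring
  have hlog : ∀ z : (Fin n → ℂ) × (Fin n → ℂ), Real.log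
      ((p (s + z.2) / vden 1 (s + z.2 - s)) * (vden w (t + z.1 - (s + z.2 - k)) / r (t + z.1))) =
      Real.log (p (s + z.2)) - Real.log (vden 1 z.2) +
      (Real.log (vden w fun i => (t i - s i + k i) + (1 * z.1 i + -1 * z.2 i)) -
        Real.log (r (t + z.1))) := by
    intro z
    rw [Real.log_mul (div_pos (hp.pos _) (vden_pos one_pos _)).ne'
      (div_pos (vden_pos hw _) (hr.pos _)).ne', Real.log_div (hp.pos _).ne'
      (vden_pos one_pos _).ne', Real.log_div (vden_pos hw _).ne' (hr.pos _).ne', e3,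
      add_sub_cancel_left]
  have i0 : Integrable (fun z : (Fin n → ℂ) × (Fin n → ℂ) => Real.log (p (s + z.2)))
      ((stdFamily (Fin n)).prod (stdFamily (Fin n))) := (hp.integrable_log s).comp_snd _
  have i1 : Integrable (fun z : (Fin n → ℂ) × (Fin n → ℂ) => Real.log (vden 1 z.2))
      ((stdFamily (Fin n)).prod (stdFamily (Fin n))) := by
    have := (isDensity_vden (n := n)).integrable_log 0
    simp only [zero_add] at this
    exact this.comp_snd _
  have i3 : Integrable (fun z : (Fin n → ℂ) × (Fin n → ℂ) => Real.log (r (t + z.1)))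
      ((stdFamily (Fin n)).prod (stdFamily (Fin n))) := (hr.integrable_log t).comp_fst _
  obtain ⟨i2, j2⟩ := integral_log_vden (n := n) hw (fun i => t i - s i + k i) 1 (-1)
  simp_rw [hlog]
  refine ⟨(i0.sub i1).add (i2.sub i3), ?_⟩
  have i01 := i0.sub i1
  have i23 := i2.sub i3
  simp only [Pi.sub_def] at i01 i23
  rw [integral_add i01 i23, integral_sub i0 i1, integral_sub i2 i3, j2,
    integral_fun_snd (fun z => Real.log (p (s + z))),
    integral_fun_snd (fun z : Fin n → ℂ => Real.log (vden 1 z)), integral_log_vden_one,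
    integral_fun_fst (fun z => Real.log (r (t + z))), Real.log_mul Real.pi_ne_zero hw.ne']
  generalize ∑ i, ‖t i - s i + k i‖ ^ 2 = T
  simp
  field_simp
  ring

variable {A B : Type*} [Fintype A] [Fintype B]

lemma sum_vden_eq (τ : A → Fin n → ℂ) [Nonempty A] (y : Fin n → ℂ) :
    ∑ a, ENNReal.ofReal (vden 1 (y - τ a)) = Fintype.card A * ENNReal.ofReal (mixDen τ y) := by
  have hA : 0 < (Fintype.card A : ℝ) := by exact_mod_cast Fintype.card_pos
  rw [← ENNReal.ofReal_sum_of_nonneg fun b _ => (vden_pos one_pos _).le, mixDen,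
    ← ENNReal.ofReal_natCast, ← ENNReal.ofReal_mul hA.le, mul_div_cancel₀ _ hA.ne']

/-- The noise of `Y` cancels `vden 1`. Summed over `a`, the densities of `V` form the mixture
`mixDen τ`, which cancels the other denominator and leaves the total mass of the test law of `V`,
once for each message. -/
lemma sum_lintegral_ratio [Nonempty A] (s τ : A → Fin n → ℂ) (k : Fin n → ℂ) {p : (Fin n → ℂ) → ℝ}
    (hp : IsDensity p) {w : ℝ} (hw : 0 < w) :
    ∑ a, ∫⁻ z : (Fin n → ℂ) × (Fin n → ℂ), ENNReal.ofReal
        ((p (s a + z.2) / vden 1 (s a + z.2 - s a)) *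
          (vden w (τ a + z.1 - (s a + z.2 - k)) / mixDen τ (τ a + z.1)))
        ∂(stdFamily (Fin n)).prod (stdFamily (Fin n)) = Fintype.card A := by
  have hm := hp.measurable
  have hr := isDensity_mixDen τ
  have hrm := hr.measurable
  let H : (Fin n → ℂ) → ℝ≥0∞ := fun v => ∫⁻ y,
    ENNReal.ofReal (p y) * ENNReal.ofReal (vden w (v - (y - k)))
  have hHj : Measurable fun q : (Fin n → ℂ) × (Fin n → ℂ) =>
      ENNReal.ofReal (p q.2) * ENNReal.ofReal (vden w (q.1 - (q.2 - k))) := by fun_prop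
  have hHm : Measurable H := hHj.lintegral_prod_right'
  have hH1 : ∫⁻ v, H v = 1 := by
    rw [lintegral_lintegral_swap hHj.aemeasurable, ← hp.lintegral_eq_one]
    refine lintegral_congr fun y => ?_
    rw [lintegral_const_mul _ (by fun_prop), lintegral_vden hw, mul_one]
  have step : ∀ a, ∫⁻ z : (Fin n → ℂ) × (Fin n → ℂ), ENNReal.ofReal
        ((p (s a + z.2) / vden 1 (s a + z.2 - s a)) *
          (vden w (τ a + z.1 - (s a + z.2 - k)) / mixDen τ (τ a + z.1)))
        ∂(stdFamily (Fin n)).prod (stdFamily (Fin n)) =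
      ∫⁻ v, ENNReal.ofReal (mixDen τ v)⁻¹ * H v * ENNReal.ofReal (vden 1 (v - τ a)) := by
    intro a
    refine (lintegral_prod _ (by fun_prop)).trans ?_
    rw [← lintegral_add_noise (τ a) (F := fun v => ENNReal.ofReal (mixDen τ v)⁻¹ * H v)
      (by fun_prop)]
    refine lintegral_congr fun z' => ?_
    have h1 := lintegral_add_noise (s a) (F := fun y => ENNReal.ofReal
      ((p y / vden 1 (y - s a)) * (vden w (τ a + z' - (y - k)) / mixDen τ (τ a + z'))))
      (by fun_prop)
    refine h1.trans ?_
    simp only [H]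
    rw [← lintegral_const_mul _ (by fun_prop)]
    refine lintegral_congr fun y => ?_
    have hv := vden_pos one_pos (y - s a)
    have hpy := hp.pos y
    have hrv := hr.pos (τ a + z')
    have hvw := vden_pos hw (τ a + z' - (y - k))
    rw [← ENNReal.ofReal_mul (by positivity), ← ENNReal.ofReal_mul (by positivity),
      ← ENNReal.ofReal_mul (by positivity)]
    congr 1
    field_simp
  simp_rw [step]
  rw [← lintegral_finsetSum _ fun a _ => by fun_prop]
  simp_rw [← Finset.mul_sum, sum_vden_eq]
  have e2 : ∀ v, ENNReal.ofReal (mixDen τ v)⁻¹ * H v *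
      (Fintype.card A * ENNReal.ofReal (mixDen τ v)) = Fintype.card A * H v := by
    intro v
    have : ENNReal.ofReal (mixDen τ v)⁻¹ * ENNReal.ofReal (mixDen τ v) = 1 := by
      rw [← ENNReal.ofReal_mul (inv_pos.mpr (hr.pos v)).le, inv_mul_cancel₀ (hr.pos v).ne',
        ENNReal.ofReal_one]
    calc _ = Fintype.card A * H v *
          (ENNReal.ofReal (mixDen τ v)⁻¹ * ENNReal.ofReal (mixDen τ v)) := by ring
      _ = _ := by rw [this, mul_one]
  simp_rw [e2]
  rw [lintegral_const_mul _ hHm, hH1, mul_one]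

variable [Nonempty A] [Nonempty B]

/-- Conditioning on both messages reduces the entropy to that of the noise. -/
lemma average_log_mixDen_le (σ : A → B → Fin n → ℂ) :
    (average fun a b => ∫ z, Real.log (mixDen (fun a => σ a b) (σ a b + z)) ∂stdFamily (Fin n)) ≤
      -(n * (Real.log Real.pi + 1)) := by
  have hp := fun b => isDensity_mixDen fun a => σ a b
  have i1 := fun a b => (hp b).integrable_log (σ a b)
  have i2 : Integrable (fun z : Fin n → ℂ => Real.log (vden 1 z)) (stdFamily (Fin n)) := by
    simpa using (isDensity_vden (n := n)).integrable_log 0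
  have hlog : ∀ a b (z : Fin n → ℂ), Real.log (mixDen (fun a => σ a b) (σ a b + z) /
      vden 1 (σ a b + z - σ a b)) = Real.log (mixDen (fun a => σ a b) (σ a b + z)) -
        Real.log (vden 1 z) := by
    intro a b z
    rw [add_sub_cancel_left, Real.log_div ((hp b).pos _).ne' (vden_pos one_pos _).ne']
  have hm := fun b => (hp b).measurable
  have key := average_integral_log_le (N := stdFamily (Fin n))
    (f := fun a b z => mixDen (fun a => σ a b) (σ a b + z) / vden 1 (σ a b + z - σ a b))
    (fun a b z => div_pos ((hp b).pos _) (vden_pos one_pos _))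
    (fun a b => by have := hm b; fun_prop)
    (fun a b => by simp_rw [hlog]; exact (i1 a b).sub i2) (c := 1) one_pos ?_
  · simp_rw [hlog, integral_sub (i1 _ _) i2, integral_log_vden_one] at key
    rw [average_sub, average_const_fun, Real.log_one] at key
    linarith
  · have e : ∀ a b, ∫⁻ z, ENNReal.ofReal (mixDen (fun a => σ a b) (σ a b + z) /
        vden 1 (σ a b + z - σ a b)) ∂stdFamily (Fin n) = 1 := by
      intro a b
      have := hm b
      rw [lintegral_add_noise (σ a b) (F := fun y => ENNReal.ofReal (mixDen (fun a => σ a b) y /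
        vden 1 (y - σ a b))) (by fun_prop), ← (hp b).lintegral_eq_one]
      refine lintegral_congr fun y => ?_
      have hv := vden_pos one_pos (y - σ a b)
      rw [← ENNReal.ofReal_mul (div_pos ((hp b).pos _) hv).le, div_mul_cancel₀ _ hv.ne']
    simp_rw [e]
    rw [one_mul, ENNReal.ofReal_mul (by positivity), ENNReal.ofReal_natCast, ENNReal.ofReal_natCast]
    simp

/-- The Gaussian maximizes the entropy under a power constraint. -/
lemma neg_average_log_mixDen_le (τ : A → Fin n → ℂ) {h : ℝ} (h0 : 0 ≤ h)
    (hτ : (average fun (a : A) (_ : B) => ∑ t, ‖τ a t‖ ^ 2) ≤ n * h) :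
    -(average fun (a : A) (_ : B) => ∫ z, Real.log (mixDen τ (τ a + z)) ∂stdFamily (Fin n)) ≤
      n * (Real.log Real.pi + 1) + n * Real.log (1 + h) := by
  have hw : 0 < 1 + h := by positivity
  have hp := isDensity_mixDen τ
  have hm := hp.measurable
  have i1 := fun a => hp.integrable_log (τ a)
  have i2 := fun a => integral_log_vden_add hw (τ a)
  have hlog : ∀ a z, Real.log (vden (1 + h) (τ a + z) / mixDen τ (τ a + z)) =
      Real.log (vden (1 + h) (τ a + z)) - Real.log (mixDen τ (τ a + z)) := fun a z =>
    Real.log_div (vden_pos hw _).ne' (hp.pos _).ne'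
  -- The ratio of the Gaussian density to the mixture averages to one under the mixture; Jensen's
  -- inequality with `c = 1` is then the maximum-entropy bound.
  have key := average_integral_log_le (A := A) (B := B) (N := stdFamily (Fin n))
    (f := fun a _ z => vden (1 + h) (τ a + z) / mixDen τ (τ a + z))
    (fun a _ z => div_pos (vden_pos hw _) (hp.pos _)) (fun a _ => by fun_prop)
    (fun a _ => by simp_rw [hlog]; exact (i2 a).1.sub (i1 a)) (c := 1) one_pos ?_
  · have e : ∀ a, ∫ z, Real.log (vden (1 + h) (τ a + z) / mixDen τ (τ a + z)) ∂stdFamily (Fin n) =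
        -(n * Real.log (Real.pi * (1 + h))) - (1 + h)⁻¹ * (∑ t, ‖τ a t‖ ^ 2 + n) -
          ∫ z, Real.log (mixDen τ (τ a + z)) ∂stdFamily (Fin n) := by
      intro a
      simp_rw [hlog]
      rw [integral_sub (i2 a).1 (i1 a), (i2 a).2]
      ring
    simp_rw [e] at key
    rw [average_sub, average_sub, average_const_fun, average_const_mul, average_add,
      average_const_fun, Real.log_one, Real.log_mul Real.pi_ne_zero hw.ne'] at key
    have h1 : (1 + h)⁻¹ * ((average fun (a : A) (_ : B) => ∑ t, ‖τ a t‖ ^ 2) + n) ≤ n := by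
      rw [inv_mul_le_iff₀ hw]
      linarith
    linarith
  · rw [Finset.sum_comm]
    have e : ∀ a, ∫⁻ z, ENNReal.ofReal (vden (1 + h) (τ a + z) / mixDen τ (τ a + z))
        ∂stdFamily (Fin n) = ∫⁻ y, ENNReal.ofReal (vden (1 + h) y / mixDen τ y) *
          ENNReal.ofReal (vden 1 (y - τ a)) := fun a =>
      lintegral_add_noise (τ a) (F := fun y => ENNReal.ofReal (vden (1 + h) y / mixDen τ y))
        (by fun_prop)
    simp_rw [e]
    rw [← lintegral_finsetSum _ fun a _ => by fun_prop]
    simp_rw [← Finset.mul_sum, sum_vden_eq]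
    have e2 : ∀ y, ENNReal.ofReal (vden (1 + h) y / mixDen τ y) *
        (Fintype.card A * ENNReal.ofReal (mixDen τ y)) =
        Fintype.card A * ENNReal.ofReal (vden (1 + h) y) := by
      intro y
      rw [mul_left_comm, ← ENNReal.ofReal_mul (div_pos (vden_pos hw _) (hp.pos y)).le,
        div_mul_cancel₀ _ (hp.pos y).ne']
    simp_rw [e2]
    rw [lintegral_const_mul _ (by fun_prop)]
    have := lintegral_vden hw (0 : Fin n → ℂ)
    simp only [sub_zero] at this
    rw [this, one_mul, ENNReal.ofReal_mul (by positivity), ENNReal.ofReal_natCast,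
      ENNReal.ofReal_natCast]
    simp [mul_comm]

/-- The interference is nearly determined by the output of the other receiver and its message. -/
lemma average_log_mixDen_sub_le (σ : A → B → Fin n → ℂ) (τ : A → Fin n → ℂ) (κ : B → Fin n → ℂ)
    {h : ℝ} (h0 : 0 ≤ h)
    (hq : (average fun a b => ∑ t, ‖τ a t - σ a b t + κ b t‖ ^ 2) ≤ n * h) :
    (average fun a b => ∫ z, Real.log (mixDen (fun a => σ a b) (σ a b + z)) ∂stdFamily (Fin n)) -
      (average fun (a : A) (_ : B) => ∫ z, Real.log (mixDen τ (τ a + z)) ∂stdFamily (Fin n)) ≤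
      n * Real.log (2 + h) := by
  -- Given the other message, the interference is estimated by the output with `κ` subtracted. The
  -- error consists of two independent unit noises and a signal part of power at most `h`.
  have hw : 0 < 2 + h := by positivity
  have hp := fun b => isDensity_mixDen fun a => σ a b
  have hm := fun b => (hp b).measurable
  have hr := isDensity_mixDen τ
  have hrm := hr.measurable
  have hint := fun a b => integral_log_ratio (σ a b) (τ a) (κ b) (hp b) hr hw
  have hmeas : ∀ a b, Measurable fun z : (Fin n → ℂ) × (Fin n → ℂ) =>
      (mixDen (fun a => σ a b) (σ a b + z.2) / vden 1 (σ a b + z.2 - σ a b)) *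
        (vden (2 + h) (τ a + z.1 - (σ a b + z.2 - κ b)) / mixDen τ (τ a + z.1)) := by
    have gen : ∀ (s t k : Fin n → ℂ) {p r : (Fin n → ℂ) → ℝ}, Measurable p → Measurable r →
        Measurable fun z : (Fin n → ℂ) × (Fin n → ℂ) => (p (s + z.2) / vden 1 (s + z.2 - s)) *
          (vden (2 + h) (t + z.1 - (s + z.2 - k)) / r (t + z.1)) := by
      intro s t k p r hp hr
      fun_prop
    exact fun a b => gen (σ a b) (τ a) (κ b) (hm b) hrm
  have hsum := fun b => sum_lintegral_ratio (fun a => σ a b) τ (κ b) (hp b) hw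
  have hpos : ∀ a b (z : (Fin n → ℂ) × (Fin n → ℂ)), 0 <
      (mixDen (fun a => σ a b) (σ a b + z.2) / vden 1 (σ a b + z.2 - σ a b)) *
        (vden (2 + h) (τ a + z.1 - (σ a b + z.2 - κ b)) / mixDen τ (τ a + z.1)) := fun a b _ =>
    mul_pos (div_pos ((hp b).pos _) (vden_pos one_pos _)) (div_pos (vden_pos hw _) (hr.pos _))
  have key := average_integral_log_le hpos hmeas (fun a b => (hint a b).1) one_pos (by
    rw [Finset.sum_comm, Finset.sum_congr rfl fun b _ => hsum b, one_mul,
      ENNReal.ofReal_mul (Nat.cast_nonneg _), ENNReal.ofReal_natCast, ENNReal.ofReal_natCast,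
      Finset.sum_const, Finset.card_univ, nsmul_eq_mul, mul_comm])
  have e : (fun a b => _) = fun a b => _ := funext fun a => funext fun b => (hint a b).2
  rw [e, average_sub, average_add, average_sub, average_const_fun, average_const_mul, average_add,
    average_const_fun, Real.log_one] at key
  have h1 : (2 + h)⁻¹ * ((average fun a b => ∑ t, ‖τ a t - σ a b t + κ b t‖ ^ 2) + n * 2) ≤
      n := by
    rw [inv_mul_le_iff₀ hw]
    linarith
  linarith

/-- The bound on the multi-letter terms. -/
lemma multiLetter_le (σ : A → B → Fin n → ℂ) (τ : A → Fin n → ℂ) (κ : B → Fin n → ℂ)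
    {h h' : ℝ} (h0 : 0 ≤ h) (h0' : 0 ≤ h')
    (hτ : (average fun (a : A) (_ : B) => ∑ t, ‖τ a t‖ ^ 2) ≤ n * h)
    (hq : (average fun a b => ∑ t, ‖τ a t - σ a b t + κ b t‖ ^ 2) ≤ n * h') :
    (average fun a b => ∫ z, Real.log (mixDen (fun a => σ a b) (σ a b + z)) ∂stdFamily (Fin n)) -
      (average fun (a : A) (_ : B) => ∫ z, Real.log (mixDen τ (τ a + z)) ∂stdFamily (Fin n)) ≤
      n * (Real.log (1 + min h h') + Real.log 2) := by
  have hl2 : 0 ≤ Real.log 2 := Real.log_nonneg (by norm_num)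
  -- If `h` is smaller, the entropy of the interference is bounded by its power and that of the
  -- output from below by the noise; `log 2` is slack. Otherwise the interference is estimated from
  -- the output, and `2 + h' ≤ 2 (1 + h')` accounts for `log 2`.
  rcases le_total h h' with hle | hle
  · rw [min_eq_left hle]
    have h1 := average_log_mixDen_le σ
    have h2 := neg_average_log_mixDen_le (B := B) τ h0 hτ
    have h3 : 0 ≤ (n : ℝ) * Real.log 2 := by positivity
    rw [mul_add]
    linarith
  · rw [min_eq_right hle]
    refine (average_log_mixDen_sub_le σ τ κ h0' hq).trans ?_
    rw [← Real.log_mul (by positivity) two_ne_zero]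
    gcongr
    linarith

end MultiLetter

/-! ### The converse for a fixed block length -/

section Block

variable {A B : Type*} [Fintype A] [Fintype B] [Nonempty A] [Nonempty B] {n : ℕ}

/-- Second moments of linear forms in the codewords. -/
lemma exists_average_form_le (hn : 0 < n) (x₁ : A → Fin n → ℂ) (x₂ : B → Fin n → ℂ)
    (x₀ : A → B → Fin n → ℂ) (h₁ : (average fun a (_ : B) => ∑ t, ‖x₁ a t‖ ^ 2) ≤ n)
    (h₂ : (average fun (_ : A) b => ∑ t, ‖x₂ b t‖ ^ 2) ≤ n)
    (h₀ : (average fun a b => ∑ t, ‖x₀ a b t‖ ^ 2) ≤ n) :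
    ∃ p ∈ corrBall, ∃ m : Fin n → ℂ, ∀ v : ℂ × ℂ × ℂ,
      (average fun a b => ∑ t, ‖form v (x₁ a t - m t, x₂ b t, x₀ a b t)‖ ^ 2) ≤
        n * formVar p v := by
  let _ : MeasurableSpace (Fin n × A × B) := ⊤
  have hA : 0 < (Fintype.card A : ℝ) := by exact_mod_cast Fintype.card_pos
  have hB : 0 < (Fintype.card B : ℝ) := by exact_mod_cast Fintype.card_pos
  have hn' : 0 < (n : ℝ) := by exact_mod_cast hn
  have : Nonempty (Fin n) := ⟨⟨0, hn⟩⟩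
  -- The uniform law on time and messages is the single-letter sample space, with time in the role
  -- of `Q`.
  let P : Measure (Fin n × A × B) :=
    ((n * (Fintype.card A * Fintype.card B) : ℕ) : ℝ≥0∞)⁻¹ • Measure.count
  have hP : IsProbabilityMeasure P := by
    refine ⟨?_⟩
    have hc : 0 < n * (Fintype.card A * Fintype.card B) :=
      Nat.mul_pos hn (Nat.mul_pos Fintype.card_pos Fintype.card_pos)
    simp only [P, Measure.smul_apply, smul_eq_mul]
    rw [Measure.count_apply_finite' Set.finite_univ MeasurableSet.univ]
    simp only [Set.Finite.toFinset_univ, Finset.card_univ, Fintype.card_prod, Fintype.card_fin]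
    exact ENNReal.inv_mul_cancel (by exact_mod_cast hc.ne') (ENNReal.natCast_ne_top _)
  have hint : ∀ {E : Type} [NormedAddCommGroup E] [NormedSpace ℝ E] [CompleteSpace E]
      (f : Fin n × A × B → E), ∫ ω, f ω ∂P =
        ((n * (Fintype.card A * Fintype.card B) : ℝ))⁻¹ • ∑ a, ∑ b, ∑ t, f (t, a, b) := by
    intro E _ _ _ f
    simp only [P]
    rw [integral_smul_measure, integral_count]
    congr 1
    · simp
    · rw [Fintype.sum_prod_type, Finset.sum_comm' (t' := Finset.univ) (s' := fun _ => Finset.univ)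
        (by simp), Fintype.sum_prod_type]
  have havg : ∀ F : A → B → Fin n → ℝ, ∫ ω : Fin n × A × B, F ω.2.1 ω.2.2 ω.1 ∂P =
      (n : ℝ)⁻¹ * average fun a b => ∑ t, F a b t := by
    intro F
    rw [hint]
    simp only [average, smul_eq_mul]
    rw [mul_inv]
    ring
  -- Centring the first codebook at each time, over its messages, makes it orthogonal to the second,
  -- because the messages are independent.
  let m : Fin n → ℂ := fun t => (Fintype.card A : ℂ)⁻¹ * ∑ a, x₁ a t
  have hm : ∀ t, ∑ a, (x₁ a t - m t) = 0 := by
    intro t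
    have : (Fintype.card A : ℂ) ≠ 0 := by exact_mod_cast hA.ne'
    simp only [Finset.sum_sub_distrib, Finset.sum_const, Finset.card_univ, nsmul_eq_mul, m]
    rw [mul_inv_cancel_left₀ this, sub_self]
  have hvar : ∀ t, ∑ a, ‖x₁ a t - m t‖ ^ 2 ≤ ∑ a, ‖x₁ a t‖ ^ 2 := by
    intro t
    have e : ∀ a, ‖x₁ a t‖ ^ 2 = ‖x₁ a t - m t‖ ^ 2 + ‖m t‖ ^ 2 +
        2 * ((x₁ a t - m t) * (starRingEnd ℂ) (m t)).re := by
      intro a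
      have h := Complex.normSq_add (x₁ a t - m t) (m t)
      simpa [Complex.normSq_eq_norm_sq] using h
    simp_rw [e, Finset.sum_add_distrib]
    rw [← Finset.mul_sum, ← Complex.re_sum, ← Finset.sum_mul, hm]
    simp
    positivity
  have memLp : ∀ U : Fin n × A × B → ℂ, MemLp U 2 P := fun U => MemLp.of_discrete
  have b₁ : ∫ ω : Fin n × A × B, ‖x₁ ω.2.1 ω.1 - m ω.1‖ ^ 2 ∂P ≤ 1 := by
    rw [havg fun a b t => ‖x₁ a t - m t‖ ^ 2, inv_mul_le_iff₀ hn', mul_one]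
    refine le_trans ?_ h₁
    unfold average
    gcongr ?_ / _
    rw [Finset.sum_comm, Finset.sum_comm (f := fun a (_ : B) => ∑ t, ‖x₁ a t‖ ^ 2)]
    refine Finset.sum_le_sum fun b _ => ?_
    rw [Finset.sum_comm, Finset.sum_comm (f := fun a t => ‖x₁ a t‖ ^ 2)]
    exact Finset.sum_le_sum fun t _ => hvar t
  have b₂ : ∫ ω : Fin n × A × B, ‖x₂ ω.2.2 ω.1‖ ^ 2 ∂P ≤ 1 := by
    rw [havg fun a b t => ‖x₂ b t‖ ^ 2, inv_mul_le_iff₀ hn', mul_one]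
    exact h₂
  have b₀ : ∫ ω : Fin n × A × B, ‖x₀ ω.2.1 ω.2.2 ω.1‖ ^ 2 ∂P ≤ 1 := by
    rw [havg fun a b t => ‖x₀ a b t‖ ^ 2, inv_mul_le_iff₀ hn', mul_one]
    exact h₀
  have horth : ∫ ω : Fin n × A × B, (x₁ ω.2.1 ω.1 - m ω.1) * (starRingEnd ℂ) (x₂ ω.2.2 ω.1) ∂P = 0 := by
    rw [hint, Finset.sum_comm]
    have : ∀ b, ∑ a, ∑ t, (x₁ a t - m t) * (starRingEnd ℂ) (x₂ b t) = 0 := by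
      intro b
      rw [Finset.sum_comm]
      refine Finset.sum_eq_zero fun t _ => ?_
      rw [← Finset.sum_mul, hm, zero_mul]
    simp_rw [this]
    simp
  obtain ⟨p, hp, hb⟩ := exists_formVar_bound (P := P) (U₁ := fun ω => x₁ ω.2.1 ω.1 - m ω.1)
    (U₂ := fun ω => x₂ ω.2.2 ω.1) (U₀ := fun ω => x₀ ω.2.1 ω.2.2 ω.1) (memLp _) (memLp _) (memLp _)
    b₁ b₂ b₀ horth
  refine ⟨p, hp, m, fun v => ?_⟩
  have := hb v
  rw [havg fun a b t => ‖v.1 * (x₁ a t - m t) + v.2.1 * x₂ b t + v.2.2 * x₀ a b t‖ ^ 2,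
    inv_mul_le_iff₀ hn'] at this
  exact this

/-- Average log-likelihood of the output, given the message of the first user. -/
def condLogLik (σ : A → B → Fin n → ℂ) : ℝ :=
  average fun a b => ∫ z, Real.log (mixDen (σ a) (σ a b + z)) ∂stdFamily (Fin n)

/-- Average log-likelihood of a noisy observation of a codeword of the first user. -/
def inputLogLik (B : Type*) [Fintype B] (τ : A → Fin n → ℂ) : ℝ :=
  average fun (a : A) (_ : B) => ∫ z, Real.log (mixDen τ (τ a + z)) ∂stdFamily (Fin n)

/-- Bound on the rate of the first user from Fano's inequality. -/
def fanoRate (σ : A → B → Fin n → ℂ) (dec : (Fin n → ℂ) → A) : ℝ :=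
  (1 - average fun a b => (stdFamily (Fin n)).real {z | dec (σ a b + z) ≠ a}) *
    Real.log (Fintype.card A) - Real.log 2

variable [MeasurableSpace A] [MeasurableSingletonClass A]

/-- The genie is trivial here: its observation is pure noise, and its entropy cancels the noise
term. -/
lemma fanoRate_le_of_known {σ : A → B → Fin n → ℂ} {dec : (Fin n → ℂ) → A}
    (hdec : Measurable dec) (μ : B → Fin n → ℂ) {w : ℝ} (hw : 0 < w)
    (hq : average (fun a b => ∑ t, ‖σ a b t - μ b t‖ ^ 2) + n * 1 ≤ n * w) :
    fanoRate σ dec ≤ n * Real.log w := by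
  have := rate_le_of_conditional (σ := σ) (τ := fun _ _ => 0) hdec (r := fun _ => vden 1)
    (fun _ => isDensity_vden) (s := 0) (by simp) 0 μ hw (by simpa [noiseVar] using hq)
  simp_rw [zero_add, integral_log_vden_one, average_const_fun] at this
  simp only [norm_zero, ne_eq, OfNat.ofNat_ne_zero, not_false_eq_true, zero_pow, sub_zero,
    Real.log_one] at this
  unfold fanoRate
  linarith

/-- Again the additional observation is pure noise; only the output entropy given the own message is
retained. -/
lemma fanoRate_le_of_mean {σ : A → B → Fin n → ℂ} {dec : (Fin n → ℂ) → A}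
    (hdec : Measurable dec) (μ : Fin n → ℂ) {w : ℝ} (hw : 0 < w)
    (hq : average (fun a b => ∑ t, ‖σ a b t - μ t‖ ^ 2) + n * 1 ≤ n * w) :
    fanoRate σ dec ≤ condLogLik σ + n * (Real.log Real.pi + 1) + n * Real.log w := by
  have := rate_le_of_mixture (σ := σ) (τ := fun _ => 0) hdec (r := vden 1)
    isDensity_vden 0 μ hw (by simpa using hq)
  simp_rw [zero_add, integral_log_vden_one, average_const_fun] at this
  unfold fanoRate condLogLik
  linarith

end Block

/-! ### The seven bounds for a single code -/

section BlockBounds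

variable {A B : Type*} [Fintype A] [Fintype B] [Nonempty A] [Nonempty B] {n : ℕ}
  [MeasurableSpace A] [MeasurableSingletonClass A] [MeasurableSpace B] [MeasurableSingletonClass B]

lemma mlp2_mul_log_two (g : Gains) : mlp2 g * Real.log 2 =
    Real.log (1 + min (‖g.h12‖ ^ 2) (‖g.h10‖ ^ 2)) +
      Real.log (1 + min (‖g.h21‖ ^ 2) (‖g.h20‖ ^ 2)) + 2 * Real.log 2 := by
  have h2 : Real.log 2 ≠ 0 := (Real.log_pos one_lt_two).ne'
  unfold mlp2 Real.logb
  field_simp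

/-- The seven bounds for the codes of a fixed block length. -/
theorem exists_satisfies_of_code (g : Gains) (hn : 0 < n) (x₁ : A → Fin n → ℂ)
    (x₂ : B → Fin n → ℂ) (x₀ : A → B → Fin n → ℂ)
    (h₁ : (average fun a (_ : B) => ∑ t, ‖x₁ a t‖ ^ 2) ≤ n)
    (h₂ : (average fun (_ : A) b => ∑ t, ‖x₂ b t‖ ^ 2) ≤ n)
    (h₀ : (average fun a b => ∑ t, ‖x₀ a b t‖ ^ 2) ≤ n)
    {dec₁ : (Fin n → ℂ) → A} (hdec₁ : Measurable dec₁) {dec₂ : (Fin n → ℂ) → B}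
    (hdec₂ : Measurable dec₂) :
    ∃ p ∈ corrBall, Satisfies g p
      (fanoRate (fun a b t => g.signal1 (x₁ a t, x₂ b t, x₀ a b t)) dec₁ / (n * Real.log 2),
        fanoRate (fun b a t => g.signal2 (x₁ a t, x₂ b t, x₀ a b t)) dec₂ / (n * Real.log 2)) := by
  obtain ⟨p, hp, m, hform⟩ := exists_average_form_le hn x₁ x₂ x₀ h₁ h₂ h₀
  refine ⟨p, hp, ?_⟩
  have hn' : 0 < (n : ℝ) := by exact_mod_cast hn
  have hlog2 : 0 < Real.log 2 := Real.log_pos one_lt_two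
  set σ₁ : A → B → Fin n → ℂ := fun a b t => g.signal1 (x₁ a t, x₂ b t, x₀ a b t) with hσ₁
  set σ₂ : B → A → Fin n → ℂ := fun b a t => g.signal2 (x₁ a t, x₂ b t, x₀ a b t) with hσ₂
  let τ₁ : A → Fin n → ℂ := fun a t => g.h21 * x₁ a t
  let τ₂ : B → Fin n → ℂ := fun b t => g.h12 * x₂ b t
  set K₁ := fanoRate σ₁ dec₁ with hK₁
  set K₂ := fanoRate σ₂ dec₂ with hK₂
  have q₁ : ∀ (v : ℂ × ℂ × ℂ) (c : ℝ) (F : A → B → Fin n → ℂ),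
      (∀ a b t, F a b t = form v (x₁ a t - m t, x₂ b t, x₀ a b t)) →
      average (fun a b => ∑ t, ‖F a b t‖ ^ 2) + n * c ≤ n * (formVar p v + c) := by
    intro v c F hF
    simp_rw [hF, mul_add]
    gcongr
    exact hform v
  have q₂ : ∀ (v : ℂ × ℂ × ℂ) (c : ℝ) (F : B → A → Fin n → ℂ),
      (∀ b a t, F b a t = form v (x₁ a t - m t, x₂ b t, x₀ a b t)) →
      average (fun b a => ∑ t, ‖F b a t‖ ^ 2) + n * c ≤ n * (formVar p v + c) := by
    intro v c F hF
    rw [average_swap fun a b => ∑ t, ‖F b a t‖ ^ 2]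
    exact q₁ v c (fun a b => F b a) fun a b t => hF b a t
  have pos : ∀ v {c : ℝ}, 0 < c → 0 < formVar p v + c := fun v c hc =>
    add_pos_of_nonneg_of_pos (formVar_nonneg hp v) hc
  have B1 : ∀ α : ℂ, K₁ ≤ n * Real.log (formVar p (g.coef1 - α • unit2) + 1) := fun α =>
    fanoRate_le_of_known hdec₁ (fun b t => α * x₂ b t + ‖g.h11‖ * m t) (pos _ one_pos)
      (q₁ _ _ _ fun a b t => by
        simp [hσ₁, form, Gains.signal1, Gains.coef1, unit2]; ring)
  have B2 : ∀ α : ℂ, K₂ ≤ n * Real.log (formVar p (g.coef2 - α • unit1) + 1) := fun α =>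
    fanoRate_le_of_known hdec₂ (fun a t => α * x₁ a t + (g.h21 - α) * m t) (pos _ one_pos)
      (q₂ _ _ _ fun b a t => by
        simp [hσ₂, form, Gains.signal2, Gains.coef2, unit1]; ring)
  have C1 : K₁ ≤ condLogLik σ₁ + n * (Real.log Real.pi + 1) +
      n * Real.log (formVar p g.coef1 + 1) :=
    fanoRate_le_of_mean hdec₁ (fun t => ‖g.h11‖ * m t) (pos _ one_pos)
      (q₁ _ _ _ fun a b t => by simp [hσ₁, form, Gains.signal1, Gains.coef1]; ring)
  have C2 : K₂ ≤ condLogLik σ₂ + n * (Real.log Real.pi + 1) +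
      n * Real.log (formVar p g.coef2 + 1) :=
    fanoRate_le_of_mean hdec₂ (fun t => g.h21 * m t) (pos _ one_pos)
      (q₂ _ _ _ fun b a t => by simp [hσ₂, form, Gains.signal2, Gains.coef2]; ring)
  -- Receiver 1 is given the other message and a copy of the second output with noise correlation
  -- `s`. The density `mixDen (σ₂ b)` makes the genie's cost equal to `-condLogLik σ₂`, which
  -- cancels against `C2` in the sum bound.
  have G2 : ∀ s : ℂ, ‖s‖ < 1 → ∀ α β : ℂ, K₁ ≤ -condLogLik σ₂ - n * (Real.log Real.pi + 1) +
      n * (Real.log (formVar p (g.coef1 - α • g.coef2 - β • unit2) + noiseVar α s) -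
        Real.log (1 - ‖s‖ ^ 2)) := by
    intro s hs α β
    have := rate_le_of_conditional (σ := σ₁) (τ := fun a b => σ₂ b a) hdec₁
      (fun b => isDensity_mixDen (σ₂ b)) hs α
      (fun b t => β * x₂ b t + (‖g.h11‖ - α * g.h21) * m t) (pos _ (noiseVar_pos α hs))
      (q₁ (g.coef1 - α • g.coef2 - β • unit2) _ _ fun a b t => by
        simp [hσ₁, hσ₂, form, Gains.signal1, Gains.signal2, Gains.coef1, Gains.coef2, unit2]; ring)
    rwa [average_swap fun b a => ∫ z, Real.log (mixDen (σ₂ b) (σ₂ b a + z)) ∂stdFamily (Fin n)]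
      at this
  have G1 : ∀ s : ℂ, ‖s‖ < 1 → ∀ α β : ℂ, K₂ ≤ -condLogLik σ₁ - n * (Real.log Real.pi + 1) +
      n * (Real.log (formVar p (g.coef2 - α • g.coef1 - β • unit1) + noiseVar α s) -
        Real.log (1 - ‖s‖ ^ 2)) := by
    intro s hs α β
    have := rate_le_of_conditional (σ := σ₂) (τ := fun b a => σ₁ a b) hdec₂
      (fun a => isDensity_mixDen (σ₁ a)) hs α
      (fun a t => β * x₁ a t + (g.h21 - α * ‖g.h11‖ - β) * m t) (pos _ (noiseVar_pos α hs))
      (q₂ (g.coef2 - α • g.coef1 - β • unit1) _ _ fun b a t => by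
        simp [hσ₁, hσ₂, form, Gains.signal1, Gains.signal2, Gains.coef1, Gains.coef2, unit1]; ring)
    rwa [average_swap fun a b => ∫ z, Real.log (mixDen (σ₁ a) (σ₁ a b + z)) ∂stdFamily (Fin n)]
      at this
  -- The genie is the noisy interference `h₂₁ X₁ + Z`, which depends only on the receiver's own
  -- message.
  have I1 : ∀ α : ℂ, K₁ ≤ condLogLik σ₁ - inputLogLik B τ₁ +
      n * Real.log (formVar p (g.coef1 - (α * g.h21) • unit1) + (1 + ‖α‖ ^ 2)) := fun α =>
    rate_le_of_mixture hdec₁ (isDensity_mixDen τ₁) α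
      (fun t => (‖g.h11‖ - α * g.h21) * m t) (pos _ (one_add_norm_sq_pos α))
      (q₁ _ _ _ fun a b t => by
        simp [τ₁, hσ₁, form, Gains.signal1, Gains.coef1, unit1]; ring)
  have I2 : ∀ α : ℂ, K₂ ≤ condLogLik σ₂ - inputLogLik A τ₂ +
      n * Real.log (formVar p (g.coef2 - (α * g.h12) • unit2) + (1 + ‖α‖ ^ 2)) := fun α =>
    rate_le_of_mixture hdec₂ (isDensity_mixDen τ₂) α
      (fun t => g.h21 * m t) (pos _ (one_add_norm_sq_pos α))
      (q₂ _ _ _ fun b a t => by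
        simp [τ₂, hσ₂, form, Gains.signal2, Gains.coef2, unit2]; ring)
  have W1 : ∀ α β : ℂ, K₁ ≤ -inputLogLik B τ₁ - n * (Real.log Real.pi + 1) + n *
      Real.log (formVar p (g.coef1 - (α * g.h21) • unit1 - β • unit2) + (1 + ‖α‖ ^ 2)) := by
    intro α β
    have := rate_le_of_conditional (σ := σ₁) (τ := fun a _ => τ₁ a) hdec₁
      (fun _ => isDensity_mixDen τ₁) (s := 0) (by simp) α
      (fun b t => β * x₂ b t + (‖g.h11‖ - α * g.h21) * m t) (pos _ (one_add_norm_sq_pos α))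
      (by
        have e : noiseVar α 0 = 1 + ‖α‖ ^ 2 := by simp [noiseVar, add_comm]
        rw [e]
        exact q₁ (g.coef1 - (α * g.h21) • unit1 - β • unit2) _ _ fun a b t => by
          simp [τ₁, hσ₁, form, Gains.signal1, Gains.coef1, unit1, unit2]; ring)
    rw [norm_zero, zero_pow two_ne_zero, sub_zero, Real.log_one, sub_zero] at this
    exact this
  have W2 : ∀ α β : ℂ, K₂ ≤ -inputLogLik A τ₂ - n * (Real.log Real.pi + 1) + n *
      Real.log (formVar p (g.coef2 - (α * g.h12) • unit2 - β • unit1) + (1 + ‖α‖ ^ 2)) := by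
    intro α β
    have := rate_le_of_conditional (σ := σ₂) (τ := fun b _ => τ₂ b) hdec₂
      (fun _ => isDensity_mixDen τ₂) (s := 0) (by simp) α
      (fun a t => β * x₁ a t + (g.h21 - β) * m t) (pos _ (one_add_norm_sq_pos α))
      (by
        have e : noiseVar α 0 = 1 + ‖α‖ ^ 2 := by simp [noiseVar, add_comm]
        rw [e]
        exact q₂ (g.coef2 - (α * g.h12) • unit2 - β • unit1) _ _ fun b a t => by
          simp [τ₂, hσ₂, form, Gains.signal2, Gains.coef2, unit1, unit2]; ring)
    rw [norm_zero, zero_pow two_ne_zero, sub_zero, Real.log_one, sub_zero] at this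
    exact this
  have scale : ∀ (c : ℂ) (F f : A → B → Fin n → ℂ), (∀ a b t, F a b t = c * f a b t) →
      (average fun a b => ∑ t, ‖f a b t‖ ^ 2) ≤ n →
      (average fun a b => ∑ t, ‖F a b t‖ ^ 2) ≤ n * ‖c‖ ^ 2 := by
    intro c F f hF hf
    simp_rw [hF, norm_mul, mul_pow, ← Finset.mul_sum]
    rw [average_const_mul, mul_comm]
    gcongr
  have M1 : condLogLik σ₂ - inputLogLik B τ₁ ≤
      n * (Real.log (1 + min (‖g.h21‖ ^ 2) (‖g.h20‖ ^ 2)) + Real.log 2) := by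
    have := multiLetter_le (fun a b => σ₂ b a) τ₁ (fun b t => ‖g.h22‖ * x₂ b t)
      (h := ‖g.h21‖ ^ 2) (h' := ‖g.h20‖ ^ 2) (by positivity) (by positivity)
      (scale g.h21 (fun a _ => τ₁ a) (fun a _ => x₁ a) (fun a b t => rfl) h₁) (by
        -- Removing the interference and the own signal from the second output leaves only the relay
        -- part, whose power is at most `‖h₂₀‖²`.
        have := scale (-‖g.h20‖) (fun a b t => τ₁ a t - σ₂ b a t + ‖g.h22‖ * x₂ b t) x₀
          (fun a b t => by simp [τ₁, hσ₂, Gains.signal2]; ring) h₀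
        simpa using this)
    rwa [average_swap fun b a => ∫ z, Real.log (mixDen (σ₂ b) (σ₂ b a + z)) ∂stdFamily (Fin n)]
      at this
  have M2 : condLogLik σ₁ - inputLogLik A τ₂ ≤
      n * (Real.log (1 + min (‖g.h12‖ ^ 2) (‖g.h10‖ ^ 2)) + Real.log 2) := by
    have := multiLetter_le (fun b a => σ₁ a b) τ₂ (fun a t => ‖g.h11‖ * x₁ a t)
      (h := ‖g.h12‖ ^ 2) (h' := ‖g.h10‖ ^ 2) (by positivity) (by positivity)
      (by
        rw [average_swap fun (_ : A) b => ∑ t, ‖τ₂ b t‖ ^ 2]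
        exact scale g.h12 (fun _ b => τ₂ b) (fun _ b => x₂ b) (fun a b t => rfl) h₂) (by
        rw [average_swap fun a b => ∑ t, ‖τ₂ b t - σ₁ a b t + ‖g.h11‖ * x₁ a t‖ ^ 2]
        have := scale (-‖g.h10‖) (fun a b t => τ₂ b t - σ₁ a b t + ‖g.h11‖ * x₁ a t) x₀
          (fun a b t => by simp [τ₂, hσ₁, Gains.signal1]) h₀
        simpa using this)
    rwa [average_swap fun a b => ∫ z, Real.log (mixDen (σ₁ a) (σ₁ a b + z)) ∂stdFamily (Fin n)]
      at this
  have eM := mlp2_mul_log_two g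
  have fin : ∀ {i j : ℝ} {L : ℝ}, i * K₁ + j * K₂ ≤ n * L →
      (i * (K₁ / (n * Real.log 2)) + j * (K₂ / (n * Real.log 2))) * Real.log 2 ≤ L := by
    intro i j L h
    have : (i * (K₁ / (n * Real.log 2)) + j * (K₂ / (n * Real.log 2))) * Real.log 2 =
        (i * K₁ + j * K₂) / n := by field_simp
    rw [this, div_le_iff₀ hn', mul_comm L]
    exact h
  constructor
  · intro α
    have := @fin 1 0 (Real.log (formVar p (g.coef1 - α • unit2) + 1)) (by linarith [B1 α])
    simpa using this
  · intro α
    have := @fin 0 1 (Real.log (formVar p (g.coef2 - α • unit1) + 1)) (by linarith [B2 α])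
    simpa using this
  · intro s hs α β
    have := @fin 1 1 (Real.log (formVar p g.coef2 + 1) +
      (Real.log (formVar p (g.coef1 - α • g.coef2 - β • unit2) + noiseVar α s) -
        Real.log (1 - ‖s‖ ^ 2))) (by linarith [C2, G2 s hs α β])
    simpa using this
  · intro s hs α β
    have := @fin 1 1 (Real.log (formVar p g.coef1 + 1) +
      (Real.log (formVar p (g.coef2 - α • g.coef1 - β • unit1) + noiseVar α s) -
        Real.log (1 - ‖s‖ ^ 2))) (by linarith [C1, G1 s hs α β])
    simpa using this
  · intro α β
    rw [eM]
    -- The leftover log-likelihoods are regrouped across users, output of one with interference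
    -- caused by the other, as in `M1` and `M2`. The weighted bounds leave the same four terms.
    have := @fin 1 1 (Real.log (formVar p (g.coef1 - (α * g.h21) • unit1) + (1 + ‖α‖ ^ 2)) +
      Real.log (formVar p (g.coef2 - (β * g.h12) • unit2) + (1 + ‖β‖ ^ 2)) +
      (Real.log (1 + min (‖g.h12‖ ^ 2) (‖g.h10‖ ^ 2)) +
      Real.log (1 + min (‖g.h21‖ ^ 2) (‖g.h20‖ ^ 2)) + 2 * Real.log 2))
      (by linarith [I1 α, I2 β])
    simpa using this
  · intro α β γ
    rw [eM]
    have := @fin 2 1 (Real.log (formVar p g.coef1 + 1) +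
      Real.log (formVar p (g.coef1 - (α * g.h21) • unit1 - β • unit2) + (1 + ‖α‖ ^ 2)) +
      Real.log (formVar p (g.coef2 - (γ * g.h12) • unit2) + (1 + ‖γ‖ ^ 2)) +
      (Real.log (1 + min (‖g.h12‖ ^ 2) (‖g.h10‖ ^ 2)) +
      Real.log (1 + min (‖g.h21‖ ^ 2) (‖g.h20‖ ^ 2)) + 2 * Real.log 2))
      (by linarith [C1, W1 α β, I2 γ])
    simpa using this
  · intro α β γ
    rw [eM]
    have := @fin 1 2 (Real.log (formVar p g.coef2 + 1) +
      Real.log (formVar p (g.coef2 - (α * g.h12) • unit2 - β • unit1) + (1 + ‖α‖ ^ 2)) +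
      Real.log (formVar p (g.coef1 - (γ * g.h21) • unit1) + (1 + ‖γ‖ ^ 2)) +
      (Real.log (1 + min (‖g.h12‖ ^ 2) (‖g.h10‖ ^ 2)) +
      Real.log (1 + min (‖g.h21‖ ^ 2) (‖g.h20‖ ^ 2)) + 2 * Real.log 2))
      (by linarith [C2, W2 α β, I1 γ])
    simpa using this

end BlockBounds

/-! ### The capacity region -/

section Codes

variable {n k₁ k₂ : ℕ}

lemma messageAverage_eq (f : Fin (2 ^ k₁) → Fin (2 ^ k₂) → ℝ) :
    Code.messageAverage k₁ k₂ f = average f := by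
  simp [Code.messageAverage, average]

lemma map_signal_add (s : Fin n → ℂ) :
    (Measure.pi fun t => stdComplexGaussian.map fun z => s t + z) =
      (stdFamily (Fin n)).map fun z => s + z := by
  have := Measure.pi_map_pi (μ := fun _ : Fin n => stdComplexGaussian)
    (f := fun t z => s t + z) fun t => by fun_prop
  exact this.symm

lemma channelLaw_map_fst (g : Gains) (x : ℂ × ℂ × ℂ) :
    (g.channelLaw x).map Prod.fst = stdComplexGaussian.map fun z => g.signal1 x + z := by
  rw [Gains.channelLaw, Measure.map_map (by fun_prop) (by fun_prop)]
  conv_rhs => rw [← Measure.fst_prod (μ := stdComplexGaussian) (ν := stdComplexGaussian),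
    Measure.fst, Measure.map_map (by fun_prop) (by fun_prop)]
  rfl

lemma channelLaw_map_snd (g : Gains) (x : ℂ × ℂ × ℂ) :
    (g.channelLaw x).map Prod.snd = stdComplexGaussian.map fun z => g.signal2 x + z := by
  rw [Gains.channelLaw, Measure.map_map (by fun_prop) (by fun_prop)]
  conv_rhs => rw [← Measure.snd_prod (μ := stdComplexGaussian) (ν := stdComplexGaussian),
    Measure.snd, Measure.map_map (by fun_prop) (by fun_prop)]
  rfl

instance (g : Gains) (x : ℂ × ℂ × ℂ) : IsProbabilityMeasure (g.channelLaw x) :=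
  Measure.isProbabilityMeasure_map (by fun_prop)

/-- The first error probability in terms of the noise. -/
lemma Code.error1_eq (c : Code n k₁ k₂) (g : Gains) :
    c.error1 g = average fun a b => (stdFamily (Fin n)).real
      {z | c.dec1 ((fun t => g.signal1 (c.enc1 a t, c.enc2 b t, c.enc0 a b t)) + z) ≠ a} := by
  rw [Code.error1, messageAverage_eq]
  congr 1
  funext a b
  have h := Measure.pi_map_pi (μ := fun t => g.channelLaw (c.input a b t))
    (f := fun _ => Prod.fst) fun t => by fun_prop
  simp_rw [channelLaw_map_fst] at h
  rw [map_signal_add] at h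
  have hm : MeasurableSet {u | c.dec1 u ≠ a} :=
    c.measurable_dec1 (measurableSet_singleton a).compl
  have e1 := map_measureReal_apply (μ := c.outputLaw g a b)
    (f := fun y t => (y t).1) (by fun_prop) hm
  have e2 := map_measureReal_apply (μ := stdFamily (Fin n))
    (f := fun z => (fun t => g.signal1 (c.input a b t)) + z) (by fun_prop) hm
  exact e1.symm.trans ((congrArg (fun ν : Measure (Fin n → ℂ) => ν.real _) h).trans e2)

/-- The second error probability in terms of the noise. -/
lemma Code.error2_eq (c : Code n k₁ k₂) (g : Gains) :
    c.error2 g = average fun b a => (stdFamily (Fin n)).real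
      {z | c.dec2 ((fun t => g.signal2 (c.enc1 a t, c.enc2 b t, c.enc0 a b t)) + z) ≠ b} := by
  rw [Code.error2, messageAverage_eq, ← average_swap]
  congr 1
  funext b a
  have h := Measure.pi_map_pi (μ := fun t => g.channelLaw (c.input a b t))
    (f := fun _ => Prod.snd) fun t => by fun_prop
  simp_rw [channelLaw_map_snd] at h
  rw [map_signal_add] at h
  have hm : MeasurableSet {u | c.dec2 u ≠ b} :=
    c.measurable_dec2 (measurableSet_singleton b).compl
  have e1 := map_measureReal_apply (μ := c.outputLaw g a b)
    (f := fun y t => (y t).2) (by fun_prop) hm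
  have e2 := map_measureReal_apply (μ := stdFamily (Fin n))
    (f := fun z => (fun t => g.signal2 (c.input a b t)) + z) (by fun_prop) hm
  exact e1.symm.trans ((congrArg (fun ν : Measure (Fin n → ℂ) => ν.real _) h).trans e2)

/-- The rates that satisfy the seven bounds for a given code. -/
lemma Code.exists_satisfies (g : Gains) (hn : 0 < n) (c : Code n k₁ k₂) (hc : c.PowerConstraint) :
    ∃ p ∈ corrBall, Satisfies g p
      (((1 - c.error1 g) * k₁ - 1) / n, ((1 - c.error2 g) * k₂ - 1) / n) := by
  obtain ⟨h₁, h₂, h₀⟩ := hc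
  rw [messageAverage_eq] at h₁ h₂ h₀
  obtain ⟨p, hp, hS⟩ := exists_satisfies_of_code g hn c.enc1 c.enc2 c.enc0 h₁ h₂ h₀
    c.measurable_dec1 c.measurable_dec2
  refine ⟨p, hp, ?_⟩
  have hlog2 : Real.log 2 ≠ 0 := (Real.log_pos one_lt_two).ne'
  have hn' : (n : ℝ) ≠ 0 := by exact_mod_cast hn.ne'
  -- Since `log (2 ^ k) = k log 2`, division by `log 2` turns Fano's loss into one bit, which
  -- vanishes after division by `n`.
  have e : ∀ (x : ℝ) (k : ℕ), (x * Real.log (Fintype.card (Fin (2 ^ k))) - Real.log 2) /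
      (n * Real.log 2) = (x * k - 1) / n := by
    intro x k
    simp only [Fintype.card_fin, Nat.cast_pow, Nat.cast_ofNat, Real.log_pow]
    field_simp
  unfold fanoRate at hS
  rw [← Code.error1_eq, ← Code.error2_eq, e, e] at hS
  exact hS

end Codes

/-! ### Limit of large block length -/

lemma tendsto_rate {R : ℝ} (hR : 0 ≤ R) {e : ℕ → ℝ} (he : Tendsto e atTop (𝓝 0)) :
    Tendsto (fun n : ℕ => ((1 - e n) * ⌈(n : ℝ) * R⌉₊ - 1) / n) atTop (𝓝 R) := by
  have h1 : Tendsto (fun n : ℕ => (⌈(n : ℝ) * R⌉₊ : ℝ) / n) atTop (𝓝 R) := by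
    have := (tendsto_nat_ceil_mul_div_atTop hR).comp (tendsto_natCast_atTop_atTop (R := ℝ))
    refine this.congr fun n => ?_
    simp [mul_comm]
  have h2 : Tendsto (fun n : ℕ => (1 : ℝ) / n) atTop (𝓝 0) := tendsto_one_div_atTop_nhds_zero_nat
  have h3 := ((he.const_sub 1).mul h1).sub h2
  simp only [sub_zero, one_mul] at h3
  refine h3.congr fun n => ?_
  ring

lemma Achievable.mem_closedFormRegion {g : Gains} {R : ℝ × ℝ} (h : Achievable g R) :
    R ∈ closedFormRegion g := by
  obtain ⟨hR1, hR2, c, hc, he⟩ := h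
  have nonneg : ∀ n, 0 ≤ (c n).error1 g ∧ 0 ≤ (c n).error2 g := by
    intro n
    refine ⟨?_, ?_⟩
    all_goals
      refine div_nonneg (Finset.sum_nonneg fun _ _ => Finset.sum_nonneg fun _ _ => ?_)
        (by positivity)
      exact measureReal_nonneg
  have he1 : Tendsto (fun n => (c n).error1 g) atTop (𝓝 0) :=
    squeeze_zero (fun n => (nonneg n).1) (fun n => le_max_left _ _) he
  have he2 : Tendsto (fun n => (c n).error2 g) atTop (𝓝 0) :=
    squeeze_zero (fun n => (nonneg n).2) (fun n => le_max_right _ _) he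
  refine ⟨hR1, hR2, ?_⟩
  have hlim := (tendsto_rate hR1 he1).prodMk_nhds (tendsto_rate hR2 he2)
  -- The shift by one excludes block length zero, for which rates are not defined.
  exact exists_satisfies_of_tendsto ((tendsto_add_atTop_iff_nat 1).mpr hlim)
    fun n => Code.exists_satisfies g n.succ_pos (c (n + 1)) (hc (n + 1))

theorem capacityRegion_subset (g : Gains) : capacityRegion g ⊆ closedFormRegion g :=
  closure_minimal (convexHull_min (fun _ h => Achievable.mem_closedFormRegion h)
    (convex_closedFormRegion g)) (isClosed_closedFormRegion g)

end ICCR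

end

theorem theorem4 (g : ICCR.Gains) :
    ICCR.capacityRegion g ⊆ ICCR.outerRegion g ∧
      ICCR.outerRegion g = ICCR.gaussianOuterRegion g :=
  have h := ICCR.closedFormRegion_subset g
  ⟨((ICCR.capacityRegion_subset g).trans h).trans (ICCR.gaussianOuterRegion_subset g),
    ((ICCR.outerRegion_subset g).trans h).antisymm (ICCR.gaussianOuterRegion_subset g)⟩
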